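/- **Proposition 1.4.** Let $E\to X$ be a holomorphic vector bundle of rank $r$ over a complex manifold $X$ of dimension $n$, and let $h$ be a singular hermitian metric on $E$, i.e. a measurable map from $X$ to the space of non-negative (finite, possibly degenerate) hermitian forms on the fibres. Suppose that $h$ is negatively curved in the sense of Griffiths, meaning that $\|u\|_h^2$ is plurisubharmonic on $U$ for every open $U\subseteq X$ and every holomorphic section $u$ of $E$ over $U$. For a holomorphic frame $(e_1,\dots,e_r)$ of $E$ over an open set $U$ and holomorphic coordinates $z_1,\dots,z_n$ on (an open part of) $U$, regard $h$ as the matrix-valued function $h=(h_{ab})$ with $h_{ab}=(e_b,e_a)_h$. Then, for every such frame and coordinates: 1. The entries $h_{ab}$ are locally integrable, and the current $\partial h=\sum_j \frac{\partial h}{\partial z_j}\,dz_j$ (entrywise derivatives in the sense of distributions) is locally an $L^2$-valued form: each $\frac{\partial h_{ab}}{\partial z_j}$ is given by a function in $L^2_{loc}$. 2. If $\det h$ does not vanish identically on any connected component of $X$, then $\det h\neq 0$ almost everywhere, and $\theta^h:=h^{-1}\partial h$ is an a.e. well-defined matrix of $(1,0)$-forms: its coefficients $h^{-1}\frac{\partial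 h}{\partial z_j}$ are measurable and, up to null sets, independent of the choice of the functions representing $\frac{\partial h}{\partial z_j}$. 3. Let $W\subseteq X$ be open and let $\{h_\nu\}$ be any sequence of smooth hermitian metrics (degenerate ones being allowed) on $E|_W$, negatively curved in the sense of Griffiths, decreasing pointwise to $h$ on $W$. Then, for every holomorphic frame over an open $U\subseteq W$, $\partial h_\nu$ converges weakly in $L^2$ to $\partial h$ on compact sets: for all $j,a,b$ and every compact subset $K$ of the coordinate domain, $\frac{\partial (h_\nu)_{ab}}{\partial z_j}$ and $\frac{\partial h_{ab}}{\partial z_j}$ lie in $L^2(K)$ and $$\int_K \chi\,\frac{\partial (h_\nu)_{ab}}{\partial z_j}\,d\lambda\;\longrightarrow\;\int_K\chi\,\frac{\partial h_{ab}}{\partial z_j}\,d\lambda\qquad\text{for all }\chi\in L^2(K).$$ -/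

import Mathlib

open MeasureTheory Filter Topology Set Bundle
open scoped Manifold ContDiff

namespace GriffithsMetric

/-! ### Analysis on open subsets of `ℂⁿ` -/

/-- A real-valued function is plurisubharmonic on `Ω ⊆ ℂⁿ` (`Ω` open) if it is upper
semicontinuous on `Ω` and satisfies the sub-mean value inequality
`f a ≤ (1 / 2π) ∫₀^{2π} f (a + e^{iθ} b) dθ` for every closed complex disc
`{a + ζ b : |ζ| ≤ 1}` contained in `Ω`. -/
def IsPSHOn {n : ℕ} (f : (Fin n → ℂ) → ℝ) (Ω : Set (Fin n → ℂ)) : Prop :=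
  UpperSemicontinuousOn f Ω ∧
    ∀ a b : Fin n → ℂ, (∀ ζ : ℂ, ‖ζ‖ ≤ 1 → a + ζ • b ∈ Ω) →
      CircleIntegrable (fun ζ : ℂ => f (a + ζ • b)) 0 1 ∧
        f a ≤ Real.circleAverage (fun ζ : ℂ => f (a + ζ • b)) 0 1

/-- The Wirtinger derivative `∂f/∂z_j = (1/2) (∂f/∂x_j - i ∂f/∂y_j)`. -/
noncomputable def wirtinger {n : ℕ} (j : Fin n) (f : (Fin n → ℂ) → ℂ) (z : Fin n → ℂ) : ℂ :=
  (1 / 2 : ℂ) * (fderiv ℝ f z (Pi.single j 1) - Complex.I * fderiv ℝ f z (Pi.single j Complex.I))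

/-- Smooth complex-valued test functions with compact support in `Ω`. -/
structure IsTestFunction {n : ℕ} (Ω : Set (Fin n → ℂ)) (φ : (Fin n → ℂ) → ℂ) : Prop where
  smooth : ContDiff ℝ ∞ φ
  compact : HasCompactSupport φ
  subset : tsupport φ ⊆ Ω

/-- The value at `φ` of the distribution `∂f/∂z_j`. -/
noncomputable def distWirtinger {n : ℕ} (j : Fin n) (f : (Fin n → ℂ) → ℂ)
    (φ : (Fin n → ℂ) → ℂ) : ℂ :=
  -∫ z, f z * wirtinger j φ z

/-- The distribution `∂f/∂z_j` on `Ω` is given by the locally integrable function `g`. -/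
structure HasWeakWirtinger {n : ℕ} (j : Fin n) (f g : (Fin n → ℂ) → ℂ)
    (Ω : Set (Fin n → ℂ)) : Prop where
  locallyIntegrable : LocallyIntegrableOn f Ω
  locallyIntegrable_deriv : LocallyIntegrableOn g Ω
  eq_integral : ∀ φ, IsTestFunction Ω φ → distWirtinger j f φ = ∫ z, g z * φ z

/-- `g` is in `L²_loc(Ω)`. -/
def IsLocallyL2On {n : ℕ} (g : (Fin n → ℂ) → ℂ) (Ω : Set (Fin n → ℂ)) : Prop :=
  ∀ K ⊆ Ω, IsCompact K → MemLp g 2 (volume.restrict K)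

/-- Weak convergence in `L²` on every compact subset of `Ω`. -/
def WeaklyL2TendstoOn {n : ℕ} (g : ℕ → (Fin n → ℂ) → ℂ) (g₀ : (Fin n → ℂ) → ℂ)
    (Ω : Set (Fin n → ℂ)) : Prop :=
  ∀ K ⊆ Ω, IsCompact K → (∀ ν, MemLp (g ν) 2 (volume.restrict K)) ∧
    MemLp g₀ 2 (volume.restrict K) ∧
    ∀ χ : (Fin n → ℂ) → ℂ, MemLp χ 2 (volume.restrict K) →
      Tendsto (fun ν => ∫ z in K, χ z * g ν z) atTop (𝓝 (∫ z in K, χ z * g₀ z))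

/-- The matrix-valued `(1,0)`-form `∑ j, G j dz_j` represents, entry by entry, the current `∂H`
on `Ω`. -/
def RepresentsDel {n r : ℕ} (H : (Fin n → ℂ) → Matrix (Fin r) (Fin r) ℂ)
    (G : Fin n → (Fin n → ℂ) → Matrix (Fin r) (Fin r) ℂ) (Ω : Set (Fin n → ℂ)) : Prop :=
  ∀ j a b, HasWeakWirtinger j (fun z => H z a b) (fun z => G j z a b) Ω

/-! ### Singular hermitian metrics on holomorphic vector bundles -/

section Bundle

variable {n r : ℕ} {X : Type*} [TopologicalSpace X] [ChartedSpace (Fin n → ℂ) X]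

/-- The complex manifold charts: the maximal holomorphic atlas. -/
def holomorphicCharts (n : ℕ) (X : Type*) [TopologicalSpace X] [ChartedSpace (Fin n → ℂ) X] :
    Set (OpenPartialHomeomorph X (Fin n → ℂ)) :=
  IsManifold.maximalAtlas 𝓘(ℂ, Fin n → ℂ) ω X

/-- The image in `ℂⁿ` of the part of `U` covered by the chart `c`. -/
def chartImage (c : OpenPartialHomeomorph X (Fin n → ℂ)) (U : Set X) : Set (Fin n → ℂ) :=
  c.target ∩ c.symm ⁻¹' U

/-- A real-valued function on (an open subset `U` of) a complex manifold is plurisubharmonic if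
it is so in all holomorphic coordinates. -/
def IsManifoldPSHOn (f : X → ℝ) (U : Set X) : Prop :=
  ∀ c ∈ holomorphicCharts n X, IsPSHOn (f ∘ c.symm) (chartImage c U)

variable (r) (E : X → Type*)
  [TopologicalSpace (TotalSpace (Fin r → ℂ) E)] [∀ x, TopologicalSpace (E x)]
  [∀ x, AddCommGroup (E x)] [∀ x, Module ℂ (E x)] [FiberBundle (Fin r → ℂ) E]

variable {E} in
/-- The section `u` of `E` is holomorphic on `U`. -/
def IsHolomorphicOn (u : ∀ x, E x) (U : Set X) : Prop :=
  ContMDiffOn 𝓘(ℂ, Fin n → ℂ) (𝓘(ℂ, Fin n → ℂ).prod 𝓘(ℂ, Fin r → ℂ)) ω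
    (fun x => TotalSpace.mk' (Fin r → ℂ) x (u x)) U

variable {E} in
/-- `e₁, …, e_r` is a holomorphic frame of `E` over the open set `U`. -/
structure IsHolomorphicFrame (e : Fin r → ∀ x, E x) (U : Set X) : Prop where
  isOpen : IsOpen U
  isFrame : IsLocalFrameOn 𝓘(ℂ, Fin n → ℂ) (Fin r → ℂ) ω e U

/-- A singular hermitian metric: a measurable family of non-negative hermitian forms on the
fibres.  Here `form x t s` is `(s, t)_h` at `x`, linear in `s` and conjugate linear in `t`;
measurability means measurability of the coefficients in holomorphic frames. -/
structure SingularHermitianMetric [MeasurableSpace X] where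
  form : ∀ x, E x →ₗ⋆[ℂ] E x →ₗ[ℂ] ℂ
  conj_symm : ∀ x t s, starRingEnd ℂ (form x t s) = form x s t
  nonneg : ∀ x s, 0 ≤ (form x s s).re
  measurable : ∀ (U : Set X) (e : Fin r → ∀ x, E x), IsHolomorphicFrame (n := n) r e U →
    ∀ a b, Measurable (fun x : U => form x (e a x) (e b x))

variable {r E} [MeasurableSpace X]

namespace SingularHermitianMetric

/-- The function `‖u‖²_h`. -/
noncomputable def normSq (h : SingularHermitianMetric (n := n) r E) (u : ∀ x, E x) (x : X) : ℝ :=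
  (h.form x (u x) (u x)).re

/-- `h` is negatively curved in the sense of Griffiths over the open set `W`: `‖u‖²_h` is
plurisubharmonic for any holomorphic section `u` over any open subset of `W`. -/
def IsGriffithsNegativeOn (h : SingularHermitianMetric (n := n) r E) (W : Set X) : Prop :=
  ∀ U ⊆ W, IsOpen U → ∀ u : ∀ x, E x, IsHolomorphicOn (n := n) r u U →
    IsManifoldPSHOn (n := n) (h.normSq u) U

/-- `h` is negatively curved in the sense of Griffiths. -/
def IsGriffithsNegative (h : SingularHermitianMetric (n := n) r E) : Prop :=
  h.IsGriffithsNegativeOn univ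

/-- The form `h_x` is nondegenerate, i.e. `det h ≠ 0` at `x`. -/
def IsNondegenerateAt (h : SingularHermitianMetric (n := n) r E) (x : X) : Prop :=
  ∀ s : E x, (∀ t : E x, h.form x t s = 0) → s = 0

/-- The matrix of `h` in the frame `e`, as a function of the coordinates `c`: its `(a, b)` entry is
`(e_b, e_a)_h`, so that `(s, t)_h = t* h s` for column vectors `s`, `t`. -/
noncomputable def localMatrix (h : SingularHermitianMetric (n := n) r E)
    (c : OpenPartialHomeomorph X (Fin n → ℂ)) (e : Fin r → ∀ x, E x) (z : Fin n → ℂ) :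
    Matrix (Fin r) (Fin r) ℂ :=
  Matrix.of fun a b => h.form (c.symm z) (e a (c.symm z)) (e b (c.symm z))

/-- `h` is smooth (`C^∞` in the real sense) on the open set `W`. -/
def IsSmoothOn (h : SingularHermitianMetric (n := n) r E) (W : Set X) : Prop :=
  ∀ c ∈ holomorphicCharts n X, ∀ U ⊆ W, ∀ e : Fin r → ∀ x, E x,
    IsHolomorphicFrame (n := n) r e U → ∀ a b,
      ContDiffOn ℝ ∞ (fun z => h.localMatrix c e z a b) (chartImage c U)

/-- The sequence `h' ν` of metrics decreases pointwise to `h` on `W`. -/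
def DecreasesToOn (h' : ℕ → SingularHermitianMetric (n := n) r E)
    (h : SingularHermitianMetric (n := n) r E) (W : Set X) : Prop :=
  ∀ x ∈ W, ∀ s : E x, Antitone (fun ν => ((h' ν).form x s s).re) ∧
    Tendsto (fun ν => ((h' ν).form x s s).re) atTop (𝓝 (h.form x s s).re)

end SingularHermitianMetric

end Bundle

end GriffithsMetric

open GriffithsMetric

/-! Two independent mechanisms are at work: an energy estimate gives the first and third assertions,
and subharmonicity of `log det h` gives the second.

Energy. By polarization (`exists_polarization`) each entry of `h` is a fixed combination of four
functions ‖v‖²_h with `v` constant in the frame, so it suffices to treat a non-negative, locally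
bounded plurisubharmonic function f. Formally Δ(f²) ≥ 2|∇f|², and testing against a cutoff χ bounds
∫ χ|∇f|² by ∫ f²|Δχ|. Since f has no classical derivatives, the gradient is replaced by differences
f(z + ζb) − f(z) averaged over |ζ| = 1 (`energy_le`). Dually, |∫ f ∂φ/∂z_j| ≤ A M² + ‖φ‖² for test
functions φ on a fixed compact set, where M bounds f on a slightly larger one
(`exists_norm_integral_mul_wirtinger_le`). Scaling φ and Riesz representation then produce the L²
derivative. As A does not depend on f, a decreasing sequence satisfies one common bound; dominated
convergence gives convergence of the distributions, and density of test functions upgrades it to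
weak L² convergence.

Determinant. For a smooth positive definite metric G on a disc, choose a holomorphic frame P at z₀
with K = P*GP = 1 + O(|z − z₀|²). Then log det K ≥ tr K − r − 2 tr (K − 1)². The trace is a sum of
squared norms of holomorphic sections, hence has the sub-mean value property; the last term is O(t⁴)
on the circle of radius t; and log|det P| is harmonic near z₀
(`exists_sub_le_circleAverage_log_det`). An error of smaller order than t² does no harm, by a
maximum principle argument (`le_circleAverage_of_local`). A singular h is restricted to a disc
through a nondegenerate centre and approximated there by mollification plus a small multiple of the
identity. Fatou's lemma applied to −log det shows that det h ≠ 0 almost everywhere on the circle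
(`ae_circle_det_ne_zero`); Fubini and rotation invariance extend this to balls, and connectedness to
all of X. -/

namespace GriffithsMetric

/-! ### The uniform measure on the unit circle -/

/-- The uniform probability measure on the unit circle of `ℂ`. -/
noncomputable def unitCircleMeasure : Measure ℂ :=
  ENNReal.ofReal (2 * Real.pi)⁻¹ •
    (volume.restrict (Ioc 0 (2 * Real.pi))).map (circleMap 0 1)

instance isProbabilityMeasure_unitCircleMeasure : IsProbabilityMeasure unitCircleMeasure := by
  constructor
  have h : Measurable (circleMap 0 1) := (continuous_circleMap 0 1).measurable
  rw [unitCircleMeasure, Measure.smul_apply, Measure.map_apply h MeasurableSet.univ, preimage_univ,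
    Measure.restrict_apply_univ, Real.volume_Ioc, smul_eq_mul, sub_zero,
    ← ENNReal.ofReal_mul (by positivity), inv_mul_cancel₀ (by positivity), ENNReal.ofReal_one]

lemma ae_norm_eq_one : ∀ᵐ ζ ∂unitCircleMeasure, ‖ζ‖ = 1 := by
  have h : Measurable (circleMap 0 1) := (continuous_circleMap 0 1).measurable
  refine Measure.ae_smul_measure ?_ _
  rw [ae_map_iff h.aemeasurable (measurableSet_eq_fun measurable_norm measurable_const)]
  filter_upwards with θ
  simp

/-- Writing circle averages as integrals against a probability measure makes Fubini's theorem and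
the comparison results for Bochner integrals available. -/
lemma integral_unitCircleMeasure {F : Type*} [NormedAddCommGroup F] [NormedSpace ℝ F]
    {f : ℂ → F} (hf : AEStronglyMeasurable f unitCircleMeasure) :
    ∫ ζ, f ζ ∂unitCircleMeasure = Real.circleAverage f 0 1 := by
  have h : Measurable (circleMap 0 1) := (continuous_circleMap 0 1).measurable
  have h0 : ENNReal.ofReal (2 * Real.pi)⁻¹ ≠ 0 := by
    rw [Ne, ENNReal.ofReal_eq_zero, not_le]; positivity
  have hf' : AEStronglyMeasurable f ((volume.restrict (Ioc 0 (2 * Real.pi))).map (circleMap 0 1)) :=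
    hf.mono_ac (Measure.absolutelyContinuous_smul h0)
  rw [unitCircleMeasure, integral_smul_measure, integral_map h.aemeasurable hf',
    Real.circleAverage_def, intervalIntegral.integral_of_le (by positivity),
    ENNReal.toReal_ofReal (by positivity)]

lemma integral_unitCircleMeasure_id : ∫ ζ : ℂ, ζ ∂unitCircleMeasure = 0 := by
  rw [integral_unitCircleMeasure (by fun_prop)]
  exact DiffContOnCl.circleAverage (f := fun z => z) differentiable_id.diffContOnCl

lemma integral_unitCircleMeasure_sq : ∫ ζ : ℂ, ζ ^ 2 ∂unitCircleMeasure = 0 := by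
  rw [integral_unitCircleMeasure (by fun_prop), DiffContOnCl.circleAverage (f := fun z => z ^ 2)]
  · simp
  · exact Differentiable.diffContOnCl (by fun_prop)

lemma integral_unitCircleMeasure_conj :
    ∫ ζ : ℂ, starRingEnd ℂ ζ ∂unitCircleMeasure = 0 := by
  rw [integral_conj, integral_unitCircleMeasure_id, map_zero]

lemma integral_unitCircleMeasure_conj_sq :
    ∫ ζ : ℂ, (starRingEnd ℂ ζ) ^ 2 ∂unitCircleMeasure = 0 := by
  simp_rw [← map_pow]
  rw [integral_conj, integral_unitCircleMeasure_sq, map_zero]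

lemma integrable_unitCircleMeasure_of_bound {F : Type*} [NormedAddCommGroup F] {f : ℂ → F}
    (hf : AEStronglyMeasurable f unitCircleMeasure) (C : ℝ) (h : ∀ ζ, ‖ζ‖ = 1 → ‖f ζ‖ ≤ C) :
    Integrable f unitCircleMeasure :=
  Integrable.of_bound hf C (ae_norm_eq_one.mono h)

lemma integrable_unitCircleMeasure_of_continuous {F : Type*} [NormedAddCommGroup F] {f : ℂ → F}
    (hf : Continuous f) : Integrable f unitCircleMeasure := by
  obtain ⟨C, hC⟩ := (isCompact_sphere (0 : ℂ) 1).exists_bound_of_continuousOn hf.continuousOn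
  exact integrable_unitCircleMeasure_of_bound hf.aestronglyMeasurable C
    fun ζ hζ => hC ζ (by simpa using hζ)

lemma integral_unitCircleMeasure_realLinear {F : Type*} [NormedAddCommGroup F] [NormedSpace ℝ F]
    [CompleteSpace F] (L : ℂ →L[ℝ] F) : ∫ ζ : ℂ, L ζ ∂unitCircleMeasure = 0 := by
  rw [ContinuousLinearMap.integral_comp_comm L (φ := fun ζ => ζ)
    (integrable_unitCircleMeasure_of_continuous continuous_id), integral_unitCircleMeasure_id,
    map_zero]

/-! ### First order Taylor estimates -/

/-- The derivative of a compactly supported smooth function is globally Lipschitz, so one constant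
serves all base points. For a cutoff, this constant is what enters the final estimates. -/
lemma exists_taylor_bound {E F : Type*} [NormedAddCommGroup E] [NormedSpace ℝ E]
    [NormedAddCommGroup F] [NormedSpace ℝ F] {f : E → F} (hf : ContDiff ℝ ∞ f)
    (hc : HasCompactSupport f) :
    ∃ C : ℝ, 0 ≤ C ∧ ∀ z w, ‖f (z + w) - f z - fderiv ℝ f z w‖ ≤ C * ‖w‖ ^ 2 := by
  have h1 : ContDiff ℝ 1 (fderiv ℝ f) := hf.fderiv_right (by norm_cast)
  obtain ⟨C, hC⟩ := h1.lipschitzWith_of_hasCompactSupport (hc.fderiv (𝕜 := ℝ)) (by norm_num)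
  refine ⟨C, C.2, fun z w => ?_⟩
  have hd : Differentiable ℝ f := hf.differentiable (by simp)
  have := Convex.norm_image_sub_le_of_norm_hasFDerivWithin_le' (f := f) (f' := fderiv ℝ f)
    (φ := fderiv ℝ f z) (s := segment ℝ z (z + w)) (C := C * ‖w‖) (x := z) (y := z + w)
    (fun x _ => (hd x).hasFDerivAt.hasFDerivWithinAt) (fun x hx => ?_) (convex_segment _ _)
    (left_mem_segment _ _ _) (right_mem_segment _ _ _)
  · simpa [pow_two, mul_assoc] using this
  · refine (hC.norm_sub_le x z).trans (mul_le_mul_of_nonneg_left ?_ C.2)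
    obtain ⟨t, ht, rfl⟩ := segment_eq_image' ℝ z (z + w) ▸ hx
    simp only [add_sub_cancel_left]
    rw [norm_smul, Real.norm_of_nonneg ht.1]
    exact mul_le_of_le_one_left (norm_nonneg _) ht.2

/-! ### A discrete Caccioppoli inequality -/

lemma integrable_prod_unitCircleMeasure {n : ℕ} {F : Type*} [NormedAddCommGroup F]
    {f : (Fin n → ℂ) × ℂ → F} (hf : AEStronglyMeasurable f (volume.prod unitCircleMeasure))
    {K : Set (Fin n → ℂ)} (hK : IsCompact K) (B : ℝ)
    (hB : ∀ z ζ, ‖ζ‖ = 1 → ‖f (z, ζ)‖ ≤ B) (h0 : ∀ z ζ, z ∉ K → f (z, ζ) = 0) :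
    Integrable f (volume.prod unitCircleMeasure) := by
  have hg : Integrable (fun p : (Fin n → ℂ) × ℂ => (K ×ˢ univ).indicator (fun _ => B) p)
      (volume.prod unitCircleMeasure) := by
    refine (integrable_indicator_iff (hK.measurableSet.prod MeasurableSet.univ)).2 ?_
    refine integrableOn_const ?_
    rw [Measure.prod_prod]
    simpa using hK.measure_lt_top.ne
  refine hg.mono' hf ?_
  have h1 : ∀ᵐ p ∂(volume.prod unitCircleMeasure : Measure ((Fin n → ℂ) × ℂ)), ‖p.2‖ = 1 :=
    Measure.quasiMeasurePreserving_snd.ae ae_norm_eq_one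
  filter_upwards [h1] with p hp
  by_cases hz : p.1 ∈ K
  · rw [indicator_of_mem (by simpa using hz)]
    exact hB p.1 p.2 hp
  · rw [indicator_of_notMem (by simpa using hz), h0 p.1 p.2 hz, norm_zero]

/-- Discrete form of Δ(f²) ≥ 2|∇f|² tested against χ. Translation invariance moves the circular
average from f² to χ, and there it differs from χ by at most `C * ‖b‖ ^ 2`. -/
lemma energy_le {n : ℕ} {f χ : (Fin n → ℂ) → ℝ} {M C : ℝ} {L : Set (Fin n → ℂ)} {b : Fin n → ℂ}
    (hfm : Measurable f) (hf0 : ∀ z, 0 ≤ f z) (hfM : ∀ z, f z ≤ M) (hL : IsCompact L)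
    (hfL : ∀ z, z ∉ L → f z = 0) (hχ : ContDiff ℝ ∞ χ) (hχc : HasCompactSupport χ)
    (hχ0 : ∀ z, 0 ≤ χ z)
    (hC : ∀ z w, ‖χ (z + w) - χ z - fderiv ℝ χ z w‖ ≤ C * ‖w‖ ^ 2)
    (hsub : ∀ z, χ z ≠ 0 → f z ≤ ∫ ζ, f (z + ζ • b) ∂unitCircleMeasure) :
    ∫ z, ∫ ζ, χ z * (f (z + ζ • b) - f z) ^ 2 ∂unitCircleMeasure ≤ C * ‖b‖ ^ 2 * ∫ z, f z ^ 2 := by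
  have hM : 0 ≤ M := (hf0 0).trans (hfM 0)
  obtain ⟨B, hB⟩ := hχc.exists_bound_of_continuous hχ.continuous
  have hB0 : 0 ≤ B := (norm_nonneg _).trans (hB 0)
  have hχm : Measurable χ := hχ.continuous.measurable
  have hfabs : ∀ z, ‖f z‖ ≤ M := fun z => by rw [Real.norm_of_nonneg (hf0 z)]; exact hfM z
  have hsq : ∀ z, f z ^ 2 ≤ M ^ 2 := fun z => pow_le_pow_left₀ (hf0 z) (hfM z) 2
  have hχz : ∀ z, z ∉ tsupport χ → χ z = 0 := fun z => image_eq_zero_of_notMem_tsupport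
  have i1 : Integrable (fun p : (Fin n → ℂ) × ℂ => χ p.1 * (f (p.1 + p.2 • b) - f p.1) ^ 2)
      (volume.prod unitCircleMeasure) := by
    refine integrable_prod_unitCircleMeasure (by fun_prop) hχc (B * (M ^ 2)) (fun z ζ _ => ?_)
      (fun z ζ hz => by simp [hχz z hz])
    rw [norm_mul, norm_pow]
    have : ‖f (z + ζ • b) - f z‖ ≤ M := by
      rw [Real.norm_eq_abs, abs_le]
      constructor <;> linarith [hf0 z, hfM z, hf0 (z + ζ • b), hfM (z + ζ • b)]
    gcongr
    exact hB z
  have i2 : Integrable (fun p : (Fin n → ℂ) × ℂ => χ p.1 * f (p.1 + p.2 • b) ^ 2)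
      (volume.prod unitCircleMeasure) := by
    refine integrable_prod_unitCircleMeasure (by fun_prop) hχc (B * (M ^ 2)) (fun z ζ _ => ?_)
      (fun z ζ hz => by simp [hχz z hz])
    rw [norm_mul, norm_pow]
    gcongr
    exacts [hB z, hfabs _]
  have i3 : Integrable (fun p : (Fin n → ℂ) × ℂ => χ (p.1 - p.2 • b) * f p.1 ^ 2)
      (volume.prod unitCircleMeasure) := by
    refine integrable_prod_unitCircleMeasure (by fun_prop) hL (B * (M ^ 2)) (fun z ζ _ => ?_)
      (fun z ζ hz => by simp [hfL z hz])
    rw [norm_mul, norm_pow]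
    gcongr
    exacts [hB _, hfabs _]
  have i4 : Integrable (fun z => f z ^ 2) := by
    have : IntegrableOn (fun z => f z ^ 2) L := by
      refine Measure.integrableOn_of_bounded hL.measure_lt_top.ne (by fun_prop) (M := M ^ 2) ?_
      filter_upwards with z
      rw [Real.norm_of_nonneg (sq_nonneg _)]
      exact hsq z
    rwa [integrableOn_iff_integrable_of_support_subset] at this
    intro z hz
    by_contra hzL
    simp [hfL z hzL] at hz
  have i5 : Integrable (fun z => χ z * f z ^ 2) :=
    i4.bdd_mul hχm.aestronglyMeasurable (Eventually.of_forall hB)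
  -- Expanding the square, the cross term −2 f(z) ∫ f(z + ζb) is at most −2 f(z)², by the sub-mean
  -- value inequality and f(z) ≥ 0. Where χ vanishes nothing is needed.
  have pw : ∀ z, ∫ ζ, χ z * (f (z + ζ • b) - f z) ^ 2 ∂unitCircleMeasure ≤
      (∫ ζ, χ z * f (z + ζ • b) ^ 2 ∂unitCircleMeasure) - χ z * f z ^ 2 := by
    intro z
    have j1 : Integrable (fun ζ : ℂ => f (z + ζ • b)) unitCircleMeasure :=
      integrable_unitCircleMeasure_of_bound
        (by fun_prop : Measurable fun ζ : ℂ => f (z + ζ • b)).aestronglyMeasurable M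
        fun ζ _ => hfabs _
    have j2 : Integrable (fun ζ : ℂ => f (z + ζ • b) ^ 2) unitCircleMeasure :=
      integrable_unitCircleMeasure_of_bound
        (by fun_prop : Measurable fun ζ : ℂ => f (z + ζ • b) ^ 2).aestronglyMeasurable (M ^ 2)
        fun ζ _ => by
        rw [Real.norm_of_nonneg (sq_nonneg _)]
        exact hsq _
    have e : (∫ ζ, (f (z + ζ • b) - f z) ^ 2 ∂unitCircleMeasure) =
        (∫ ζ, f (z + ζ • b) ^ 2 ∂unitCircleMeasure)
          - 2 * f z * (∫ ζ, f (z + ζ • b) ∂unitCircleMeasure) + f z ^ 2 := by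
      have : (fun ζ : ℂ => (f (z + ζ • b) - f z) ^ 2) =
          fun ζ : ℂ => f (z + ζ • b) ^ 2 - 2 * f z * f (z + ζ • b) + f z ^ 2 := by
        ext ζ; ring
      have j3 : Integrable (fun ζ : ℂ => f (z + ζ • b) ^ 2 - 2 * f z * f (z + ζ • b))
        unitCircleMeasure := j2.sub (j1.const_mul _)
      rw [this, integral_add j3 (integrable_const _), integral_sub j2 (j1.const_mul _),
        integral_const_mul]
      simp
    rw [integral_const_mul, integral_const_mul, e]
    by_cases hz : χ z = 0
    · simp [hz]
    · have h1 := mul_nonneg (hf0 z) (sub_nonneg.2 (hsub z hz))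
      nlinarith [mul_nonneg (hχ0 z) h1]
  -- The linear Taylor term has mean zero over the circle, so only the quadratic remainder survives.
  have avg : ∀ z, ∫ ζ, χ (z - ζ • b) ∂unitCircleMeasure ≤ χ z + C * ‖b‖ ^ 2 := by
    intro z
    have hl : ∫ ζ : ℂ, fderiv ℝ χ z (-(ζ • b)) ∂unitCircleMeasure = 0 := by
      have := integral_unitCircleMeasure_realLinear
        ((fderiv ℝ χ z).comp (-((ContinuousLinearMap.toSpanSingleton ℂ b).restrictScalars ℝ)))
      simpa using this
    have jl : Integrable (fun ζ : ℂ => fderiv ℝ χ z (-(ζ • b))) unitCircleMeasure :=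
      integrable_unitCircleMeasure_of_continuous (by fun_prop)
    have hχcont : Continuous χ := hχ.continuous
    calc ∫ ζ, χ (z - ζ • b) ∂unitCircleMeasure
        ≤ ∫ ζ : ℂ, ((χ z + C * ‖b‖ ^ 2) + fderiv ℝ χ z (-(ζ • b))) ∂unitCircleMeasure := by
          refine integral_mono_ae (integrable_unitCircleMeasure_of_continuous (by fun_prop))
            ((integrable_const _).add jl) ?_
          filter_upwards [ae_norm_eq_one] with ζ hζ
          have := (abs_le.1 (hC z (-(ζ • b)))).2
          rw [norm_neg, norm_smul, hζ, one_mul, ← sub_eq_add_neg] at this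
          linarith
      _ = _ := by rw [integral_add (integrable_const _) jl, hl]; simp
  have swap : ∫ z, ∫ ζ, χ z * f (z + ζ • b) ^ 2 ∂unitCircleMeasure =
      ∫ z, (∫ ζ, χ (z - ζ • b) ∂unitCircleMeasure) * f z ^ 2 := by
    rw [integral_integral_swap i2]
    have : ∀ ζ : ℂ, ∫ z, χ z * f (z + ζ • b) ^ 2 = ∫ z, χ (z - ζ • b) * f z ^ 2 := by
      intro ζ
      rw [← integral_add_right_eq_self (fun z => χ (z - ζ • b) * f z ^ 2) (ζ • b)]
      simp
    simp_rw [this]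
    rw [← integral_integral_swap i3]
    simp_rw [integral_mul_const]
  have i6 : Integrable (fun z => (∫ ζ, χ (z - ζ • b) ∂unitCircleMeasure) * f z ^ 2) := by
    have := i3.integral_prod_left
    simpa only [integral_mul_const] using this
  calc ∫ z, ∫ ζ, χ z * (f (z + ζ • b) - f z) ^ 2 ∂unitCircleMeasure
      ≤ ∫ z, ((∫ ζ, χ z * f (z + ζ • b) ^ 2 ∂unitCircleMeasure) - χ z * f z ^ 2) :=
        integral_mono i1.integral_prod_left (i2.integral_prod_left.sub i5) pw
    _ = (∫ z, (∫ ζ, χ (z - ζ • b) ∂unitCircleMeasure) * f z ^ 2) - ∫ z, χ z * f z ^ 2 := by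
        rw [integral_sub i2.integral_prod_left i5, swap]
    _ ≤ (∫ z, (χ z * f z ^ 2 + C * ‖b‖ ^ 2 * f z ^ 2)) - ∫ z, χ z * f z ^ 2 := by
        gcongr ?_ - _
        refine integral_mono i6 (i5.add (i4.const_mul _)) fun z => ?_
        have := mul_le_mul_of_nonneg_right (avg z) (sq_nonneg (f z))
        simpa [add_mul] using this
    _ = C * ‖b‖ ^ 2 * ∫ z, f z ^ 2 := by
        rw [integral_add i5 (i4.const_mul _), integral_const_mul]
        ring

/-- The differential applied to ζρe_j is ρ(ζ ∂φ/∂z_j + ζ̄ ∂φ/∂z̄_j). After multiplication by ζ̄ the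
first term is constant on |ζ| = 1, while the second carries ζ̄², whose mean is zero. -/
lemma integral_conj_mul_fderiv_single {n : ℕ} (j : Fin n) (φ : (Fin n → ℂ) → ℂ)
    (z : Fin n → ℂ) (ρ : ℝ) :
    ∫ ζ : ℂ, starRingEnd ℂ ζ * fderiv ℝ φ z (ζ • (ρ • (Pi.single j 1 : Fin n → ℂ)))
      ∂unitCircleMeasure =
      ρ * wirtinger j φ z := by
  set D := fderiv ℝ φ z
  have key : ∀ ζ : ℂ, ‖ζ‖ = 1 → starRingEnd ℂ ζ * D (ζ • (ρ • (Pi.single j 1 : Fin n → ℂ))) =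
      ρ * wirtinger j φ z + (starRingEnd ℂ ζ) ^ 2 *
        (ρ * ((1 / 2 : ℂ) * (D (Pi.single j 1) + Complex.I * D (Pi.single j Complex.I)))) := by
    intro ζ hζ
    have e1 : ζ • (ρ • (Pi.single j 1 : Fin n → ℂ)) =
        (ρ * ζ.re) • (Pi.single j 1 : Fin n → ℂ) + (ρ * ζ.im) • (Pi.single j Complex.I : Fin n → ℂ) := by
      ext k
      by_cases hk : k = j
      · subst hk
        simp only [Pi.smul_apply, Pi.single_eq_same, Pi.add_apply, Complex.real_smul, smul_eq_mul]
        conv_lhs => rw [← Complex.re_add_im ζ]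
        push_cast
        ring
      · simp [hk]
    have h1 : starRingEnd ℂ ζ * ζ = 1 := by
      rw [mul_comm, Complex.mul_conj, Complex.normSq_eq_norm_sq, hζ]; simp
    have h2 : (ζ.re : ℂ) = (ζ + starRingEnd ℂ ζ) / 2 := by
      rw [Complex.add_conj]; push_cast; ring
    have h3 : (ζ.im : ℂ) = -Complex.I * (ζ - starRingEnd ℂ ζ) / 2 := by
      rw [Complex.sub_conj]; push_cast; linear_combination (ζ.im : ℂ) * Complex.I_sq
    rw [e1, map_add, map_smul, map_smul, Complex.real_smul, Complex.real_smul]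
    push_cast
    rw [h2, h3, wirtinger]
    linear_combination ((ρ : ℂ) / 2 * (D (Pi.single j 1) - Complex.I * D (Pi.single j Complex.I)))
      * h1
  have i1 : Integrable (fun _ : ℂ => (ρ : ℂ) * wirtinger j φ z) unitCircleMeasure :=
    integrable_const _
  rw [integral_congr_ae (ae_norm_eq_one.mono key), integral_add i1
    (integrable_unitCircleMeasure_of_continuous (by fun_prop)),
    integral_mul_const _ (fun ζ : ℂ => (starRingEnd ℂ ζ) ^ 2), integral_unitCircleMeasure_conj_sq]
  simp

/-- With b = ρe_j, the derivative ∂φ/∂z_j is ρ⁻¹ times the mean of ζ̄ φ(z + ζb), up to O(ρ). A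
translation turns this into differences of f, to which `energy_le` applies; then ρ tends to 0. The
additive right-hand side is made homogeneous later, in `norm_le_mul_norm_testToLp`. -/
lemma norm_integral_mul_wirtinger_le {n : ℕ} {f χ : (Fin n → ℂ) → ℝ} {φ : (Fin n → ℂ) → ℂ}
    {M C ρ₀ : ℝ} {L : Set (Fin n → ℂ)} (j : Fin n)
    (hfm : Measurable f) (hf0 : ∀ z, 0 ≤ f z) (hfM : ∀ z, f z ≤ M) (hL : IsCompact L)
    (hfL : ∀ z, z ∉ L → f z = 0) (hχ : ContDiff ℝ ∞ χ) (hχc : HasCompactSupport χ)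
    (hχ0 : ∀ z, 0 ≤ χ z)
    (hC : ∀ z w, ‖χ (z + w) - χ z - fderiv ℝ χ z w‖ ≤ C * ‖w‖ ^ 2) (hρ₀ : 0 < ρ₀)
    (hsub : ∀ z, χ z ≠ 0 → ∀ b, ‖b‖ < ρ₀ → f z ≤ ∫ ζ, f (z + ζ • b) ∂unitCircleMeasure)
    (hφ : ContDiff ℝ ∞ φ) (hφc : HasCompactSupport φ) (hχφ : ∀ z, φ z ≠ 0 → χ z = 1) :
    ‖∫ z, (f z : ℂ) * wirtinger j φ z‖ ≤ C * (∫ z, f z ^ 2) + ∫ z, ‖φ z‖ ^ 2 := by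
  have hM : 0 ≤ M := (hf0 0).trans (hfM 0)
  obtain ⟨C', hC'0, hC'⟩ := exists_taylor_bound hφ hφc
  obtain ⟨B, hB⟩ := hφc.exists_bound_of_continuous hφ.continuous
  have hB0 : 0 ≤ B := (norm_nonneg _).trans (hB 0)
  obtain ⟨B', hB'⟩ := hχc.exists_bound_of_continuous hχ.continuous
  have hB'0 : 0 ≤ B' := (norm_nonneg _).trans (hB' 0)
  have hφm : Measurable φ := hφ.continuous.measurable
  have hχm : Measurable χ := hχ.continuous.measurable
  have hφcont : Continuous φ := hφ.continuous
  have hφ0 : ∀ z, z ∉ tsupport φ → φ z = 0 := fun z => image_eq_zero_of_notMem_tsupport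
  have hχz : ∀ z, z ∉ tsupport χ → χ z = 0 := fun z => image_eq_zero_of_notMem_tsupport
  have hfabs : ∀ z, ‖f z‖ ≤ M := fun z => by rw [Real.norm_of_nonneg (hf0 z)]; exact hfM z
  have hwc : Continuous (wirtinger j φ) := by
    have := hφ.continuous_fderiv (by simp)
    unfold wirtinger
    fun_prop
  have fi : Integrable f := by
    have : IntegrableOn f L :=
      Measure.integrableOn_of_bounded hL.measure_lt_top.ne (by fun_prop) (M := M)
        (Eventually.of_forall hfabs)
    rwa [integrableOn_iff_integrable_of_support_subset] at this
    intro z hz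
    by_contra hzL
    simp [hfL z hzL] at hz
  have φi : Integrable (fun z => ‖φ z‖ ^ 2) := by
    refine Continuous.integrable_of_hasCompactSupport (by fun_prop) ?_
    exact hφc.comp_left (g := fun x : ℂ => ‖x‖ ^ 2) (by simp)
  have fwi : Integrable (fun z => (f z : ℂ) * wirtinger j φ z) := by
    have : HasCompactSupport (wirtinger j φ) := by
      unfold wirtinger
      have h1 := hφc.fderiv (𝕜 := ℝ)
      exact h1.comp_left (g := fun D : (Fin n → ℂ) →L[ℝ] ℂ => (1 / 2 : ℂ) * (D (Pi.single j 1)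
        - Complex.I * D (Pi.single j Complex.I))) (by simp)
    obtain ⟨B'', hB''⟩ := this.exists_bound_of_continuous hwc
    exact fi.ofReal.mul_bdd hwc.aestronglyMeasurable (Eventually.of_forall hB'')
  -- The additional term `C' * ρ * ∫ z, f z` comes from the second-order remainder of φ and
  -- disappears in the limit.
  have step : ∀ ρ : ℝ, 0 < ρ → ρ < ρ₀ → ‖∫ z, (f z : ℂ) * wirtinger j φ z‖ ≤
      C * (∫ z, f z ^ 2) + (∫ z, ‖φ z‖ ^ 2) + C' * ρ * ∫ z, f z := by
    intro ρ hρ hρρ₀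
    set b : Fin n → ℂ := ρ • Pi.single j 1 with hb
    have hbn : ‖b‖ = ρ := by
      rw [hb, norm_smul, Pi.norm_single]
      simp [hρ.le]
    -- the averaged difference quotient of `φ`
    have i1 : Integrable (fun p : (Fin n → ℂ) × ℂ =>
        (f p.1 : ℂ) * (starRingEnd ℂ p.2 * φ (p.1 + p.2 • b))) (volume.prod unitCircleMeasure) := by
      refine integrable_prod_unitCircleMeasure ?_ hL (M * (1 * B)) (fun z ζ hζ => ?_)
        (fun z ζ hz => by simp [hfL z hz])
      · have : Measurable (starRingEnd ℂ) := Complex.continuous_conj.measurable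
        have : Measurable fun p : (Fin n → ℂ) × ℂ =>
          (f p.1 : ℂ) * (starRingEnd ℂ p.2 * φ (p.1 + p.2 • b)) := by fun_prop
        exact this.aestronglyMeasurable
      · rw [norm_mul, norm_mul, RCLike.norm_conj, hζ, Complex.norm_real]
        gcongr
        exacts [hfabs z, hB _]
    have hI1 : ‖(∫ z, (f z : ℂ) * ∫ ζ, starRingEnd ℂ ζ * φ (z + ζ • b) ∂unitCircleMeasure)
        - ρ * ∫ z, (f z : ℂ) * wirtinger j φ z‖ ≤ C' * ρ ^ 2 * ∫ z, f z := by
      rw [← integral_const_mul, ← integral_sub ?_ (fwi.const_mul _)]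
      · have : ∀ z, ‖(f z : ℂ) * (∫ ζ, starRingEnd ℂ ζ * φ (z + ζ • b) ∂unitCircleMeasure)
            - ρ * ((f z : ℂ) * wirtinger j φ z)‖ ≤ C' * ρ ^ 2 * f z := by
          intro z
          -- Because ζ̄ has mean zero, φ(z) may be subtracted at no cost, which leaves the Taylor
          -- remainder.
          have e : (∫ ζ, starRingEnd ℂ ζ * φ (z + ζ • b) ∂unitCircleMeasure) - ρ * wirtinger j φ z
              = ∫ ζ, starRingEnd ℂ ζ * (φ (z + ζ • b) - φ z - fderiv ℝ φ z (ζ • b))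
                ∂unitCircleMeasure := by
            simp_rw [mul_sub]
            rw [integral_sub, integral_sub, integral_mul_const, integral_unitCircleMeasure_conj,
              hb, integral_conj_mul_fderiv_single]
            · simp
            all_goals exact integrable_unitCircleMeasure_of_continuous (by fun_prop)
          have e2 : (f z : ℂ) * (∫ ζ, starRingEnd ℂ ζ * φ (z + ζ • b) ∂unitCircleMeasure)
            - ρ * ((f z : ℂ) * wirtinger j φ z) = f z *
            ((∫ ζ, starRingEnd ℂ ζ * φ (z + ζ • b) ∂unitCircleMeasure) - ρ * wirtinger j φ z) := by
            ring
          rw [e2, norm_mul, e, Complex.norm_real, Real.norm_of_nonneg (hf0 z), mul_comm]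
          refine mul_le_mul_of_nonneg_right ?_ (hf0 z)
          have := norm_integral_le_of_norm_le_const (μ := unitCircleMeasure)
            (f := fun ζ => starRingEnd ℂ ζ * (φ (z + ζ • b) - φ z - fderiv ℝ φ z (ζ • b)))
            (C := C' * ρ ^ 2) ?_
          · simpa using this
          · filter_upwards [ae_norm_eq_one] with ζ hζ
            rw [norm_mul, RCLike.norm_conj, hζ, one_mul]
            refine (hC' z _).trans ?_
            rw [norm_smul, hζ, one_mul, hbn]
        refine (norm_integral_le_of_norm_le (fi.const_mul _) (Eventually.of_forall this)).trans ?_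
        rw [integral_const_mul]
      · have := i1.integral_prod_left
        simpa only [integral_const_mul] using this
    have i2 : Integrable (fun p : (Fin n → ℂ) × ℂ =>
        (f (p.1 - p.2 • b) : ℂ) * (starRingEnd ℂ p.2 * φ p.1))
        (volume.prod unitCircleMeasure) := by
      refine integrable_prod_unitCircleMeasure ?_ hφc (M * (1 * B)) (fun z ζ hζ => ?_)
        (fun z ζ hz => by simp [hφ0 z hz])
      · have : Measurable (starRingEnd ℂ) := Complex.continuous_conj.measurable
        have : Measurable fun p : (Fin n → ℂ) × ℂ =>
          (f (p.1 - p.2 • b) : ℂ) * (starRingEnd ℂ p.2 * φ p.1) := by fun_prop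
        exact this.aestronglyMeasurable
      · rw [norm_mul, norm_mul, RCLike.norm_conj, hζ, Complex.norm_real]
        gcongr
        exacts [hfabs _, hB _]
    have i3 : Integrable (fun p : (Fin n → ℂ) × ℂ =>
        χ p.1 * (f (p.1 + p.2 • (-b)) - f p.1) ^ 2) (volume.prod unitCircleMeasure) := by
      refine integrable_prod_unitCircleMeasure (by fun_prop) hχc (B' * (M ^ 2)) (fun z ζ _ => ?_)
        (fun z ζ hz => by simp [hχz z hz])
      rw [norm_mul, norm_pow]
      have : ‖f (z + ζ • (-b)) - f z‖ ≤ M := by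
        rw [Real.norm_eq_abs, abs_le]
        constructor <;> linarith [hf0 z, hfM z, hf0 (z + ζ • (-b)), hfM (z + ζ • (-b))]
      gcongr
      exact hB' z
    have hI2 : ‖∫ z, (f z : ℂ) * ∫ ζ, starRingEnd ℂ ζ * φ (z + ζ • b) ∂unitCircleMeasure‖ ≤
        ρ * (C * (∫ z, f z ^ 2) + ∫ z, ‖φ z‖ ^ 2) := by
      have e1 : (∫ z, (f z : ℂ) * ∫ ζ, starRingEnd ℂ ζ * φ (z + ζ • b) ∂unitCircleMeasure) =
          ∫ z, ∫ ζ, ((f (z + ζ • (-b)) - f z : ℝ) : ℂ) * (starRingEnd ℂ ζ * φ z)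
            ∂unitCircleMeasure := by
        simp_rw [← integral_const_mul]
        rw [integral_integral_swap i1]
        have : ∀ ζ : ℂ, ∫ z, (f z : ℂ) * (starRingEnd ℂ ζ * φ (z + ζ • b)) =
            ∫ z, (f (z - ζ • b) : ℂ) * (starRingEnd ℂ ζ * φ z) := by
          intro ζ
          rw [← integral_add_right_eq_self
            (fun z => (f (z - ζ • b) : ℂ) * (starRingEnd ℂ ζ * φ z)) (ζ • b)]
          simp
        simp_rw [this]
        rw [← integral_integral_swap i2]
        refine integral_congr_ae (Eventually.of_forall fun z => ?_)
        have j1 : Integrable (fun ζ : ℂ => (f (z - ζ • b) : ℂ) * (starRingEnd ℂ ζ * φ z))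
            unitCircleMeasure := by
          refine integrable_unitCircleMeasure_of_bound ?_ (M * (1 * B)) fun ζ hζ => ?_
          · have : Measurable (starRingEnd ℂ) := Complex.continuous_conj.measurable
            have : Measurable fun ζ : ℂ => (f (z - ζ • b) : ℂ) * (starRingEnd ℂ ζ * φ z) := by
              fun_prop
            exact this.aestronglyMeasurable
          · rw [norm_mul, norm_mul, RCLike.norm_conj, hζ, Complex.norm_real]
            gcongr
            exacts [hfabs _, hB _]
        have j2 : Integrable (fun ζ : ℂ => (f z : ℂ) * (starRingEnd ℂ ζ * φ z))
            unitCircleMeasure := integrable_unitCircleMeasure_of_continuous (by fun_prop)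
        -- The same cancellation on the other factor: subtracting f(z) from f(z − ζb) does not
        -- change the integral and produces the difference that the energy controls.
        have e3 : ∫ ζ : ℂ, (f z : ℂ) * (starRingEnd ℂ ζ * φ z) ∂unitCircleMeasure = 0 := by
          rw [integral_const_mul, integral_mul_const, integral_unitCircleMeasure_conj]
          simp
        have := integral_sub j1 j2
        rw [e3, sub_zero] at this
        simp only
        rw [← this]
        refine integral_congr_ae (Eventually.of_forall fun ζ => ?_)
        simp only [smul_neg, ← sub_eq_add_neg]
        push_cast
        ring
      have φ2 : Integrable (fun p : (Fin n → ℂ) × ℂ => ‖φ p.1‖ ^ 2)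
          (volume.prod unitCircleMeasure) := by
        simpa using φi.mul_prod (integrable_const (1 : ℝ) (μ := unitCircleMeasure))
      have en := energy_le hfm hf0 hfM hL hfL hχ hχc hχ0 hC (b := -b)
        fun z hz => hsub z hz _ (by rw [norm_neg, hbn]; exact hρρ₀)
      rw [norm_neg, hbn] at en
      -- Young's inequality with weight ρ: the energy is of order ρ², so the factors ρ⁻¹ and ρ make
      -- both terms of order ρ. The cutoff may be inserted because χ = 1 wherever φ ≠ 0.
      have pw : ∀ z, ‖∫ ζ, ((f (z + ζ • (-b)) - f z : ℝ) : ℂ) * (starRingEnd ℂ ζ * φ z)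
            ∂unitCircleMeasure‖ ≤ ρ⁻¹ * (∫ ζ, χ z * (f (z + ζ • (-b)) - f z) ^ 2
              ∂unitCircleMeasure) + ρ * ‖φ z‖ ^ 2 := by
        intro z
        have j3 : Integrable (fun ζ : ℂ => χ z * (f (z + ζ • (-b)) - f z) ^ 2)
            unitCircleMeasure := by
          refine integrable_unitCircleMeasure_of_bound ?_ (B' * M ^ 2) fun ζ hζ => ?_
          · have : Measurable fun ζ : ℂ => χ z * (f (z + ζ • (-b)) - f z) ^ 2 := by fun_prop
            exact this.aestronglyMeasurable
          · rw [norm_mul, norm_pow]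
            have : ‖f (z + ζ • (-b)) - f z‖ ≤ M := by
              rw [Real.norm_eq_abs, abs_le]
              constructor <;> linarith [hf0 z, hfM z, hf0 (z + ζ • (-b)), hfM (z + ζ • (-b))]
            gcongr
            exact hB' z
        refine (norm_integral_le_of_norm_le ((j3.const_mul ρ⁻¹).add
          (integrable_const (ρ * ‖φ z‖ ^ 2))) ?_).trans ?_
        · filter_upwards [ae_norm_eq_one] with ζ hζ
          rw [norm_mul, norm_mul, RCLike.norm_conj, hζ, one_mul, Complex.norm_real]
          by_cases hz : φ z = 0
          · simp only [hz, norm_zero, mul_zero]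
            have := hχ0 z
            simp only [Pi.add_apply]
            positivity
          · simp only [Pi.add_apply]
            rw [hχφ z hz, one_mul, ← sq_abs (f _ - f z)]
            set x := |f (z + ζ • (-b)) - f z|
            have h1 : 0 ≤ ρ⁻¹ * (x - ρ * ‖φ z‖) ^ 2 := by positivity
            have h2 : ρ⁻¹ * (x - ρ * ‖φ z‖) ^ 2 =
                ρ⁻¹ * x ^ 2 - 2 * (x * ‖φ z‖) + ρ * ‖φ z‖ ^ 2 := by
              field_simp
              ring
            have h3 : 0 ≤ x * ‖φ z‖ := by positivity
            rw [Real.norm_eq_abs]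
            linarith
        · rw [integral_add' (j3.const_mul _) (integrable_const _), integral_const_mul]
          simp
      rw [e1]
      refine (norm_integral_le_of_norm_le ((i3.integral_prod_left.const_mul _).add
        (φi.const_mul _)) (Eventually.of_forall pw)).trans ?_
      rw [integral_add' (i3.integral_prod_left.const_mul _) (φi.const_mul _), integral_const_mul,
        integral_const_mul]
      calc _ ≤ ρ⁻¹ * (C * ρ ^ 2 * ∫ z, f z ^ 2) + ρ * ∫ z, ‖φ z‖ ^ 2 := by gcongr
        _ = _ := by field_simp
    have h3 : ‖(ρ : ℂ) * ∫ z, (f z : ℂ) * wirtinger j φ z‖ ≤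
        ρ * (C * (∫ z, f z ^ 2) + ∫ z, ‖φ z‖ ^ 2) + C' * ρ ^ 2 * ∫ z, f z := by
      refine (norm_le_norm_add_norm_sub _ _).trans (add_le_add hI2 ?_)
      exact hI1
    rw [norm_mul, Complex.norm_real, Real.norm_of_nonneg hρ.le] at h3
    refine le_of_mul_le_mul_left (h3.trans (le_of_eq ?_)) hρ
    ring
  refine ge_of_tendsto (f := fun ρ : ℝ => C * (∫ z, f z ^ 2) + (∫ z, ‖φ z‖ ^ 2) +
    C' * ρ * ∫ z, f z) (x := 𝓝[>] 0) ?_ ?_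
  · have : Continuous fun ρ : ℝ => C * (∫ z, f z ^ 2) + (∫ z, ‖φ z‖ ^ 2) +
      C' * ρ * ∫ z, f z := by fun_prop
    simpa using (this.tendsto 0).mono_left nhdsWithin_le_nhds
  · filter_upwards [Ioo_mem_nhdsGT hρ₀] with ρ hρ using step ρ hρ.1 hρ.2

/-! ### Uniform derivative bounds for bounded plurisubharmonic functions. -/

lemma measurable_indicator_of_upperSemicontinuousOn {X : Type*} [TopologicalSpace X]
    [MeasurableSpace X] [BorelSpace X] {f : X → ℝ} {s : Set X} (hs : MeasurableSet s)
    (hf : UpperSemicontinuousOn f s) : Measurable (s.indicator f) := by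
  refine measurable_of_restrict_of_restrict_compl hs ?_ ?_
  · have h1 : s.domRestrict (s.indicator f) = s.domRestrict f := by
      ext x; exact indicator_of_mem x.2 _
    rw [h1]
    refine UpperSemicontinuous.measurable ?_
    rw [← upperSemicontinuousOn_univ_iff]
    exact fun x _ y hy => (continuous_subtype_val.continuousWithinAt.tendsto_nhdsWithin
      (fun z _ => z.2)).eventually (hf x.1 x.2 y hy)
  · have : sᶜ.domRestrict (s.indicator f) = fun _ => 0 := by
      ext x; exact indicator_of_notMem x.2 _
    rw [this]
    exact measurable_const

lemma exists_cutoff {n : ℕ} {K K' : Set (Fin n → ℂ)} (hK : IsCompact K) (hK' : IsCompact K')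
    (h : K ⊆ interior K') :
    ∃ χ : (Fin n → ℂ) → ℝ, ContDiff ℝ ∞ χ ∧ HasCompactSupport χ ∧ (∀ z, 0 ≤ χ z) ∧
      (∀ z ∈ K, χ z = 1) ∧ ∀ z, χ z ≠ 0 → z ∈ K' := by
  obtain ⟨χ, h0, h1, hm⟩ := exists_contMDiffMap_zero_one_of_isClosed (n := ⊤) 𝓘(ℝ, Fin n → ℂ)
    (s := (interior K')ᶜ) (t := K) isOpen_interior.isClosed_compl hK.isClosed
    (disjoint_compl_left_iff_subset.2 h)
  have hs : ∀ z, χ z ≠ 0 → z ∈ K' := fun z hz => by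
    by_contra hzK
    exact hz (h0 fun hzi => hzK (interior_subset hzi))
  exact ⟨χ, χ.contMDiff.contDiff, HasCompactSupport.of_support_subset_isCompact hK' hs,
    fun z => (hm z).1, fun z hz => h1 hz, hs⟩

lemma wirtinger_eq_zero_of_notMem_tsupport {n : ℕ} {j : Fin n} {φ : (Fin n → ℂ) → ℂ}
    {z : Fin n → ℂ} (hz : z ∉ tsupport φ) : wirtinger j φ z = 0 := by
  have h : fderiv ℝ φ z = 0 := by
    by_contra h
    exact hz (support_fderiv_subset ℝ h)
  simp [wirtinger, h]

/-- A bounded plurisubharmonic function has weak first derivatives bounded in `L²`, locally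
uniformly. -/
lemma exists_norm_integral_mul_wirtinger_le {n : ℕ} {Ω K : Set (Fin n → ℂ)} (hΩ : IsOpen Ω)
    (hK : IsCompact K) (hKΩ : K ⊆ Ω) (j : Fin n) :
    ∃ L ⊆ Ω, IsCompact L ∧ K ⊆ L ∧ ∃ A : ℝ, ∀ (f : (Fin n → ℂ) → ℝ) (M : ℝ), IsPSHOn f Ω →
      (∀ z ∈ L, 0 ≤ f z ∧ f z ≤ M) → ∀ φ : (Fin n → ℂ) → ℂ, ContDiff ℝ ∞ φ →
      HasCompactSupport φ → tsupport φ ⊆ K →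
      ‖∫ z, (f z : ℂ) * wirtinger j φ z‖ ≤ A * M ^ 2 + ∫ z, ‖φ z‖ ^ 2 := by
  obtain ⟨K', hK', hKK', hK'Ω⟩ := exists_compact_between hK hΩ hKΩ
  obtain ⟨χ, hχ, hχc, hχ0, hχ1, hχK⟩ := exists_cutoff hK hK' hKK'
  obtain ⟨C, hC0, hC⟩ := exists_taylor_bound hχ hχc
  obtain ⟨δ, hδ, hδΩ⟩ := hK'.exists_cthickening_subset_open hΩ hK'Ω
  set L := Metric.cthickening δ K' with hLdef
  have hL : IsCompact L := hK'.cthickening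
  have hKL : K ⊆ L := (hKK'.trans interior_subset).trans (Metric.self_subset_cthickening _)
  -- The constant is fixed before f: `C` belongs to the cutoff, and f enters only through its bound
  -- M on L. The weak convergence statement rests on this uniformity.
  refine ⟨L, hδΩ, hL, hKL, C * volume.real L, fun f M hf hM φ hφ hφc hφK => ?_⟩
  have hfm : Measurable (L.indicator f) :=
    measurable_indicator_of_upperSemicontinuousOn hL.measurableSet (hf.1.mono hδΩ)
  -- Non-negativity of M can be read off only at a point of L; if L is empty then φ = 0.
  rcases L.eq_empty_or_nonempty with hLe | ⟨z₀, hz₀⟩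
  · have : ∀ z, φ z = 0 := fun z => by
      by_contra h
      have := hKL (hφK (subset_tsupport _ h))
      simp [hLe] at this
    obtain rfl : φ = fun _ => 0 := funext this
    have hw : ∀ z, wirtinger j (fun _ : Fin n → ℂ => (0 : ℂ)) z = 0 := fun z => by
      simp [wirtinger]
    simp [hw, hLe]
  have hM0 : 0 ≤ M := (hM z₀ hz₀).1.trans (hM z₀ hz₀).2
  have hf0 : ∀ z, 0 ≤ L.indicator f z := fun z => indicator_nonneg (fun z hz => (hM z hz).1) z
  have hfM : ∀ z, L.indicator f z ≤ M := fun z =>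
    indicator_apply_le' (fun hz => (hM z hz).2) fun _ => hM0
  have hfL : ∀ z, z ∉ L → L.indicator f z = 0 := fun z hz => indicator_of_notMem hz _
  -- The margin δ keeps discs centred in the support of χ inside L, where the indicator does not
  -- alter f.
  have hsub : ∀ z, χ z ≠ 0 → ∀ b, ‖b‖ < δ →
      L.indicator f z ≤ ∫ ζ, L.indicator f (z + ζ • b) ∂unitCircleMeasure := by
    intro z hz b hb
    have hmem : ∀ ζ : ℂ, ‖ζ‖ ≤ 1 → z + ζ • b ∈ L := by
      intro ζ hζ
      refine Metric.mem_cthickening_of_dist_le _ z _ _ (hχK z hz) ?_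
      rw [dist_eq_norm, add_sub_cancel_left, norm_smul]
      nlinarith [norm_nonneg b]
    have hzL : z ∈ L := by simpa using hmem 0 (by simp)
    rw [integral_unitCircleMeasure
      (by fun_prop : Measurable fun ζ : ℂ => L.indicator f (z + ζ • b)).aestronglyMeasurable,
      indicator_of_mem hzL,
      Real.circleAverage_congr_sphere (f₂ := fun ζ : ℂ => f (z + ζ • b))]
    · exact (hf.2 z b fun ζ hζ => hδΩ (hmem ζ hζ)).2
    · intro ζ hζ
      exact indicator_of_mem (hmem ζ (by simpa using (mem_sphere_zero_iff_norm.1 hζ).le)) _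
  have main := norm_integral_mul_wirtinger_le j hfm hf0 hfM hL hfL hχ hχc hχ0 hC hδ hsub hφ hφc
    fun z hz => hχ1 z (hφK (subset_tsupport _ hz))
  have e1 : ∫ z, (f z : ℂ) * wirtinger j φ z = ∫ z, ((L.indicator f z : ℝ) : ℂ) * wirtinger j φ z := by
    refine integral_congr_ae (Eventually.of_forall fun z => ?_)
    by_cases hz : z ∈ L
    · simp only [indicator_of_mem hz]
    · simp only [wirtinger_eq_zero_of_notMem_tsupport fun h => hz (hKL (hφK h)), mul_zero]
  have e2 : ∫ z, L.indicator f z ^ 2 ≤ volume.real L * M ^ 2 := by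
    have : ∀ z, L.indicator f z ^ 2 = L.indicator (fun z => f z ^ 2) z := fun z => by
      by_cases hz : z ∈ L <;> simp [hz]
    simp_rw [this]
    rw [integral_indicator hL.measurableSet]
    refine (Real.le_norm_self _).trans ((norm_setIntegral_le_of_norm_le_const (C := M ^ 2)
      hL.measure_lt_top fun z hz => ?_).trans (le_of_eq (mul_comm _ _)))
    rw [norm_pow, Real.norm_of_nonneg (hM z hz).1]
    exact pow_le_pow_left₀ (hM z hz).1 (hM z hz).2 2
  rw [e1]
  refine main.trans ?_
  rw [mul_assoc]
  gcongr

/-! ### Test functions and weak derivatives in `L²` -/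

section TestFunctions

variable {n : ℕ}

lemma IsTestFunction.mono {U Ω : Set (Fin n → ℂ)} {φ : (Fin n → ℂ) → ℂ} (h : IsTestFunction U φ)
    (hU : U ⊆ Ω) : IsTestFunction Ω φ :=
  ⟨h.smooth, h.compact, h.subset.trans hU⟩

lemma IsTestFunction.eq_zero {U : Set (Fin n → ℂ)} {φ : (Fin n → ℂ) → ℂ}
    (h : IsTestFunction U φ) {z : Fin n → ℂ} (hz : z ∉ U) : φ z = 0 :=
  image_eq_zero_of_notMem_tsupport fun hz' => hz (h.subset hz')

/-- The test functions on `U`, as a linear subspace. -/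
def testFunctions (U : Set (Fin n → ℂ)) : Submodule ℂ ((Fin n → ℂ) → ℂ) where
  carrier := {φ | IsTestFunction U φ}
  add_mem' {a b} ha hb := ⟨ha.smooth.add hb.smooth, ha.compact.add hb.compact,
    (tsupport_add a b).trans (union_subset ha.subset hb.subset)⟩
  zero_mem' := ⟨contDiff_const, HasCompactSupport.zero, by
    rw [tsupport_eq_empty_iff.2 rfl]; exact empty_subset _⟩
  smul_mem' c φ hφ := ⟨hφ.smooth.const_smul c, hφ.compact.smul_left (f := fun _ => c),
    (closure_mono (Function.support_const_smul_subset c φ)).trans hφ.subset⟩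

lemma IsTestFunction.memLp {U : Set (Fin n → ℂ)} {φ : (Fin n → ℂ) → ℂ} (h : IsTestFunction U φ)
    (μ : Measure (Fin n → ℂ)) [IsFiniteMeasureOnCompacts μ] : MemLp φ 2 μ :=
  h.smooth.continuous.memLp_of_hasCompactSupport h.compact

/-- The inclusion of the test functions on `U` into `L²(U)`. -/
noncomputable def testToLp (U : Set (Fin n → ℂ)) :
    testFunctions U →ₗ[ℂ] Lp ℂ 2 (volume.restrict U) where
  toFun φ := (IsTestFunction.memLp φ.2 _).toLp
  map_add' _ _ := MemLp.toLp_add _ _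
  map_smul' _ _ := MemLp.toLp_const_smul _ _

lemma coeFn_testToLp {U : Set (Fin n → ℂ)} (φ : testFunctions U) :
    testToLp U φ =ᵐ[volume.restrict U] (φ : (Fin n → ℂ) → ℂ) :=
  MemLp.coeFn_toLp (IsTestFunction.memLp φ.2 _)

/-- The inner product is conjugate linear in its first argument. Conjugating the density therefore
turns it into the bilinear pairing used for distributions. -/
lemma inner_testToLp {U : Set (Fin n → ℂ)} (φ : testFunctions U)
    (x : Lp ℂ 2 (volume.restrict U)) {g : (Fin n → ℂ) → ℂ}
    (hg : x =ᵐ[volume.restrict U] fun z => starRingEnd ℂ (g z)) :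
    inner ℂ x (testToLp U φ) = ∫ z, g z * (φ : (Fin n → ℂ) → ℂ) z := by
  rw [L2.inner_def, ← setIntegral_eq_integral_of_forall_compl_eq_zero (s := U)
    (f := fun z => g z * (φ : (Fin n → ℂ) → ℂ) z)
    fun z hz => by rw [IsTestFunction.eq_zero φ.2 hz, mul_zero]]
  refine integral_congr_ae ?_
  filter_upwards [coeFn_testToLp φ, hg] with z h1 h2
  rw [h1, h2, RCLike.inner_apply, RCLike.conj_conj, mul_comm]

lemma norm_testToLp_sq {U : Set (Fin n → ℂ)} (φ : testFunctions U) :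
    ‖testToLp U φ‖ ^ 2 = ∫ z, ‖(φ : (Fin n → ℂ) → ℂ) z‖ ^ 2 := by
  have h := inner_self_eq_norm_sq_to_K (𝕜 := ℂ) (testToLp U φ)
  rw [inner_testToLp φ _ (g := fun z => starRingEnd ℂ ((φ : (Fin n → ℂ) → ℂ) z))] at h
  · have h2 : ∀ z, starRingEnd ℂ ((φ : (Fin n → ℂ) → ℂ) z) * (φ : (Fin n → ℂ) → ℂ) z =
      ((‖(φ : (Fin n → ℂ) → ℂ) z‖ ^ 2 : ℝ) : ℂ) := fun z => by
      rw [mul_comm, Complex.mul_conj, Complex.normSq_eq_norm_sq]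
    simp_rw [h2] at h
    rw [integral_complex_ofReal] at h
    refine Complex.ofReal_injective ?_
    simpa using h.symm
  · filter_upwards [coeFn_testToLp φ] with z hz
    simpa using hz

lemma locallyIntegrableOn_of_memLp {U : Set (Fin n → ℂ)} {g : (Fin n → ℂ) → ℂ}
    (hg : MemLp g 2 (volume.restrict U)) : LocallyIntegrableOn g U := by
  exact locallyIntegrableOn_of_locallyIntegrable_restrict (hg.locallyIntegrable (by norm_num))

lemma integrable_mul_of_locallyIntegrableOn {Ω : Set (Fin n → ℂ)} {f ψ : (Fin n → ℂ) → ℂ}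
    (hf : LocallyIntegrableOn f Ω) (hψ : Continuous ψ) (hc : HasCompactSupport ψ)
    (hs : tsupport ψ ⊆ Ω) : Integrable fun z => f z * ψ z := by
  have h1 : IntegrableOn f (tsupport ψ) := hf.integrableOn_compact_subset hs hc
  have h2 := h1.mul_continuousOn hψ.continuousOn hc
  rwa [integrableOn_iff_integrable_of_support_subset] at h2
  exact (Function.support_mul_subset_right _ _).trans (subset_tsupport ψ)

/-- The fundamental lemma of the calculus of variations for complex test functions. -/
lemma ae_eq_of_forall_integral_testFunction_eq {U : Set (Fin n → ℂ)} (hU : IsOpen U)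
    {g₁ g₂ : (Fin n → ℂ) → ℂ} (h₁ : LocallyIntegrableOn g₁ U) (h₂ : LocallyIntegrableOn g₂ U)
    (h : ∀ φ, IsTestFunction U φ → ∫ z, g₁ z * φ z = ∫ z, g₂ z * φ z) :
    g₁ =ᵐ[volume.restrict U] g₂ := by
  have := hU.ae_eq_zero_of_integral_contDiff_smul_eq_zero (μ := volume) (h₁.sub h₂)
    fun φ hφ hφc hφU => ?_
  · rw [Filter.EventuallyEq, ae_restrict_iff' hU.measurableSet]
    filter_upwards [this] with z hz hzU using sub_eq_zero.1 (hz hzU)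
  · have hs : tsupport (fun z => (φ z : ℂ)) ⊆ tsupport φ :=
      closure_mono fun z hz => by simpa using hz
    have ht : IsTestFunction U fun z => (φ z : ℂ) :=
      ⟨Complex.ofRealCLM.contDiff.comp hφ, hφc.comp_left (g := fun x : ℝ => (x : ℂ)) (by simp),
        hs.trans hφU⟩
    have i1 := integrable_mul_of_locallyIntegrableOn h₁ ht.smooth.continuous ht.compact ht.subset
    have i2 := integrable_mul_of_locallyIntegrableOn h₂ ht.smooth.continuous ht.compact ht.subset
    have := h _ ht
    rw [← sub_eq_zero, ← integral_sub i1 i2] at this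
    rw [← this]
    refine integral_congr_ae (Eventually.of_forall fun z => ?_)
    simp only [Pi.sub_apply, Complex.real_smul]
    ring

/-- A vector orthogonal to all test functions defines the zero distribution, and so vanishes by the
fundamental lemma of the calculus of variations. -/
lemma denseRange_testToLp {U : Set (Fin n → ℂ)} (hU : IsOpen U) : DenseRange (testToLp U) := by
  have h : (LinearMap.range (testToLp U)).topologicalClosure = ⊤ := by
    rw [Submodule.topologicalClosure_eq_top_iff, Submodule.eq_bot_iff]
    intro x hx
    rw [Submodule.mem_orthogonal'] at hx
    have hm : MemLp (fun z => starRingEnd ℂ (x z)) 2 (volume.restrict U) := (Lp.memLp x).star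
    have h0 : (fun z => starRingEnd ℂ (x z)) =ᵐ[volume.restrict U] fun _ => 0 := by
      refine ae_eq_of_forall_integral_testFunction_eq hU (locallyIntegrableOn_of_memLp hm)
        (locallyIntegrableOn_of_memLp MemLp.zero) fun φ hφ => ?_
      have := hx _ ⟨⟨φ, hφ⟩, rfl⟩
      rw [inner_testToLp _ _ (g := fun z => starRingEnd ℂ (x z)) (by simp)] at this
      simpa using this
    rw [Lp.eq_zero_iff_ae_eq_zero]
    filter_upwards [h0] with z hz
    simpa using hz
  have h2 := (Submodule.dense_iff_topologicalClosure_eq_top).2 h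
  rwa [LinearMap.coe_range] at h2

/-- Homogenization: applied to tφ, the hypothesis reads t|Tφ| ≤ A + t²‖φ‖². Take t = 1/‖φ‖; if ‖φ‖ =
0, arbitrarily large t force Tφ = 0. -/
lemma norm_le_mul_norm_testToLp {U : Set (Fin n → ℂ)} (T : testFunctions U →ₗ[ℂ] ℂ)
    {A : ℝ} (hT : ∀ φ : testFunctions U, ‖T φ‖ ≤ A + ∫ z, ‖(φ : (Fin n → ℂ) → ℂ) z‖ ^ 2)
    (φ : testFunctions U) : ‖T φ‖ ≤ (A + 1) * ‖testToLp U φ‖ := by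
  rcases eq_or_ne ‖testToLp U φ‖ 0 with h0 | h0
  · have hA : ∀ t : ℝ, 0 ≤ t → t * ‖T φ‖ ≤ A := by
      intro t ht
      have := hT ((t : ℂ) • φ)
      rw [← norm_testToLp_sq, map_smul, map_smul, norm_smul, norm_smul, h0, Complex.norm_real,
        Real.norm_of_nonneg ht] at this
      simpa using this
    rw [h0, mul_zero]
    by_contra hc
    rw [not_le] at hc
    have h1 := hA ((|A| + 1) / ‖T φ‖) (by positivity)
    rw [div_mul_cancel₀ _ hc.ne'] at h1
    linarith [le_abs_self A]
  · have h1 : 0 < ‖testToLp U φ‖ := lt_of_le_of_ne (norm_nonneg _) (Ne.symm h0)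
    have := hT (((‖testToLp U φ‖⁻¹ : ℝ) : ℂ) • φ)
    rw [← norm_testToLp_sq, map_smul, map_smul, norm_smul, norm_smul, Complex.norm_real,
      Real.norm_of_nonneg (by positivity), inv_mul_cancel₀ h0, one_pow,
      inv_mul_le_iff₀ h1] at this
    linarith

/-- The functional is bounded for the L² norm on a dense subspace, so it extends to L² and is
represented by a vector there. -/
lemma exists_memLp_of_bound {U : Set (Fin n → ℂ)} (hU : IsOpen U) (T : testFunctions U →ₗ[ℂ] ℂ)
    {A : ℝ} (hT : ∀ φ : testFunctions U, ‖T φ‖ ≤ A + ∫ z, ‖(φ : (Fin n → ℂ) → ℂ) z‖ ^ 2) :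
    ∃ g : (Fin n → ℂ) → ℂ, MemLp g 2 (volume.restrict U) ∧
      ∀ φ : testFunctions U, T φ = ∫ z, g z * (φ : (Fin n → ℂ) → ℂ) z := by
  have hT' := norm_le_mul_norm_testToLp T hT
  have hd := denseRange_testToLp hU
  set Φ := T.extendOfNorm (testToLp U)
  set x := (InnerProductSpace.toDual ℂ (Lp ℂ 2 (volume.restrict U))).symm Φ with hx
  refine ⟨fun z => starRingEnd ℂ (x z), (Lp.memLp x).star, fun φ => ?_⟩
  rw [← inner_testToLp φ x (by simp), hx, InnerProductSpace.toDual_symm_apply]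
  exact (LinearMap.extendOfNorm_eq hd ⟨_, hT'⟩ φ).symm

end TestFunctions

/-! ### Distributional derivatives and the gluing of local L² densities. -/

section WeakDerivatives

variable {n : ℕ}

lemma wirtinger_add {j : Fin n} {f g : (Fin n → ℂ) → ℂ} {z : Fin n → ℂ}
    (hf : DifferentiableAt ℝ f z) (hg : DifferentiableAt ℝ g z) :
    wirtinger j (fun z => f z + g z) z = wirtinger j f z + wirtinger j g z := by
  simp only [wirtinger, fderiv_fun_add hf hg, _root_.add_apply]
  ring

lemma wirtinger_const_mul {j : Fin n} {f : (Fin n → ℂ) → ℂ} {z : Fin n → ℂ} (c : ℂ)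
    (hf : DifferentiableAt ℝ f z) : wirtinger j (fun z => c * f z) z = c * wirtinger j f z := by
  simp only [wirtinger, fderiv_const_mul hf c, _root_.smul_apply, smul_eq_mul]
  ring

lemma IsTestFunction.differentiable {U : Set (Fin n → ℂ)} {φ : (Fin n → ℂ) → ℂ}
    (h : IsTestFunction U φ) : Differentiable ℝ φ :=
  h.smooth.differentiable (by simp)

lemma tsupport_wirtinger_subset (j : Fin n) (φ : (Fin n → ℂ) → ℂ) :
    tsupport (wirtinger j φ) ⊆ tsupport φ :=
  closure_minimal (fun z hz => by
    by_contra h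
    exact hz (wirtinger_eq_zero_of_notMem_tsupport h)) (isClosed_tsupport φ)

lemma IsTestFunction.continuous_wirtinger {U : Set (Fin n → ℂ)} {φ : (Fin n → ℂ) → ℂ}
    (h : IsTestFunction U φ) (j : Fin n) : Continuous (wirtinger j φ) := by
  have := h.smooth.continuous_fderiv (by simp)
  unfold wirtinger
  fun_prop

lemma IsTestFunction.integrable_mul {U : Set (Fin n → ℂ)} {f φ : (Fin n → ℂ) → ℂ}
    (h : IsTestFunction U φ) (hf : LocallyIntegrableOn f U) : Integrable fun z => f z * φ z :=
  integrable_mul_of_locallyIntegrableOn hf h.smooth.continuous h.compact h.subset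

lemma IsTestFunction.integrable_mul_wirtinger {U : Set (Fin n → ℂ)} {f φ : (Fin n → ℂ) → ℂ}
    (h : IsTestFunction U φ) (hf : LocallyIntegrableOn f U) (j : Fin n) :
    Integrable fun z => f z * wirtinger j φ z :=
  integrable_mul_of_locallyIntegrableOn hf (h.continuous_wirtinger j)
    (h.compact.mono' (subset_tsupport _ |>.trans (tsupport_wirtinger_subset j φ)))
    ((tsupport_wirtinger_subset j φ).trans h.subset)

/-- The distribution `∂f/∂z_j`, as a linear functional on test functions. -/
noncomputable def distWirtingerLinear (j : Fin n) {f : (Fin n → ℂ) → ℂ} {U : Set (Fin n → ℂ)}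
    (hf : LocallyIntegrableOn f U) : testFunctions U →ₗ[ℂ] ℂ where
  toFun φ := distWirtinger j f φ
  map_add' φ ψ := by
    have e : ∀ z, f z * wirtinger j (↑(φ + ψ) : (Fin n → ℂ) → ℂ) z =
        f z * wirtinger j (φ : (Fin n → ℂ) → ℂ) z + f z * wirtinger j (ψ : (Fin n → ℂ) → ℂ) z :=
      fun z => by
        rw [← mul_add, ← wirtinger_add (IsTestFunction.differentiable φ.2 z)
          (IsTestFunction.differentiable ψ.2 z)]
        rfl
    simp_rw [distWirtinger, e]
    rw [integral_add (IsTestFunction.integrable_mul_wirtinger φ.2 hf j)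
      (IsTestFunction.integrable_mul_wirtinger ψ.2 hf j), neg_add]
  map_smul' c φ := by
    have e : ∀ z, f z * wirtinger j (↑(c • φ) : (Fin n → ℂ) → ℂ) z =
        c * (f z * wirtinger j (φ : (Fin n → ℂ) → ℂ) z) := fun z => by
      rw [mul_left_comm, ← wirtinger_const_mul c (IsTestFunction.differentiable φ.2 z)]
      rfl
    simp_rw [distWirtinger, e]
    rw [integral_const_mul]
    simp

/-- Densities on two sets of an exhaustion agree almost everywhere on the smaller one, by the
fundamental lemma, and therefore glue. Each U is placed inside a compact K ⊆ Ω because the available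
estimates are uniform only there. -/
lemma exists_isLocallyL2On_of_local {Ω : Set (Fin n → ℂ)} (hΩ : IsOpen Ω)
    (T : ((Fin n → ℂ) → ℂ) → ℂ)
    (h : ∀ U K : Set (Fin n → ℂ), IsOpen U → IsCompact K → U ⊆ K → K ⊆ Ω →
      ∃ g, MemLp g 2 (volume.restrict U) ∧ ∀ φ, IsTestFunction U φ → T φ = ∫ z, g z * φ z) :
    ∃ g, IsLocallyL2On g Ω ∧ ∀ φ, IsTestFunction Ω φ → T φ = ∫ z, g z * φ z := by
  classical
  have := hΩ.locallyCompactSpace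
  let e := CompactExhaustion.choice Ω
  let U : ℕ → Set (Fin n → ℂ) := fun m => Subtype.val '' interior (e m)
  have hUo : ∀ m, IsOpen (U m) := fun m => hΩ.isOpenMap_subtype_val _ isOpen_interior
  have hUΩ : ∀ m, U m ⊆ Ω := fun m => by rintro _ ⟨x, _, rfl⟩; exact x.2
  have hUm : Monotone U := fun m k hmk =>
    image_mono (interior_mono (e.subset hmk))
  have hUK : ∀ m, ∃ K, IsCompact K ∧ U m ⊆ K ∧ K ⊆ Ω := fun m =>
    ⟨Subtype.val '' e m, (e.isCompact m).image continuous_subtype_val,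
      image_mono interior_subset, by rintro _ ⟨x, _, rfl⟩; exact x.2⟩
  have hcov : ∀ z ∈ Ω, ∃ m, z ∈ U m := fun z hz => by
    obtain ⟨m, hm⟩ := e.exists_mem ⟨z, hz⟩
    exact ⟨m + 1, ⟨z, hz⟩, e.subset_interior_succ m hm, rfl⟩
  have hcomp : ∀ K ⊆ Ω, IsCompact K → ∃ m, K ⊆ U m := fun K hK hKc =>
    hKc.elim_directed_cover U hUo (fun z hz => mem_iUnion.2 (hcov z (hK hz)))
      (directed_of_isDirected_le hUm)
  choose K hKc hUK hKΩ using hUK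
  choose G hG hGT using fun m => h (U m) (K m) (hUo m) (hKc m) (hUK m) (hKΩ m)
  -- At z the density of the first set containing z is used. On `U m` only the finitely many indices
  -- k ≤ m can then occur.
  let g : (Fin n → ℂ) → ℂ := fun z => if hz : ∃ m, z ∈ U m then G (Nat.find hz) z else 0
  have hcompat : ∀ k m, k ≤ m → G k =ᵐ[volume.restrict (U k)] G m := fun k m hkm =>
    ae_eq_of_forall_integral_testFunction_eq (hUo k) (locallyIntegrableOn_of_memLp (hG k))
      ((locallyIntegrableOn_of_memLp (hG m)).mono_set (hUm hkm)) fun φ hφ => by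
        rw [← hGT k φ hφ, ← hGT m φ (hφ.mono (hUm hkm))]
  have hgG : ∀ m, g =ᵐ[volume.restrict (U m)] G m := by
    intro m
    rw [Filter.EventuallyEq, ae_restrict_iff' (hUo m).measurableSet]
    have h1 : ∀ᵐ z, ∀ k : ℕ, k ≤ m → z ∈ U k → G k z = G m z := by
      rw [ae_all_iff]
      intro k
      by_cases hk : k ≤ m
      · have := hcompat k m hk
        rw [Filter.EventuallyEq, ae_restrict_iff' (hUo k).measurableSet] at this
        filter_upwards [this] with z hz _ using hz
      · exact Eventually.of_forall fun z h => absurd h hk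
    filter_upwards [h1] with z hz hzm
    have hex : ∃ m, z ∈ U m := ⟨m, hzm⟩
    simp only [g, dif_pos hex]
    exact hz _ (Nat.find_min' hex hzm) (Nat.find_spec hex)
  refine ⟨g, fun K hK hKc => ?_, fun φ hφ => ?_⟩
  · obtain ⟨m, hm⟩ := hcomp K hK hKc
    exact ((hG m).ae_eq (hgG m).symm).mono_measure (Measure.restrict_mono hm le_rfl)
  · obtain ⟨m, hm⟩ := hcomp _ hφ.subset hφ.compact
    have hφm : IsTestFunction (U m) φ := ⟨hφ.smooth, hφ.compact, hm⟩
    rw [hGT m φ hφm,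
      ← setIntegral_eq_integral_of_forall_compl_eq_zero (s := U m) (f := fun z => G m z * φ z)
        fun z hz => by rw [hφm.eq_zero hz, mul_zero],
      ← setIntegral_eq_integral_of_forall_compl_eq_zero (s := U m) (f := fun z => g z * φ z)
        fun z hz => by rw [hφm.eq_zero hz, mul_zero]]
    refine integral_congr_ae ?_
    filter_upwards [hgG m] with z hz
    rw [hz]

lemma IsLocallyL2On.locallyIntegrableOn {g : (Fin n → ℂ) → ℂ} {Ω : Set (Fin n → ℂ)}
    (hΩ : IsOpen Ω) (hg : IsLocallyL2On g Ω) : LocallyIntegrableOn g Ω := by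
  rw [locallyIntegrableOn_iff hΩ.isLocallyClosed]
  intro K hK hKc
  have : IsFiniteMeasure (volume.restrict K : Measure (Fin n → ℂ)) :=
    ⟨by simpa using hKc.measure_lt_top⟩
  exact (hg K hK hKc).integrable (by norm_num)

lemma IsPSHOn.exists_bound {f : (Fin n → ℂ) → ℝ} {Ω K : Set (Fin n → ℂ)} (hf : IsPSHOn f Ω)
    (hK : IsCompact K) (hKΩ : K ⊆ Ω) : ∃ M, ∀ z ∈ K, f z ≤ M := by
  obtain ⟨M, hM⟩ := (hf.1.mono hKΩ).bddAbove_of_isCompact hK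
  exact ⟨M, fun z hz => hM (mem_image_of_mem f hz)⟩

lemma IsPSHOn.locallyIntegrableOn {f : (Fin n → ℂ) → ℝ} {Ω : Set (Fin n → ℂ)} (hΩ : IsOpen Ω)
    (hf : IsPSHOn f Ω) (h0 : ∀ z ∈ Ω, 0 ≤ f z) : LocallyIntegrableOn f Ω := by
  rw [locallyIntegrableOn_iff hΩ.isLocallyClosed]
  intro K hK hKc
  obtain ⟨M, hM⟩ := hf.exists_bound hKc hK
  rw [← integrable_indicator_iff hKc.measurableSet]
  have hm := measurable_indicator_of_upperSemicontinuousOn hKc.measurableSet (hf.1.mono hK)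
  have hb : Integrable (K.indicator fun _ => M) :=
    (integrable_indicator_iff hKc.measurableSet).2 (integrableOn_const hKc.measure_lt_top.ne)
  refine hb.mono' hm.aestronglyMeasurable (Eventually.of_forall fun z => ?_)
  by_cases hz : z ∈ K
  · simp only [indicator_of_mem hz, Real.norm_of_nonneg (h0 z (hK hz))]
    exact hM z hz
  · simp [indicator_of_notMem hz]

lemma LocallyIntegrableOn.complex_ofReal {f : (Fin n → ℂ) → ℝ} {Ω : Set (Fin n → ℂ)}
    (hf : LocallyIntegrableOn f Ω) : LocallyIntegrableOn (fun z => (f z : ℂ)) Ω := fun x hx => by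
  obtain ⟨s, hs, hi⟩ := hf x hx
  exact ⟨s, hs, Integrable.ofReal hi⟩

/-- A non-negative (finite) plurisubharmonic function has first derivatives in `L²_loc`. -/
lemma IsPSHOn.exists_hasWeakWirtinger {f : (Fin n → ℂ) → ℝ} {Ω : Set (Fin n → ℂ)} (hΩ : IsOpen Ω)
    (hf : IsPSHOn f Ω) (h0 : ∀ z ∈ Ω, 0 ≤ f z) (j : Fin n) :
    ∃ g, HasWeakWirtinger j (fun z => (f z : ℂ)) g Ω ∧ IsLocallyL2On g Ω := by
  have hfi := LocallyIntegrableOn.complex_ofReal (hf.locallyIntegrableOn hΩ h0)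
  have hloc : ∀ U K : Set (Fin n → ℂ), IsOpen U → IsCompact K → U ⊆ K → K ⊆ Ω →
      ∃ g, MemLp g 2 (volume.restrict U) ∧ ∀ φ, IsTestFunction U φ →
        distWirtinger j (fun z => (f z : ℂ)) φ = ∫ z, g z * φ z := by
    intro U K hU hK hUK hKΩ
    -- Upper semicontinuity bounds f above on the compact set L, which is all that the derivative
    -- estimate asks besides f ≥ 0.
    obtain ⟨L, hLΩ, hL, -, A, hA⟩ := exists_norm_integral_mul_wirtinger_le hΩ hK hKΩ j
    obtain ⟨M, hM⟩ := hf.exists_bound hL hLΩ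
    obtain ⟨g, hg, hgT⟩ := exists_memLp_of_bound hU
      (distWirtingerLinear j (hfi.mono_set (hUK.trans hKΩ))) (A := A * M ^ 2) fun φ => by
        have := hA f M hf (fun z hz => ⟨h0 z (hLΩ hz), hM z hz⟩) φ φ.2.smooth φ.2.compact
          (φ.2.subset.trans hUK)
        simpa [distWirtingerLinear, distWirtinger] using this
    exact ⟨g, hg, fun φ hφ => hgT ⟨φ, hφ⟩⟩
  obtain ⟨g, hg, hgT⟩ := exists_isLocallyL2On_of_local hΩ (distWirtinger j fun z => (f z : ℂ)) hloc
  exact ⟨g, ⟨hfi, hg.locallyIntegrableOn hΩ, hgT⟩, hg⟩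

end WeakDerivatives

/-- The bound is required only on the dense family, where it comes from estimates on distributions.
It extends to every y by continuity, and an ε/2 argument then transfers the convergence. -/
lemma tendsto_inner_of_denseRange {E ι : Type*} [NormedAddCommGroup E] [InnerProductSpace ℂ E]
    {e : ι → E} (he : DenseRange e) {x : ℕ → E} {x₀ : E} {C : ℝ}
    (hC : ∀ ν i, ‖inner ℂ (x ν) (e i)‖ ≤ C * ‖e i‖)
    (h : ∀ i, Tendsto (fun ν => inner ℂ (x ν) (e i)) atTop (𝓝 (inner ℂ x₀ (e i)))) (y : E) :
    Tendsto (fun ν => inner ℂ (x ν) y) atTop (𝓝 (inner ℂ x₀ y)) := by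
  have hC' : ∀ ν y, ‖inner ℂ (x ν) y‖ ≤ C * ‖y‖ := fun ν y =>
    he.induction_on (p := fun y => ‖inner ℂ (x ν) y‖ ≤ C * ‖y‖) y
      (isClosed_le (by fun_prop) (by fun_prop)) (hC ν)
  rw [Metric.tendsto_atTop]
  intro ε hε
  set B := |C| + ‖x₀‖ + 1 with hB
  have hBpos : 0 < B := by positivity
  obtain ⟨i, hi⟩ := he.exists_dist_lt y (show 0 < ε / (2 * B) by positivity)
  rw [dist_eq_norm] at hi
  obtain ⟨N, hN⟩ := Metric.tendsto_atTop.1 (h i) (ε / 2) (by positivity)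
  refine ⟨N, fun ν hν => ?_⟩
  have h1 := hN ν hν
  rw [dist_eq_norm] at h1 ⊢
  have e1 : inner ℂ (x ν) y - inner ℂ x₀ y = inner ℂ (x ν) (y - e i) - inner ℂ x₀ (y - e i) +
      (inner ℂ (x ν) (e i) - inner ℂ x₀ (e i)) := by
    rw [inner_sub_right, inner_sub_right]; ring
  have h2 : ‖inner ℂ (x ν) (y - e i)‖ ≤ |C| * ‖y - e i‖ :=
    (hC' ν _).trans (mul_le_mul_of_nonneg_right (le_abs_self C) (norm_nonneg _))
  have h3 := norm_inner_le_norm (𝕜 := ℂ) x₀ (y - e i)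
  have h4 : (|C| + ‖x₀‖) * ‖y - e i‖ ≤ ε / 2 := by
    calc (|C| + ‖x₀‖) * ‖y - e i‖ ≤ B * (ε / (2 * B)) := by
          gcongr
          linarith
      _ = ε / 2 := by field_simp
  rw [e1]
  refine (norm_add_le _ _).trans_lt ?_
  have h5 := norm_sub_le (inner ℂ (x ν) (y - e i)) (inner ℂ x₀ (y - e i))
  linarith

/-! ### Calculus of weak derivatives and weak L² convergence. -/

section WeakConvergence

variable {n : ℕ}

lemma HasWeakWirtinger.add {j : Fin n} {f₁ f₂ g₁ g₂ : (Fin n → ℂ) → ℂ} {Ω : Set (Fin n → ℂ)}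
    (h₁ : HasWeakWirtinger j f₁ g₁ Ω) (h₂ : HasWeakWirtinger j f₂ g₂ Ω) :
    HasWeakWirtinger j (fun z => f₁ z + f₂ z) (fun z => g₁ z + g₂ z) Ω := by
  refine ⟨h₁.1.add h₂.1, h₁.2.add h₂.2, fun φ hφ => ?_⟩
  have e1 := h₁.3 φ hφ
  have e2 := h₂.3 φ hφ
  simp only [distWirtinger, add_mul] at e1 e2 ⊢
  rw [integral_add (hφ.integrable_mul_wirtinger h₁.1 j) (hφ.integrable_mul_wirtinger h₂.1 j),
    integral_add (hφ.integrable_mul h₁.2) (hφ.integrable_mul h₂.2), ← e1, ← e2, neg_add]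

lemma HasWeakWirtinger.const_mul {j : Fin n} {f g : (Fin n → ℂ) → ℂ} {Ω : Set (Fin n → ℂ)}
    (h : HasWeakWirtinger j f g Ω) (c : ℂ) :
    HasWeakWirtinger j (fun z => c * f z) (fun z => c * g z) Ω := by
  refine ⟨h.1.smul c, h.2.smul c, fun φ hφ => ?_⟩
  have e := h.3 φ hφ
  simp only [distWirtinger, mul_assoc] at e ⊢
  rw [integral_const_mul, integral_const_mul, ← e, mul_neg]

lemma HasWeakWirtinger.sum {ι : Type*} (s : Finset ι) {j : Fin n}
    {f g : ι → (Fin n → ℂ) → ℂ} {Ω : Set (Fin n → ℂ)}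
    (h : ∀ i, HasWeakWirtinger j (f i) (g i) Ω) :
    HasWeakWirtinger j (fun z => ∑ i ∈ s, f i z) (fun z => ∑ i ∈ s, g i z) Ω := by
  classical
  induction s using Finset.induction_on with
  | empty =>
    have h0 : LocallyIntegrableOn (fun _ : Fin n → ℂ => (0 : ℂ)) Ω :=
      (locallyIntegrable_const 0).locallyIntegrableOn Ω
    exact ⟨by simpa using h0, by simpa using h0, fun φ _ => by simp [distWirtinger]⟩
  | insert a s ha ih =>
    simp only [Finset.sum_insert ha]
    exact (h a).add ih

lemma IsLocallyL2On.sum {ι : Type*} (s : Finset ι) {g : ι → (Fin n → ℂ) → ℂ}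
    {Ω : Set (Fin n → ℂ)} (h : ∀ i, IsLocallyL2On (g i) Ω) :
    IsLocallyL2On (fun z => ∑ i ∈ s, g i z) Ω := fun K hK hKc =>
  memLp_finsetSum s fun i _ => h i K hK hKc

lemma IsLocallyL2On.const_mul {g : (Fin n → ℂ) → ℂ} {Ω : Set (Fin n → ℂ)}
    (h : IsLocallyL2On g Ω) (c : ℂ) : IsLocallyL2On (fun z => c * g z) Ω := fun K hK hKc =>
  (h K hK hKc).const_mul c

/-- Weak derivatives are unique almost everywhere. -/
lemma HasWeakWirtinger.ae_eq {j : Fin n} {f g₁ g₂ : (Fin n → ℂ) → ℂ} {Ω : Set (Fin n → ℂ)}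
    (hΩ : IsOpen Ω) (h₁ : HasWeakWirtinger j f g₁ Ω) (h₂ : HasWeakWirtinger j f g₂ Ω) :
    g₁ =ᵐ[volume.restrict Ω] g₂ :=
  ae_eq_of_forall_integral_testFunction_eq hΩ h₁.2 h₂.2 fun φ hφ => by
    rw [← h₁.3 φ hφ, ← h₂.3 φ hφ]

lemma IsLocallyL2On.congr_ae {g₁ g₂ : (Fin n → ℂ) → ℂ} {Ω : Set (Fin n → ℂ)}
    (h : IsLocallyL2On g₁ Ω) (he : g₁ =ᵐ[volume.restrict Ω] g₂) : IsLocallyL2On g₂ Ω :=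
  fun K hK hKc => (h K hK hKc).ae_eq (ae_restrict_of_ae_restrict_of_subset hK he)

lemma continuousOn_wirtinger {j : Fin n} {F : (Fin n → ℂ) → ℂ} {Ω : Set (Fin n → ℂ)}
    (hΩ : IsOpen Ω) (hF : ContDiffOn ℝ ∞ F Ω) : ContinuousOn (wirtinger j F) Ω := by
  have h := hF.continuousOn_fderiv_of_isOpen hΩ (by simp)
  unfold wirtinger
  fun_prop

/-- Integration by parts. It asks for a derivative of F only on `tsupport φ`, so smoothness on Ω
suffices although F may be arbitrary elsewhere. -/
lemma integral_mul_fderiv_testFunction {F φ : (Fin n → ℂ) → ℂ} {Ω : Set (Fin n → ℂ)}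
    (hΩ : IsOpen Ω) (hF : ContDiffOn ℝ ∞ F Ω) (hφ : IsTestFunction Ω φ) (v : Fin n → ℂ) :
    (∫ z, F z * fderiv ℝ φ z v = -∫ z, fderiv ℝ F z v * φ z) ∧
      Integrable (fun z => F z * fderiv ℝ φ z v) ∧ Integrable fun z => fderiv ℝ F z v * φ z := by
  have hFi : LocallyIntegrableOn F Ω := hF.continuousOn.locallyIntegrableOn hΩ.measurableSet
  have hF' : ContinuousOn (fun z => fderiv ℝ F z v) Ω :=
    (hF.continuousOn_fderiv_of_isOpen hΩ (by simp)).clm_apply continuousOn_const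
  have hφ' : Continuous fun z => fderiv ℝ φ z v :=
    (hφ.smooth.continuous_fderiv (by simp)).clm_apply continuous_const
  have hs : tsupport (fun z => fderiv ℝ φ z v) ⊆ tsupport φ := by
    refine closure_minimal (fun z hz => ?_) (isClosed_tsupport φ)
    by_contra h
    refine hz ?_
    have : fderiv ℝ φ z = 0 := by
      by_contra h'
      exact h (support_fderiv_subset ℝ h')
    simp [this]
  have i1 : Integrable fun z => F z * fderiv ℝ φ z v :=
    integrable_mul_of_locallyIntegrableOn hFi hφ'
      (hφ.compact.mono' ((subset_tsupport _).trans hs)) (hs.trans hφ.subset)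
  have i2 : Integrable fun z => fderiv ℝ F z v * φ z :=
    hφ.integrable_mul (hF'.locallyIntegrableOn hΩ.measurableSet)
  refine ⟨integral_bilinear_hasLineDerivAt_right_eq_neg_left_of_integrable
    (B := ContinuousLinearMap.mul ℝ ℂ) (f' := fun z => fderiv ℝ F z v)
    (g' := fun z => fderiv ℝ φ z v) (v := v) i2 i1 (hφ.integrable_mul hFi)
    (fun z hz => ?_) (fun z _ => ?_), i1, i2⟩
  · exact ((hF.contDiffAt (hΩ.mem_nhds (hφ.subset hz))).differentiableAt
      (by simp)).hasFDerivAt.hasLineDerivAt v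
  · exact (hφ.differentiable z).hasFDerivAt.hasLineDerivAt v

lemma distWirtinger_eq_integral {j : Fin n} {F φ : (Fin n → ℂ) → ℂ} {Ω : Set (Fin n → ℂ)}
    (hΩ : IsOpen Ω) (hF : ContDiffOn ℝ ∞ F Ω) (hφ : IsTestFunction Ω φ) :
    distWirtinger j F φ = ∫ z, wirtinger j F z * φ z := by
  obtain ⟨h1, i1, k1⟩ := integral_mul_fderiv_testFunction hΩ hF hφ (Pi.single j 1)
  obtain ⟨h2, i2, k2⟩ := integral_mul_fderiv_testFunction hΩ hF hφ (Pi.single j Complex.I)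
  have e1 : ∀ z, F z * wirtinger j φ z = (1 / 2 : ℂ) * (F z * fderiv ℝ φ z (Pi.single j 1)) -
      (1 / 2 * Complex.I) * (F z * fderiv ℝ φ z (Pi.single j Complex.I)) := fun z => by
    simp only [wirtinger]; ring
  have e2 : ∀ z, wirtinger j F z * φ z = (1 / 2 : ℂ) * (fderiv ℝ F z (Pi.single j 1) * φ z) -
      (1 / 2 * Complex.I) * (fderiv ℝ F z (Pi.single j Complex.I) * φ z) := fun z => by
    simp only [wirtinger]; ring
  simp_rw [distWirtinger, e1, e2]
  rw [integral_sub (i1.const_mul _) (i2.const_mul _), integral_sub (k1.const_mul _)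
    (k2.const_mul _), integral_const_mul, integral_const_mul, integral_const_mul,
    integral_const_mul, h1, h2]
  ring

/-- All derivatives are viewed as vectors of L²(U), with U a relatively compact neighbourhood of K.
The uniform bound turns convergence of distributions into weak convergence there, and any χ in
L²(K), extended by zero, is a vector to test against. -/
lemma weaklyL2TendstoOn_wirtinger {j : Fin n} {Ω : Set (Fin n → ℂ)} (hΩ : IsOpen Ω)
    {F : ℕ → (Fin n → ℂ) → ℂ} {f g : (Fin n → ℂ) → ℂ} (hF : ∀ ν, ContDiffOn ℝ ∞ (F ν) Ω)
    (hfg : HasWeakWirtinger j f g Ω) (hg : IsLocallyL2On g Ω)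
    (hbd : ∀ U K : Set (Fin n → ℂ), IsOpen U → IsCompact K → U ⊆ K → K ⊆ Ω →
      ∃ C : ℝ, ∀ ν, ∀ φ : testFunctions U, ‖distWirtinger j (F ν) φ‖ ≤ C * ‖testToLp U φ‖)
    (hconv : ∀ φ, IsTestFunction Ω φ →
      Tendsto (fun ν => distWirtinger j (F ν) φ) atTop (𝓝 (distWirtinger j f φ))) :
    WeaklyL2TendstoOn (fun ν => wirtinger j (F ν)) g Ω := by
  intro K hKΩ hK
  obtain ⟨K', hK', hKK', hK'Ω⟩ := exists_compact_between hK hΩ hKΩ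
  set U := interior K'
  have hUo : IsOpen U := isOpen_interior
  have hUΩ : U ⊆ Ω := interior_subset.trans hK'Ω
  have hgν : ∀ ν, MemLp (wirtinger j (F ν)) 2 (volume.restrict U) := fun ν => by
    have hc := (continuousOn_wirtinger (j := j) hΩ (hF ν)).mono hK'Ω
    obtain ⟨B, hB⟩ := hK'.exists_bound_of_continuousOn hc
    have : IsFiniteMeasure (volume.restrict K' : Measure (Fin n → ℂ)) :=
      ⟨by simpa using hK'.measure_lt_top⟩
    have hm : MemLp (wirtinger j (F ν)) 2 (volume.restrict K') :=
      MemLp.of_bound (hc.aestronglyMeasurable hK'.measurableSet) B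
        (ae_restrict_of_forall_mem hK'.measurableSet hB)
    exact hm.mono_measure (Measure.restrict_mono interior_subset le_rfl)
  have hgU : MemLp g 2 (volume.restrict U) :=
    (hg K' hK'Ω hK').mono_measure (Measure.restrict_mono interior_subset le_rfl)
  have hKU : (volume.restrict K : Measure (Fin n → ℂ)) ≤ volume.restrict U :=
    Measure.restrict_mono hKK' le_rfl
  refine ⟨fun ν => (hgν ν).mono_measure hKU, hgU.mono_measure hKU, fun χ hχ => ?_⟩
  obtain ⟨C, hC⟩ := hbd U K' hUo hK' interior_subset hK'Ω
  have hc : ∀ {g : (Fin n → ℂ) → ℂ}, MemLp g 2 (volume.restrict U) →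
      MemLp (fun z => starRingEnd ℂ (g z)) 2 (volume.restrict U) := fun hg => hg.star
  have hχU : MemLp (K.indicator χ) 2 (volume.restrict U) := by
    rw [memLp_indicator_iff_restrict hK.measurableSet, Measure.restrict_restrict hK.measurableSet,
      inter_eq_left.2 hKK']
    exact hχ
  have key : ∀ {g : (Fin n → ℂ) → ℂ} (hg : MemLp g 2 (volume.restrict U)),
      inner ℂ (hc hg).toLp hχU.toLp = ∫ z in K, χ z * g z := by
    intro g hg
    have e : ∫ z in K, χ z * g z = ∫ z in U, K.indicator (fun z => χ z * g z) z := by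
      rw [integral_indicator hK.measurableSet, Measure.restrict_restrict hK.measurableSet,
        inter_eq_left.2 hKK']
    rw [L2.inner_def, e]
    refine integral_congr_ae ?_
    filter_upwards [MemLp.coeFn_toLp (hc hg), MemLp.coeFn_toLp hχU] with z h1 h2
    rw [h1, h2, RCLike.inner_apply, RCLike.conj_conj]
    by_cases hz : z ∈ K <;> simp [hz]
  have hν : ∀ ν (φ : testFunctions U), inner ℂ (hc (hgν ν)).toLp (testToLp U φ) =
      distWirtinger j (F ν) φ := fun ν φ => by
    rw [inner_testToLp φ _ (MemLp.coeFn_toLp _),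
      distWirtinger_eq_integral hΩ (hF ν) (IsTestFunction.mono φ.2 hUΩ)]
  have h0 : ∀ φ : testFunctions U, inner ℂ (hc hgU).toLp (testToLp U φ) =
      distWirtinger j f φ := fun φ => by
    rw [inner_testToLp φ _ (MemLp.coeFn_toLp _), hfg.3 φ (IsTestFunction.mono φ.2 hUΩ)]
  have := tendsto_inner_of_denseRange (denseRange_testToLp hUo)
    (x := fun ν => (hc (hgν ν)).toLp) (x₀ := (hc hgU).toLp) (C := C)
    (fun ν φ => by rw [hν]; exact hC ν φ)
    (fun φ => by
      rw [h0]
      exact (hconv φ (IsTestFunction.mono φ.2 hUΩ)).congr fun ν => (hν ν φ).symm) hχU.toLp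
  rw [key hgU] at this
  exact this.congr fun ν => key (hgν ν)

end WeakConvergence

/-! ### Determinants of positive definite matrices -/

section Matrices

open Matrix

variable {r : ℕ}

/-- With y = 1 − x and |y| ≤ 1/2, the remainder of the logarithm series after its linear term is at
most y²/(1 − |y|) ≤ 2y². -/
lemma sub_one_sub_two_mul_sq_le_log {x : ℝ} (hx : (x - 1) ^ 2 ≤ 1 / 4) :
    x - 1 - 2 * (x - 1) ^ 2 ≤ Real.log x := by
  have h0 : |1 - x| ≤ 1 / 2 := by
    rw [abs_le]; constructor <;> nlinarith
  have h1 := Real.abs_log_sub_add_sum_range_le (x := 1 - x) (by linarith) 1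
  have h2 : |1 - x| ^ (1 + 1) / (1 - |1 - x|) ≤ 2 * (x - 1) ^ 2 := by
    rw [div_le_iff₀ (by linarith), sq_abs]
    nlinarith [sq_nonneg (x - 1)]
  have h3 := (abs_le.1 (h1.trans h2)).1
  simp only [Finset.range_one, Finset.sum_singleton, zero_add, pow_one, Nat.cast_zero, div_one,
    sub_sub_cancel] at h3
  linarith

/-- Diagonalization reduces this to the scalar inequality for each eigenvalue λ. As tr (K − 1)² is
the sum of the (λ − 1)², the hypothesis places every λ in [1/2, 3/2]. -/
lemma sub_le_log_det {K : Matrix (Fin r) (Fin r) ℂ} (hK : K.IsHermitian)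
    (hs : ((K - 1) * (K - 1)).trace.re ≤ 1 / 4) :
    K.trace.re - r - 2 * ((K - 1) * (K - 1)).trace.re ≤ Real.log K.det.re := by
  have h1 : K.det.re = ∏ i, hK.eigenvalues i := by
    rw [hK.det_eq_prod_eigenvalues]
    have : (∏ i, (RCLike.ofReal (hK.eigenvalues i) : ℂ)) =
      ((∏ i, hK.eigenvalues i : ℝ) : ℂ) := by push_cast; rfl
    rw [this, Complex.ofReal_re]
  have h2 : K.trace.re = ∑ i, hK.eigenvalues i := by
    rw [hK.trace_eq_sum_eigenvalues]
    simp
  have h3 : (K * K).trace.re = ∑ i, hK.eigenvalues i ^ 2 := by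
    have hsp := hK.spectral_theorem
    rw [Unitary.conjStarAlgAut_apply] at hsp
    set V := (hK.eigenvectorUnitary : Matrix (Fin r) (Fin r) ℂ)
    set D : Matrix (Fin r) (Fin r) ℂ := diagonal (RCLike.ofReal ∘ hK.eigenvalues)
    have hV : star V * V = 1 := Unitary.coe_star_mul_self hK.eigenvectorUnitary
    have h4 : K * K = V * (D * D) * star V := by
      rw [hsp]
      calc V * D * star V * (V * D * star V) = V * D * (star V * V) * D * star V := by
            simp only [Matrix.mul_assoc]
        _ = _ := by rw [hV]; simp only [Matrix.mul_assoc, Matrix.mul_one]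
    rw [h4, Matrix.trace_mul_comm, ← Matrix.mul_assoc, hV, Matrix.one_mul, diagonal_mul_diagonal,
      Matrix.trace_diagonal]
    simp [pow_two]
  have h5 : ((K - 1) * (K - 1)).trace.re = ∑ i, (hK.eigenvalues i - 1) ^ 2 := by
    have : (K - 1) * (K - 1) = K * K - K - K + 1 := by noncomm_ring
    rw [this]
    simp only [trace_add, trace_sub, Complex.add_re, Complex.sub_re, h3, h2, trace_one,
      sub_sq, Finset.sum_add_distrib, Finset.sum_sub_distrib, ← Finset.mul_sum, mul_one,
      Fintype.card_fin]
    simp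
    ring
  rw [h1, h2]
  have hle : ∀ i, (hK.eigenvalues i - 1) ^ 2 ≤ 1 / 4 := fun i =>
    (Finset.single_le_sum (f := fun i => (hK.eigenvalues i - 1) ^ 2)
      (fun i _ => sq_nonneg _) (Finset.mem_univ i)).trans (h5 ▸ hs)
  rw [h5, Real.log_prod fun i _ => by have := hle i; nlinarith]
  calc ∑ i, hK.eigenvalues i - r - 2 * ∑ i, (hK.eigenvalues i - 1) ^ 2
      = ∑ i, (hK.eigenvalues i - 1 - 2 * (hK.eigenvalues i - 1) ^ 2) := by
        simp [Finset.sum_sub_distrib, Finset.mul_sum]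
    _ ≤ _ := Finset.sum_le_sum fun i _ => sub_one_sub_two_mul_sq_le_log (hle i)

open scoped MatrixOrder ComplexOrder in
lemma exists_conjTranspose_mul_mul_eq_one {B : Matrix (Fin r) (Fin r) ℂ} (hB : B.PosDef) :
    ∃ S : Matrix (Fin r) (Fin r) ℂ, Sᴴ * B * S = 1 := by
  obtain ⟨N, hN⟩ := CStarAlgebra.nonneg_iff_eq_star_mul_self.mp hB.posSemidef.nonneg
  have hu : IsUnit N.det := by
    rw [isUnit_iff_ne_zero]
    intro h0
    have := hB.det_pos.ne'
    rw [hN, det_mul, h0, mul_zero] at this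
    exact this rfl
  refine ⟨N⁻¹, ?_⟩
  rw [hN, star_eq_conjTranspose, Matrix.mul_assoc, Matrix.mul_assoc, Matrix.mul_nonsing_inv _ hu,
    Matrix.mul_one, ← conjTranspose_mul, Matrix.mul_nonsing_inv _ hu, conjTranspose_one]

lemma re_dotProduct_column (P M : Matrix (Fin r) (Fin r) ℂ) (i : Fin r) :
    (Pᴴ * M * P) i i = star (fun k => P k i) ⬝ᵥ M *ᵥ (fun k => P k i) := by
  rw [Matrix.mul_assoc, Matrix.mul_apply]
  simp only [dotProduct, Matrix.conjTranspose_apply, Pi.star_apply]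
  rfl

end Matrices

/-! ### Normal frames and the infinitesimal sub-mean value inequality for log det. -/

section

attribute [local instance] Matrix.linftyOpNormedRing Matrix.linftyOpNormedAlgebra

open Matrix

variable {r : ℕ}

lemma exists_sq_bound_of_hasFDerivAt_zero {E : Type*} [NormedAddCommGroup E] [NormedSpace ℝ E]
    {f : ℂ → E} (hf : ContDiff ℝ ∞ f) (h0 : fderiv ℝ f 0 = 0) :
    ∃ C δ : ℝ, 0 < δ ∧ ∀ w, ‖w‖ < δ → ‖f w - f 0‖ ≤ C * ‖w‖ ^ 2 := by
  have h1 : ContDiff ℝ 1 (fderiv ℝ f) := hf.fderiv_right (by norm_cast)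
  obtain ⟨C, t, ht, hC⟩ := (h1.contDiffAt (x := 0)).exists_lipschitzOnWith
  obtain ⟨δ, hδ, hδt⟩ := Metric.mem_nhds_iff.1 ht
  refine ⟨C, δ, hδ, fun w hw => ?_⟩
  have hd : Differentiable ℝ f := hf.differentiable (by simp)
  have := Convex.norm_image_sub_le_of_norm_hasFDerivWithin_le (f := f) (f' := fderiv ℝ f)
    (s := segment ℝ 0 w) (C := C * ‖w‖) (x := 0) (y := w)
    (fun x _ => (hd x).hasFDerivAt.hasFDerivWithinAt) (fun x hx => ?_) (convex_segment _ _)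
    (left_mem_segment _ _ _) (right_mem_segment _ _ _)
  · simpa [pow_two, mul_assoc] using this
  · obtain ⟨s, hs, rfl⟩ := segment_eq_image' ℝ 0 w ▸ hx
    have hsn : ‖s • w‖ ≤ ‖w‖ := by
      rw [norm_smul, Real.norm_of_nonneg hs.1]
      exact mul_le_of_le_one_left (norm_nonneg _) hs.2
    have hl := hC.norm_sub_le (x := s • w) (y := 0) (hδt (by simpa using hsn.trans_lt hw))
      (hδt (by simpa using hδ))
    rw [h0, sub_zero, sub_zero] at hl
    simp only [zero_add, sub_zero]
    exact hl.trans (by gcongr)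

/-- By the product rule the derivative in direction v is v G A + D v + v̄ A* G at the centre, and
`hD` says exactly that these terms cancel. -/
lemma hasFDerivAt_frame {G : ℂ → Matrix (Fin r) (Fin r) ℂ} {A : Matrix (Fin r) (Fin r) ℂ}
    {D : ℂ →L[ℝ] Matrix (Fin r) (Fin r) ℂ} {z₀ : ℂ} (hG : HasFDerivAt G D z₀)
    (hD : ∀ v, D v = -(v • (G z₀ * A)) - starRingEnd ℂ v • (Aᴴ * G z₀)) :
    HasFDerivAt (fun w => (1 + starRingEnd ℂ w • Aᴴ) * G (z₀ + w) * (1 + w • A))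
      (0 : ℂ →L[ℝ] Matrix (Fin r) (Fin r) ℂ) 0 := by
  have h1 : HasFDerivAt (fun w : ℂ => 1 + starRingEnd ℂ w • Aᴴ)
      ((Complex.conjCLE : ℂ →L[ℝ] ℂ).smulRight Aᴴ) 0 :=
    (((Complex.conjCLE : ℂ →L[ℝ] ℂ).smulRight Aᴴ).hasFDerivAt).const_add 1
  have h2 : HasFDerivAt (fun w : ℂ => G (z₀ + w)) D 0 := by
    have := HasFDerivAt.comp (x := (0 : ℂ)) (g := G) (f := fun w => z₀ + w) (g' := D)
      (by rw [add_zero]; exact hG) ((hasFDerivAt_id (𝕜 := ℝ) (0 : ℂ)).const_add z₀)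
    simpa using! this
  have h3 : HasFDerivAt (fun w : ℂ => 1 + w • A)
      ((ContinuousLinearMap.id ℝ ℂ).smulRight A) 0 :=
    (((ContinuousLinearMap.id ℝ ℂ).smulRight A).hasFDerivAt).const_add 1
  convert! (h1.mul' h2).mul' h3 using 1
  ext v : 1
  change (0 : Matrix (Fin r) (Fin r) ℂ) =
    ((1 + starRingEnd ℂ 0 • Aᴴ) * G (z₀ + 0)) * (v • A) +
      ((1 + starRingEnd ℂ 0 • Aᴴ) * D v + (starRingEnd ℂ v • Aᴴ) * G (z₀ + 0)) * (1 + (0 : ℂ) • A)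
  simp only [map_zero, zero_smul, add_zero, one_mul, mul_one, hD, Matrix.mul_smul,
    Matrix.smul_mul]
  abel

end

section

open Matrix
open scoped ComplexOrder

variable {r : ℕ}

attribute [local instance] Matrix.linftyOpNormedRing Matrix.linftyOpNormedAlgebra

/-- The `(i, j)` entry, as a continuous real-linear functional. -/
noncomputable def entryCLM (i j : Fin r) : Matrix (Fin r) (Fin r) ℂ →L[ℝ] ℂ :=
  LinearMap.toContinuousLinearMap (Matrix.entryLinearMap ℝ ℂ i j)

lemma contDiff_matrix {G : ℂ → Matrix (Fin r) (Fin r) ℂ}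
    (hG : ∀ i j, ContDiff ℝ ∞ fun z => G z i j) : ContDiff ℝ ∞ G := by
  have : G = fun z => ∑ i, ∑ j, G z i j • Matrix.single i j (1 : ℂ) := by
    ext z : 1
    conv_lhs => rw [Matrix.matrix_eq_sum_single (G z)]
    simp [Matrix.smul_single]
  rw [this]
  exact ContDiff.sum fun i _ => ContDiff.sum fun j _ => (hG i j).smul contDiff_const

lemma fderiv_matrix_conjTranspose {G : ℂ → Matrix (Fin r) (Fin r) ℂ} (hG : Differentiable ℝ G)
    (hh : ∀ z, (G z).IsHermitian) (z v : ℂ) : (fderiv ℝ G z v)ᴴ = fderiv ℝ G z v := by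
  ext i j
  have h1 : ∀ i j, fderiv ℝ (fun z => G z i j) z v = fderiv ℝ G z v i j := fun i j => by
    have := ((entryCLM i j).hasFDerivAt.comp z (hG z).hasFDerivAt).fderiv
    change fderiv ℝ (fun z => G z i j) z = _ at this
    rw [this]
    rfl
  rw [Matrix.conjTranspose_apply, ← h1, ← h1]
  have h2 : (fun z => G z i j) = fun z => Complex.conjCLE (G z j i) := by
    ext z
    exact ((hh z).apply i j).symm
  rw [h2]
  have hd : DifferentiableAt ℝ (fun z => G z j i) z :=
    ((entryCLM j i).differentiable.comp hG) z
  have := ((Complex.conjCLE : ℂ →L[ℝ] ℂ).hasFDerivAt.comp z hd.hasFDerivAt).fderiv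
  change fderiv ℝ (fun z => Complex.conjCLE (G z j i)) z = _ at this
  rw [this]
  rfl

lemma norm_entry_le_linftyOpNorm (M : Matrix (Fin r) (Fin r) ℂ) (i j : Fin r) :
    ‖M i j‖ ≤ ‖M‖ := by
  rw [Matrix.linfty_opNorm_def]
  have h1 : ‖M i j‖₊ ≤ ∑ j, ‖M i j‖₊ :=
    Finset.single_le_sum (f := fun j => ‖M i j‖₊) (fun _ _ => zero_le) (Finset.mem_univ j)
  have h2 := Finset.le_sup (f := fun i => ∑ j, ‖M i j‖₊) (Finset.mem_univ i)
  exact_mod_cast h1.trans h2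

/-- The choice is A = −G⁻¹ ∂G at z₀. As G is hermitian, the ∂̄ part of dG is the adjoint of the ∂
part, so a single matrix A accounts for both. -/
lemma exists_frame {G : ℂ → Matrix (Fin r) (Fin r) ℂ} (hG : Differentiable ℝ G)
    (hpd : ∀ z, (G z).PosDef) (z₀ : ℂ) : ∃ A : Matrix (Fin r) (Fin r) ℂ, ∀ v,
      fderiv ℝ G z₀ v = -(v • (G z₀ * A)) - starRingEnd ℂ v • (Aᴴ * G z₀) := by
  set D := fderiv ℝ G z₀
  have hDh : ∀ v, (D v)ᴴ = D v := fderiv_matrix_conjTranspose hG (fun z => (hpd z).1) z₀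
  have hu : IsUnit (G z₀).det := (Matrix.isUnit_iff_isUnit_det _).1 (hpd z₀).isUnit
  set A₁ : Matrix (Fin r) (Fin r) ℂ := (1 / 2 : ℂ) • (D 1 - Complex.I • D Complex.I) with hA₁
  refine ⟨-((G z₀)⁻¹ * A₁), fun v => ?_⟩
  have e1 : G z₀ * -((G z₀)⁻¹ * A₁) = -A₁ := by
    rw [mul_neg, ← mul_assoc, Matrix.mul_nonsing_inv _ hu, one_mul]
  have e2 : (-((G z₀)⁻¹ * A₁))ᴴ * G z₀ = -A₁ᴴ := by
    rw [conjTranspose_neg, conjTranspose_mul, conjTranspose_nonsing_inv, (hpd z₀).1.eq, neg_mul,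
      mul_assoc, Matrix.nonsing_inv_mul _ hu, mul_one]
  have e3 : A₁ᴴ = (1 / 2 : ℂ) • (D 1 + Complex.I • D Complex.I) := by
    rw [hA₁, conjTranspose_smul, conjTranspose_sub, conjTranspose_smul, hDh, hDh]
    simp
  have e4 : D v = v.re • D 1 + v.im • D Complex.I := by
    rw [← map_smul, ← map_smul, ← map_add]
    congr 1
    simp [Complex.real_smul]
  rw [e1, e2, e3, e4, hA₁]
  ext i j
  simp only [Matrix.add_apply, Matrix.sub_apply, Matrix.neg_apply, Matrix.smul_apply, smul_eq_mul,
    Complex.real_smul, smul_neg]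
  have h1 : starRingEnd ℂ v = v.re - v.im * Complex.I := by
    apply Complex.ext <;> simp
  rw [h1]
  conv_rhs => rw [← Complex.re_add_im v]
  simp only [Complex.add_re, Complex.add_im, Complex.ofReal_re, Complex.ofReal_im, Complex.mul_re,
    Complex.mul_im, Complex.I_re, Complex.I_im, mul_zero, mul_one, sub_zero, add_zero, zero_add]
  linear_combination ((v.im : ℂ) * (D Complex.I i j)) * Complex.I_sq

/-- In the frame P(z) = (1 + (z − z₀)A)S the metric K = P*GP is 1 to first order. `sub_le_log_det`
compares log det K with tr K − r up to O(t⁴), and log det K = log det G + 2 log|det P| with det P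
holomorphic and zero-free near z₀. -/
lemma exists_sub_le_circleAverage_log_det {G : ℂ → Matrix (Fin r) (Fin r) ℂ}
    (hG : ∀ i j, ContDiff ℝ ∞ fun z => G z i j) (hpd : ∀ z, (G z).PosDef) (z₀ : ℂ) {t₁ : ℝ}
    (ht₁ : 0 < t₁)
    (hsub : ∀ t, 0 < t → t < t₁ → ∀ v w : Fin r → ℂ, (star v ⬝ᵥ G z₀ *ᵥ v).re ≤
      Real.circleAverage
        (fun z => (star (v + (z - z₀) • w) ⬝ᵥ G z *ᵥ (v + (z - z₀) • w)).re) z₀ t) :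
    ∃ C δ : ℝ, 0 < δ ∧ ∀ t, 0 < t → t < δ →
      Real.log (G z₀).det.re - C * t ^ 4 ≤
        Real.circleAverage (fun z => Real.log (G z).det.re) z₀ t := by
  have hGs := contDiff_matrix hG
  have hGd : Differentiable ℝ G := hGs.differentiable (by simp)
  have hGc : Continuous G := hGs.continuous
  obtain ⟨A, hA⟩ := exists_frame hGd hpd z₀
  obtain ⟨S, hS⟩ := exists_conjTranspose_mul_mul_eq_one (hpd z₀)
  set P : ℂ → Matrix (Fin r) (Fin r) ℂ := fun z => (1 + (z - z₀) • A) * S with hP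
  have hPc : Continuous P := by simp only [hP]; fun_prop
  set F : ℂ → Matrix (Fin r) (Fin r) ℂ := fun w =>
    (1 + starRingEnd ℂ w • Aᴴ) * G (z₀ + w) * (1 + w • A) with hF
  have hFs : ContDiff ℝ ∞ F := by
    have h1 : ContDiff ℝ ∞ (starRingEnd ℂ) := Complex.conjCLE.contDiff
    simp only [hF]
    have h2 : ContDiff ℝ ∞ fun w => 1 + starRingEnd ℂ w • Aᴴ :=
      contDiff_const.add (h1.smul contDiff_const)
    have h3 : ContDiff ℝ ∞ fun w : ℂ => 1 + w • A :=
      contDiff_const.add (contDiff_id.smul contDiff_const)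
    have h4 : ContDiff ℝ ∞ fun w => G (z₀ + w) := hGs.comp (contDiff_const.add contDiff_id)
    exact (h2.mul h4).mul h3
  obtain ⟨C₀, δ₀, hδ₀, hC₀⟩ := exists_sq_bound_of_hasFDerivAt_zero hFs
    (hasFDerivAt_frame (hGd z₀).hasFDerivAt hA).fderiv
  have hF0 : F 0 = G z₀ := by simp [hF]
  set K : ℂ → Matrix (Fin r) (Fin r) ℂ := fun z => (P z)ᴴ * G z * P z with hK
  have hKF : ∀ z, K z - 1 = Sᴴ * (F (z - z₀) - G z₀) * S := by
    intro z
    rw [mul_sub, sub_mul, hS]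
    simp only [hK, hP, hF, conjTranspose_mul, conjTranspose_add, conjTranspose_one,
      conjTranspose_smul, add_sub_cancel, mul_assoc]
    rfl
  obtain ⟨c₁, hc₁0, hc₁⟩ : ∃ c₁ : ℝ, 0 ≤ c₁ ∧ ∀ M : Matrix (Fin r) (Fin r) ℂ,
      M.trace.re ≤ c₁ * ‖M‖ := by
    refine ⟨r, Nat.cast_nonneg r, fun M => (Complex.re_le_norm _).trans ?_⟩
    calc ‖M.trace‖ ≤ ∑ i, ‖M i i‖ := norm_sum_le _ _
      _ ≤ ∑ _i : Fin r, ‖M‖ := Finset.sum_le_sum fun i _ => norm_entry_le_linftyOpNorm M i i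
      _ = r * ‖M‖ := by simp
  set c : ℝ := c₁ * (‖Sᴴ‖ * |C₀| * ‖S‖) ^ 2 with hc
  have hc0 : 0 ≤ c := by positivity
  have hKc : ∀ z, ‖z - z₀‖ < δ₀ → ((K z - 1) * (K z - 1)).trace.re ≤ c * ‖z - z₀‖ ^ 4 := by
    intro z hz
    have h1 : ‖K z - 1‖ ≤ (‖Sᴴ‖ * |C₀| * ‖S‖) * ‖z - z₀‖ ^ 2 := by
      rw [hKF]
      have h2 := hC₀ _ hz
      rw [hF0] at h2
      calc ‖Sᴴ * (F (z - z₀) - G z₀) * S‖ ≤ ‖Sᴴ‖ * ‖F (z - z₀) - G z₀‖ * ‖S‖ :=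
            (norm_mul_le _ _).trans (mul_le_mul_of_nonneg_right (norm_mul_le _ _) (norm_nonneg _))
        _ ≤ ‖Sᴴ‖ * (|C₀| * ‖z - z₀‖ ^ 2) * ‖S‖ := by
            gcongr
            exact h2.trans (mul_le_mul_of_nonneg_right (le_abs_self _) (by positivity))
        _ = _ := by ring
    calc _ ≤ c₁ * ‖(K z - 1) * (K z - 1)‖ := hc₁ _
      _ ≤ c₁ * (‖K z - 1‖ * ‖K z - 1‖) := by gcongr; exact norm_mul_le _ _
      _ ≤ c₁ * (((‖Sᴴ‖ * |C₀| * ‖S‖) * ‖z - z₀‖ ^ 2) * ((‖Sᴴ‖ * |C₀| * ‖S‖) * ‖z - z₀‖ ^ 2)) := by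
          gcongr
      _ = _ := by rw [hc]; ring
  have hdet : ∀ z, (K z).det.re = ‖(P z).det‖ ^ 2 * (G z).det.re := by
    intro z
    have h1 : (K z).det = ((‖(P z).det‖ ^ 2 : ℝ) : ℂ) * (G z).det := by
      rw [hK, det_mul, det_mul, det_conjTranspose, ← Complex.normSq_eq_norm_sq,
        ← Complex.mul_conj]
      simp only [RCLike.star_def]
      ring
    rw [h1, Complex.re_ofReal_mul]
  have hdetG : ∀ z, 0 < (G z).det.re := fun z => by
    have := (hpd z).det_pos
    exact (Complex.pos_iff.1 this).1
  have hdet0 : ‖S.det‖ ^ 2 * (G z₀).det.re = 1 := by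
    have h1 := hdet z₀
    have h2 : K z₀ = 1 := by simp [hK, hP, hS]
    rw [h2] at h1
    simpa [hP] using h1.symm
  have hS0 : S.det ≠ 0 := fun h => by simp [h] at hdet0
  have hPd : Differentiable ℂ fun z => (P z).det := by
    simp only [hP, det_mul]
    refine Differentiable.mul_const ?_ _
    simp only [det_apply, Matrix.add_apply, Matrix.smul_apply, smul_eq_mul]
    fun_prop
  obtain ⟨δ₁, hδ₁, hPne⟩ : ∃ δ₁ > 0, ∀ z, ‖z - z₀‖ < δ₁ → (P z).det ≠ 0 := by
    have h1 : ∀ᶠ z in 𝓝 z₀, (P z).det ≠ 0 :=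
      hPd.continuous.continuousAt.eventually_ne (by simpa [hP] using hS0)
    obtain ⟨δ₁, hδ₁, h2⟩ := Metric.eventually_nhds_iff.1 h1
    exact ⟨δ₁, hδ₁, fun z hz => h2 (by rwa [dist_eq_norm])⟩
  obtain ⟨δ₂, hδ₂, hcδ⟩ : ∃ δ₂ > 0, ∀ t : ℝ, 0 < t → t < δ₂ → c * t ^ 4 ≤ 1 / 4 := by
    have h1 : Tendsto (fun t : ℝ => c * t ^ 4) (𝓝 0) (𝓝 (c * 0 ^ 4)) :=
      (by fun_prop : Continuous fun t : ℝ => c * t ^ 4).tendsto 0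
    have h2 : ∀ᶠ t in 𝓝 (0 : ℝ), c * t ^ 4 < 1 / 4 := h1.eventually_lt_const (by norm_num)
    obtain ⟨δ₂, hδ₂, h3⟩ := Metric.eventually_nhds_iff.1 h2
    exact ⟨δ₂, hδ₂, fun t ht0 ht => (h3 (by simpa [abs_of_pos ht0] using ht)).le⟩
  -- The radius must allow `hsub` (t₁), the quadratic bound on K − 1 (δ₀), det P ≠ 0 (δ₁) and the
  -- smallness demanded by `sub_le_log_det` (δ₂).
  refine ⟨2 * c, min (min t₁ δ₀) (min δ₁ δ₂), by positivity, fun t ht htδ => ?_⟩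
  obtain ⟨⟨htt₁, htδ₀⟩, htδ₁, htδ₂⟩ : (t < t₁ ∧ t < δ₀) ∧ t < δ₁ ∧ t < δ₂ := by
    simpa [lt_min_iff] using htδ
  -- The columns of P are the affine sections vᵢ + (z − z₀)wᵢ, so tr K is the sum of their squared
  -- norms.
  set v : Fin r → Fin r → ℂ := fun i k => S k i with hv
  set w : Fin r → Fin r → ℂ := fun i k => (A * S) k i with hw
  set Q : Fin r → ℂ → ℝ := fun i z =>
    (star (v i + (z - z₀) • w i) ⬝ᵥ G z *ᵥ (v i + (z - z₀) • w i)).re with hQ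
  have hQc : ∀ i, Continuous (Q i) := fun i => by
    simp only [hQ]
    refine Complex.continuous_re.comp (Continuous.dotProduct ?_ (Continuous.matrix_mulVec hGc ?_))
    · fun_prop
    · fun_prop
  have hcol : ∀ i z, (fun k => P z k i) = v i + (z - z₀) • w i := fun i z => by
    ext k
    simp only [hP, hv, hw, add_mul, one_mul, Matrix.add_apply, Matrix.smul_mul, Matrix.smul_apply,
      Pi.add_apply, Pi.smul_apply]
  have htr : ∀ z, (K z).trace.re = ∑ i, Q i z := fun z => by
    rw [Matrix.trace, Complex.re_sum]
    refine Finset.sum_congr rfl fun i _ => ?_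
    rw [Matrix.diag_apply]
    simp only [hK]
    rw [re_dotProduct_column, hcol]
  have htr0 : ∑ i, Q i z₀ = r := by
    rw [← htr]
    have h2 : K z₀ = 1 := by simp [hK, hP, hS]
    simp [h2]
  have hlogGc : Continuous fun z => Real.log (G z).det.re :=
    (Complex.continuous_re.comp hGc.matrix_det).log fun z => (hdetG z).ne'
  have hPl : ContinuousOn (fun z => Real.log ‖(P z).det‖) (Metric.sphere z₀ |t|) :=
    ContinuousOn.log (by fun_prop) fun z hz => norm_ne_zero_iff.2 (hPne z (by
      rw [mem_sphere_iff_norm, abs_of_pos ht] at hz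
      rw [hz]; exact htδ₁))
  have hPavg : Real.circleAverage (fun z => Real.log ‖(P z).det‖) z₀ t = Real.log ‖S.det‖ := by
    have := AnalyticOnNhd.circleAverage_log_norm_of_ne_zero (R := t) (c := z₀)
      (g := fun z => (P z).det) (fun z _ => hPd.analyticAt z) (fun z hz => hPne z (by
        rw [mem_closedBall_iff_norm, abs_of_pos ht] at hz
        exact hz.trans_lt htδ₁))
    simpa [hP] using this
  have i1 : CircleIntegrable (fun z => ∑ i, Q i z) z₀ t :=
    (continuous_finsetSum _ fun i _ => hQc i).continuousOn.circleIntegrable'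
  have i2 : CircleIntegrable (fun z => Real.log (G z).det.re) z₀ t :=
    hlogGc.continuousOn.circleIntegrable'
  have i3 : CircleIntegrable (fun z => Real.log ‖(P z).det‖) z₀ t := hPl.circleIntegrable'
  have i4 : CircleIntegrable (fun _ : ℂ => (r : ℝ) + 2 * (c * t ^ 4)) z₀ t :=
    continuousOn_const.circleIntegrable'
  have pw : ∀ z ∈ Metric.sphere z₀ |t|, (∑ i, Q i z) - (r + 2 * (c * t ^ 4)) ≤
      Real.log (G z).det.re + (2 : ℝ) • Real.log ‖(P z).det‖ := by
    intro z hz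
    rw [mem_sphere_iff_norm, abs_of_pos ht] at hz
    have h1 := hKc z (by rw [hz]; exact htδ₀)
    rw [hz] at h1
    have h2 := sub_le_log_det (K := K z) ((isHermitian_conjTranspose_mul_mul _ (hpd z).1))
      (h1.trans (hcδ t ht htδ₂))
    have h3 : (P z).det ≠ 0 := hPne z (by rw [hz]; exact htδ₁)
    rw [hdet, Real.log_mul (by positivity) (hdetG z).ne', Real.log_pow, htr] at h2
    rw [smul_eq_mul]
    push_cast at h2
    linarith
  have hfin := Real.circleAverage_mono (i1.sub i4) (i2.add (i3.const_smul (a := (2 : ℝ)))) pw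
  rw [Real.circleAverage_sub i1 i4,
    Real.circleAverage_add i2 (i3.const_smul (a := (2 : ℝ))), Real.circleAverage_smul,
    hPavg, Real.circleAverage_const,
    Real.circleAverage_fun_sum fun i _ => (hQc i).continuousOn.circleIntegrable'] at hfin
  have hQsub : (r : ℝ) ≤ ∑ i, Real.circleAverage (Q i) z₀ t := by
    rw [← htr0]
    refine Finset.sum_le_sum fun i _ => ?_
    have := hsub t ht htt₁ (v i) (w i)
    simpa [hQ] using this
  -- At the centre K = 1, so the harmonic term 2 log|det S| is exactly compensated by log det G(z₀).
  have hlog : Real.log (G z₀).det.re = -(2 * Real.log ‖S.det‖) := by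
    have h1 := congrArg Real.log hdet0
    have h2 := norm_pos_iff.2 hS0
    rw [Real.log_mul (by positivity) (hdetG z₀).ne', Real.log_pow, Real.log_one] at h1
    push_cast at h1
    linarith
  rw [hlog]
  rw [smul_eq_mul] at hfin
  linarith

end

/-! ### From local to global sub-mean value inequalities -/

/-- This replaces the solution of the Dirichlet problem. Trigonometric polynomials are uniformly
dense, and since ζ⁻¹ = ζ̄ on the circle, their real and imaginary parts are there the real parts of
polynomials. -/
lemma exists_entire_approx_on_circle {φ : ℂ → ℝ} (hφ : Continuous φ) {ε : ℝ} (hε : 0 < ε) :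
    ∃ q : ℂ → ℂ, Differentiable ℂ q ∧ ∀ ζ : ℂ, ‖ζ‖ = 1 → |(q ζ).re - φ ζ| < ε := by
  -- Real and imaginary parts are carried together because complex coefficients mix them.
  have key : ∀ g ∈ Submodule.span ℂ (range (@fourier 1)), ∃ q₁ q₂ : ℂ → ℂ,
      Differentiable ℂ q₁ ∧ Differentiable ℂ q₂ ∧
      ∀ x : AddCircle (1 : ℝ), (q₁ x.toCircle).re = (g x).re ∧ (q₂ x.toCircle).re = (g x).im := by
    intro g hg
    induction hg using Submodule.span_induction with
    | mem g hg =>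
      obtain ⟨k, rfl⟩ := hg
      obtain ⟨m, rfl | rfl⟩ := k.eq_nat_or_neg
      · refine ⟨fun z => z ^ m, fun z => -Complex.I * z ^ m, by fun_prop, by fun_prop, fun x => ?_⟩
        have h1 : fourier (m : ℤ) x = (x.toCircle : ℂ) ^ m := by
          rw [fourier_apply, natCast_zsmul, AddCircle.toCircle_nsmul, Circle.coe_pow]
        simp [h1]
      · refine ⟨fun z => z ^ m, fun z => Complex.I * z ^ m, by fun_prop, by fun_prop, fun x => ?_⟩
        have h1 : fourier (-(m : ℤ)) x = starRingEnd ℂ ((x.toCircle : ℂ) ^ m) := by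
          rw [fourier_neg, fourier_apply, natCast_zsmul, AddCircle.toCircle_nsmul, Circle.coe_pow]
        simp [h1, -map_pow]
    | zero => exact ⟨fun _ => 0, fun _ => 0, by fun_prop, by fun_prop, by simp⟩
    | add g₁ g₂ _ _ h₁ h₂ =>
      obtain ⟨a₁, b₁, ha₁, hb₁, e₁⟩ := h₁
      obtain ⟨a₂, b₂, ha₂, hb₂, e₂⟩ := h₂
      exact ⟨fun z => a₁ z + a₂ z, fun z => b₁ z + b₂ z, ha₁.add ha₂, hb₁.add hb₂, fun x => by
        simp [(e₁ x).1, (e₁ x).2, (e₂ x).1, (e₂ x).2]⟩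
    | smul c g _ h =>
      obtain ⟨a, b, ha, hb, e⟩ := h
      refine ⟨fun z => c.re * a z - c.im * b z, fun z => c.re * b z + c.im * a z, by fun_prop,
        by fun_prop, fun x => ?_⟩
      simp [(e x).1, (e x).2]
  let f : C(AddCircle (1 : ℝ), ℂ) :=
    ⟨fun x => (φ x.toCircle : ℂ), by
      have := AddCircle.continuous_toCircle (T := 1)
      fun_prop⟩
  have hf : f ∈ (Submodule.span ℂ (range (@fourier 1))).topologicalClosure := by
    rw [span_fourier_closure_eq_top]; trivial
  rw [← SetLike.mem_coe, Submodule.topologicalClosure_coe, Metric.mem_closure_iff] at hf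
  obtain ⟨g, hg, hfg⟩ := hf ε hε
  obtain ⟨q, _, hq, _, hqg⟩ := key g hg
  refine ⟨q, hq, fun ζ hζ => ?_⟩
  obtain ⟨x, hx⟩ := (AddCircle.homeomorphCircle (T := 1) one_ne_zero).surjective
    ⟨ζ, mem_sphere_zero_iff_norm.2 hζ⟩
  rw [AddCircle.homeomorphCircle_apply] at hx
  have hxζ : (x.toCircle : ℂ) = ζ := by rw [hx]
  have h1 := (ContinuousMap.dist_apply_le_dist (f := f) (g := g) x).trans_lt hfg
  rw [dist_comm, dist_eq_norm] at h1
  have h2 := (Complex.abs_re_le_norm _).trans_lt h1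
  have h3 := (hqg x).1
  rw [hxζ] at h3
  simpa [f, hxζ, h3] using h2

lemma circleAverage_re_entire {q : ℂ → ℂ} (hq : Differentiable ℂ q) (c : ℂ) (t : ℝ) :
    Real.circleAverage (fun z => (q z).re) c t = (q c).re := by
  have h1 := Complex.reCLM.circleAverage_comp_comm (c := c) (R := t)
    (hq.continuous.continuousOn.circleIntegrable')
  rw [hq.diffContOnCl.circleAverage] at h1
  exact h1

/-- A continuous function which satisfies the sub-mean value inequality infinitesimally satisfies
it on the unit disc. -/
lemma le_circleAverage_of_local {φ : ℂ → ℝ} (hφ : Continuous φ)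
    (hloc : ∀ z₀ : ℂ, ‖z₀‖ < 1 → ∃ C δ : ℝ, 0 < δ ∧ ∀ t, 0 < t → t < δ →
      φ z₀ - C * t ^ 4 ≤ Real.circleAverage φ z₀ t) :
    φ 0 ≤ Real.circleAverage φ 0 1 := by
  by_contra hcon
  rw [not_le] at hcon
  set ε := (φ 0 - Real.circleAverage φ 0 1) / 4 with hε
  have hε0 : 0 < ε := by rw [hε]; linarith
  obtain ⟨q, hq, hqφ⟩ := exists_entire_approx_on_circle hφ hε0
  have hφi : ∀ c t, CircleIntegrable φ c t := fun c t => hφ.continuousOn.circleIntegrable'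
  have hqc : Continuous q := hq.continuous
  have h1 : (q 0).re ≤ Real.circleAverage φ 0 1 + ε := by
    have h := Real.circleAverage_mono (c := 0) (R := 1) (f₁ := fun z => (q z).re)
      (f₂ := φ + fun _ => ε)
      (by fun_prop : Continuous fun z => (q z).re).continuousOn.circleIntegrable'
      ((hφi 0 1).add (circleIntegrable_const ε 0 1)) fun z hz => by
        have := (abs_lt.1 (hqφ z (by simpa using hz))).2
        simp only [Pi.add_apply]
        linarith
    rwa [circleAverage_re_entire hq, Real.circleAverage_add (hφi 0 1)
      (circleIntegrable_const ε 0 1), Real.circleAverage_const] at h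
  -- The perturbation ε‖z‖² makes m strictly violate the maximum principle: at an interior maximum,
  -- sub-mean values with error C t⁴ give ε ≤ C t² for all small t.
  set m : ℂ → ℝ := fun z => φ z - (q z).re + ε * ‖z‖ ^ 2 with hm
  have hmc : Continuous m := by simp only [hm]; fun_prop
  obtain ⟨z₀, hz₀, hmax⟩ := (isCompact_closedBall (0 : ℂ) 1).exists_isMaxOn
    ⟨0, by simp⟩ hmc.continuousOn
  have hm0 : m 0 ≤ m z₀ := hmax (by simp)
  -- The defect is 4ε, so m(0) ≥ 3ε, whereas m < 2ε on the unit circle.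
  have hz₀1 : ‖z₀‖ < 1 := by
    have hle : ‖z₀‖ ≤ 1 := by simpa using hz₀
    refine lt_of_le_of_ne hle fun heq => ?_
    have h2 := (abs_lt.1 (hqφ z₀ heq)).1
    simp only [hm, heq, norm_zero] at hm0
    have h4 : φ 0 = Real.circleAverage φ 0 1 + 4 * ε := by rw [hε]; ring
    nlinarith
  obtain ⟨C, δ, hδ, hC⟩ := hloc z₀ hz₀1
  -- From ‖z‖² = ‖z − z₀‖² − ‖z₀‖² + 2 Re(z̄₀z), the last term is absorbed into the entire function.
  -- On a circle about z₀ only a constant is left besides its real part.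
  set q' : ℂ → ℂ := fun z => q z - 2 * ε * starRingEnd ℂ z₀ * z with hq'
  have hq'd : Differentiable ℂ q' := by simp only [hq']; fun_prop
  have hq'c : Continuous q' := hq'd.continuous
  have hq'0 : (q' z₀).re = (q z₀).re - 2 * ε * ‖z₀‖ ^ 2 := by
    have : 2 * (ε : ℂ) * starRingEnd ℂ z₀ * z₀ = ((2 * ε * ‖z₀‖ ^ 2 : ℝ) : ℂ) := by
      rw [mul_assoc, mul_comm (starRingEnd ℂ z₀), Complex.mul_conj, Complex.normSq_eq_norm_sq]
      push_cast
      ring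
    simp only [hq']
    rw [this, Complex.sub_re, Complex.ofReal_re]
  have step : ∀ t, 0 < t → t < min δ (1 - ‖z₀‖) → ε ≤ C * t ^ 2 := by
    intro t ht htδ
    obtain ⟨h2, h3⟩ := lt_min_iff.1 htδ
    have hpw : ∀ z ∈ Metric.sphere z₀ |t|, φ z ≤ m z₀ - ε * (t ^ 2 - ‖z₀‖ ^ 2) + (q' z).re := by
      intro z hz
      rw [mem_sphere_iff_norm, abs_of_pos ht] at hz
      have hzb : m z ≤ m z₀ := hmax (by
        simp only [Metric.mem_closedBall, dist_zero_right]
        have := norm_le_norm_add_norm_sub z₀ z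
        rw [norm_sub_rev, hz] at this
        linarith)
      have h4 : ‖z‖ ^ 2 = t ^ 2 - ‖z₀‖ ^ 2 + 2 * (starRingEnd ℂ z₀ * z).re := by
        rw [← hz, ← Complex.normSq_eq_norm_sq, ← Complex.normSq_eq_norm_sq,
          ← Complex.normSq_eq_norm_sq, Complex.normSq_sub]
        have : (z * starRingEnd ℂ z₀).re = (starRingEnd ℂ z₀ * z).re := by rw [mul_comm]
        rw [this]
        ring
      have h5 : (q' z).re = (q z).re - 2 * ε * (starRingEnd ℂ z₀ * z).re := by
        have : 2 * (ε : ℂ) * starRingEnd ℂ z₀ * z = ((2 * ε : ℝ) : ℂ) * (starRingEnd ℂ z₀ * z) := by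
          push_cast; ring
        simp only [hq']
        rw [this, Complex.sub_re, Complex.re_ofReal_mul]
      have h6 : m z = φ z - (q z).re + ε * ‖z‖ ^ 2 := rfl
      rw [h6, h4] at hzb
      rw [h5]
      linarith
    have i1 : CircleIntegrable (fun _ : ℂ => m z₀ - ε * (t ^ 2 - ‖z₀‖ ^ 2)) z₀ t :=
      circleIntegrable_const _ _ _
    have i2 : CircleIntegrable (fun z => (q' z).re) z₀ t :=
      (by fun_prop : Continuous fun z => (q' z).re).continuousOn.circleIntegrable'
    have h4 := Real.circleAverage_mono (hφi z₀ t) (i1.add i2) hpw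
    rw [Real.circleAverage_add i1 i2, circleAverage_re_entire hq'd, Real.circleAverage_const,
      hq'0] at h4
    have h5 := (hC t ht h2).trans h4
    have h6 : m z₀ = φ z₀ - (q z₀).re + ε * ‖z₀‖ ^ 2 := rfl
    rw [h6] at h5
    have h7 : ε * t ^ 2 ≤ C * t ^ 2 * t ^ 2 := by linarith
    exact le_of_mul_le_mul_right h7 (by positivity)
  have hlim : ε ≤ C * 0 ^ 2 := by
    refine ge_of_tendsto (f := fun t : ℝ => C * t ^ 2) (x := 𝓝[>] 0)
      (((by fun_prop : Continuous fun t : ℝ => C * t ^ 2).tendsto 0).mono_left nhdsWithin_le_nhds) ?_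
    filter_upwards [Ioo_mem_nhdsGT (show 0 < min δ (1 - ‖z₀‖) from
      lt_min hδ (by linarith))] with t ht using step t ht.1 ht.2
  simp at hlim
  linarith

open Matrix in
open scoped ComplexOrder in
/-- `log det G` is subharmonic for a smooth Griffiths negative metric `G` on the unit disc. -/
lemma log_det_le_circleAverage {r : ℕ} {G : ℂ → Matrix (Fin r) (Fin r) ℂ}
    (hG : ∀ i j, ContDiff ℝ ∞ fun z => G z i j) (hpd : ∀ z, (G z).PosDef)
    (hsub : ∀ z₀ : ℂ, ∀ t, 0 < t → ‖z₀‖ + t < 1 → ∀ v w : Fin r → ℂ,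
      (star v ⬝ᵥ G z₀ *ᵥ v).re ≤ Real.circleAverage
        (fun z => (star (v + (z - z₀) • w) ⬝ᵥ G z *ᵥ (v + (z - z₀) • w)).re) z₀ t) :
    Real.log (G 0).det.re ≤ Real.circleAverage (fun z => Real.log (G z).det.re) 0 1 := by
  have hc : Continuous G := continuous_matrix fun i j => (hG i j).continuous
  refine le_circleAverage_of_local (φ := fun z => Real.log (G z).det.re) ?_ fun z₀ hz₀ => ?_
  · exact (Complex.continuous_re.comp hc.matrix_det).log fun z =>
      (Complex.pos_iff.1 (hpd z).det_pos).1.ne'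
  · exact exists_sub_le_circleAverage_log_det hG hpd z₀ (t₁ := 1 - ‖z₀‖) (by linarith)
      fun t ht ht1 v w => hsub z₀ t ht (by linarith) v w

/-! ### Circle-invariant mollifiers -/

section Mollifier

variable {n : ℕ}

lemma measurePreserving_unit_smul {ζ : ℂ} (hζ : ‖ζ‖ = 1) :
    MeasurePreserving (fun w : Fin n → ℂ => ζ • w) := by
  have h := volume_preserving_pi (ι := Fin n) (f := fun _ => fun x : ℂ => ζ * x) fun _ =>
    (rotation ⟨ζ, mem_sphere_zero_iff_norm.2 hζ⟩).measurePreserving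
  exact h

/-- A circle-invariant smooth probability density supported in the ball of radius `ε`. -/
structure IsMollifier (k : (Fin n → ℂ) → ℝ) (ε : ℝ) : Prop where
  smooth : ContDiff ℝ ∞ k
  compact : HasCompactSupport k
  nonneg : ∀ w, 0 ≤ k w
  norm_lt : ∀ w, k w ≠ 0 → ‖w‖ < ε
  invariant : ∀ (ζ : ℂ) (w : Fin n → ℂ), ‖ζ‖ = 1 → k (ζ • w) = k w
  integral_eq : ∫ w, k w = 1

/-- The bump is a function of the Euclidean norm squared, which is smooth and invariant under unit
scalars, unlike a function of the ambient sup norm; the sup norm is the smaller of the two, so the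
support condition follows. -/
lemma exists_isMollifier (n : ℕ) {ε : ℝ} (hε : 0 < ε) :
    ∃ k : (Fin n → ℂ) → ℝ, IsMollifier k ε := by
  set s : (Fin n → ℂ) → ℝ := fun w => ∑ i, ((w i).re ^ 2 + (w i).im ^ 2) with hs
  have hsn : ∀ w, s w = ∑ i, ‖w i‖ ^ 2 := fun w => Finset.sum_congr rfl fun i _ => by
    rw [← Complex.normSq_eq_norm_sq, Complex.normSq_apply]; ring
  set k₀ : (Fin n → ℂ) → ℝ := fun w => Real.smoothTransition (ε ^ 2 - s w) with hk₀
  have hsm : ContDiff ℝ ∞ s := by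
    refine ContDiff.sum fun i _ => ?_
    have h1 : ContDiff ℝ ∞ fun w : Fin n → ℂ => w i := contDiff_apply ℝ ℂ i
    exact ((Complex.reCLM.contDiff.comp h1).pow 2).add ((Complex.imCLM.contDiff.comp h1).pow 2)
  have hsmooth : ContDiff ℝ ∞ k₀ := Real.smoothTransition.contDiff.comp (contDiff_const.sub hsm)
  have hlt : ∀ w, k₀ w ≠ 0 → ‖w‖ < ε := by
    intro w hw
    have h1 : 0 < ε ^ 2 - s w := by
      by_contra h
      exact hw (Real.smoothTransition.zero_of_nonpos (not_lt.1 h))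
    rw [pi_norm_lt_iff hε]
    intro i
    have h2 : ‖w i‖ ^ 2 ≤ s w := by
      rw [hsn]
      exact Finset.single_le_sum (f := fun i => ‖w i‖ ^ 2) (fun i _ => sq_nonneg _)
        (Finset.mem_univ i)
    exact lt_of_pow_lt_pow_left₀ 2 hε.le (by linarith)
  have hc : HasCompactSupport k₀ := HasCompactSupport.of_support_subset_isCompact
    (isCompact_closedBall (0 : Fin n → ℂ) ε) fun w hw => by
      simpa using (hlt w hw).le
  have hnn : ∀ w, 0 ≤ k₀ w := fun w => Real.smoothTransition.nonneg _
  have hpos : 0 < ∫ w, k₀ w := by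
    refine hsmooth.continuous.integral_pos_of_hasCompactSupport_nonneg_nonzero hc hnn (x := 0) ?_
    refine (Real.smoothTransition.pos_of_pos ?_).ne'
    simp [hs, hε]
  refine ⟨fun w => (∫ w, k₀ w)⁻¹ * k₀ w, contDiff_const.mul hsmooth, hc.mul_left,
    fun w => mul_nonneg (inv_nonneg.2 hpos.le) (hnn w), fun w hw => hlt w (right_ne_zero_of_mul hw),
    fun ζ w hζ => ?_, ?_⟩
  · have : s (ζ • w) = s w := by
      rw [hsn, hsn]
      simp [hζ]
    simp only [hk₀, this]
  · rw [integral_const_mul, inv_mul_cancel₀ hpos.ne']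

lemma IsMollifier.integrable_mul {F : Type*} [NormedAddCommGroup F] [NormedSpace ℝ F]
    {k : (Fin n → ℂ) → ℝ} {ε : ℝ}
    (hk : IsMollifier k ε) {f : (Fin n → ℂ) → F} (hf : LocallyIntegrable f) (z : Fin n → ℂ) :
    Integrable fun w => k w • f (z - w) := by
  have := hk.compact.convolutionExists_left (ContinuousLinearMap.lsmul ℝ ℝ) hk.smooth.continuous
    (g := f) hf
  exact this z

/-- Mollification of a bounded plurisubharmonic function dominates the function. -/
lemma IsMollifier.le_integral {k : (Fin n → ℂ) → ℝ} {ε : ℝ} (hk : IsMollifier k ε)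
    {f : (Fin n → ℂ) → ℝ} {Ω L : Set (Fin n → ℂ)} (hf : IsPSHOn f Ω) (hL : IsCompact L)
    (hLΩ : L ⊆ Ω) {M : ℝ} (hM : ∀ z ∈ L, |f z| ≤ M) {z : Fin n → ℂ} (hz : Metric.ball z ε ⊆ L) :
    f z ≤ ∫ w, k w * L.indicator f (z - w) := by
  have hkm : Measurable k := hk.smooth.continuous.measurable
  have hfm : Measurable (L.indicator f) :=
    measurable_indicator_of_upperSemicontinuousOn hL.measurableSet (hf.1.mono hLΩ)
  have hM' : ∀ z, ‖L.indicator f z‖ ≤ |M| := fun z => by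
    by_cases hz : z ∈ L
    · rw [indicator_of_mem hz]; exact (hM z hz).trans (le_abs_self M)
    · rw [indicator_of_notMem hz, norm_zero]; positivity
  obtain ⟨B, hB⟩ := hk.compact.exists_bound_of_continuous hk.smooth.continuous
  have hB0 : 0 ≤ B := (norm_nonneg _).trans (hB 0)
  have hk0 : ∀ w, w ∉ tsupport k → k w = 0 := fun z => image_eq_zero_of_notMem_tsupport
  have i1 : Integrable (fun p : (Fin n → ℂ) × ℂ => k p.1 * L.indicator f (z - p.2 • p.1))
      (volume.prod unitCircleMeasure) := by
    refine integrable_prod_unitCircleMeasure (by fun_prop) hk.compact (B * |M|) (fun z ζ _ => ?_)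
      (fun w ζ hw => by simp [hk0 w hw])
    rw [norm_mul]
    gcongr
    exacts [hB _, hM' _]
  -- Invariance of k allows averaging over ζ, so that for each w the inner integral is a circular
  -- mean of f about z.
  have hrot : ∀ ζ : ℂ, ‖ζ‖ = 1 → ∫ w, k w * L.indicator f (z - ζ • w) =
      ∫ w, k w * L.indicator f (z - w) := by
    intro ζ hζ
    have hζ0 : ζ ≠ 0 := fun h => by simp [h] at hζ
    rw [← (measurePreserving_unit_smul hζ).integral_comp
      (measurableEmbedding_const_smul₀ hζ0) (fun w => k w * L.indicator f (z - w))]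
    simp [hk.invariant ζ _ hζ]
  have e1 : ∫ w, k w * L.indicator f (z - w) =
      ∫ w, ∫ ζ : ℂ, k w * L.indicator f (z - ζ • w) ∂unitCircleMeasure := by
    rw [integral_integral_swap i1, integral_congr_ae (ae_norm_eq_one.mono hrot)]
    simp
  have hki : Integrable k := hk.smooth.continuous.integrable_of_hasCompactSupport hk.compact
  rw [e1]
  calc f z = ∫ w, k w * f z := by rw [integral_mul_const, hk.integral_eq, one_mul]
    _ ≤ _ := by
        refine integral_mono (hki.mul_const _) i1.integral_prod_left fun w => ?_
        simp only
        rw [integral_const_mul]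
        by_cases hw : k w = 0
        · simp [hw]
        refine mul_le_mul_of_nonneg_left ?_ (hk.nonneg w)
        have hmem : ∀ ζ : ℂ, ‖ζ‖ ≤ 1 → z + ζ • (-w) ∈ L := fun ζ hζ => hz (by
          rw [Metric.mem_ball, dist_eq_norm, add_sub_cancel_left, norm_smul, norm_neg]
          nlinarith [norm_nonneg w, hk.norm_lt w hw])
        have hm : Measurable fun ζ : ℂ => L.indicator f (z - ζ • w) := by fun_prop
        rw [integral_unitCircleMeasure hm.aestronglyMeasurable,
          Real.circleAverage_congr_sphere (f₂ := fun ζ : ℂ => f (z + ζ • (-w)))]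
        · exact (hf.2 z (-w) fun ζ hζ => hLΩ (hmem ζ hζ)).2
        · intro ζ hζ
          have h1 := hmem ζ (by simpa using (mem_sphere_zero_iff_norm.1 hζ).le)
          simp only [smul_neg, ← sub_eq_add_neg] at h1 ⊢
          exact indicator_of_mem h1 _

/-- Sub-mean values give the lower bound and upper semicontinuity the upper one. Convergence thus
holds at every interior point of L, not merely almost everywhere; this is essential for restricting
to circles, which are null sets. -/
lemma tendsto_mollify {k : ℕ → (Fin n → ℂ) → ℝ} {ε : ℕ → ℝ} (hk : ∀ m, IsMollifier (k m) (ε m))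
    (hε : Tendsto ε atTop (𝓝 0))
    {f : (Fin n → ℂ) → ℝ} {Ω L : Set (Fin n → ℂ)} (hf : IsPSHOn f Ω) (hL : IsCompact L)
    (hLΩ : L ⊆ Ω) {M : ℝ} (hM : ∀ z ∈ L, |f z| ≤ M) {z : Fin n → ℂ} (hz : L ∈ 𝓝 z) :
    Tendsto (fun m => ∫ w, k m w * L.indicator f (z - w)) atTop (𝓝 (f z)) := by
  obtain ⟨δ, hδ, hδL⟩ := Metric.mem_nhds_iff.1 hz
  have hzL : z ∈ L := mem_of_mem_nhds hz
  have hfm : Measurable (L.indicator f) :=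
    measurable_indicator_of_upperSemicontinuousOn hL.measurableSet (hf.1.mono hLΩ)
  have hfl : LocallyIntegrable (L.indicator f) := by
    refine Integrable.locallyIntegrable ((integrable_indicator_iff hL.measurableSet).2 ?_)
    rw [← integrable_indicator_iff hL.measurableSet]
    have hb : Integrable (L.indicator fun _ => M) :=
      (integrable_indicator_iff hL.measurableSet).2 (integrableOn_const hL.measure_lt_top.ne)
    refine hb.mono' hfm.aestronglyMeasurable (Eventually.of_forall fun z => ?_)
    by_cases hz : z ∈ L
    · simp only [indicator_of_mem hz]; exact hM z hz
    · simp [indicator_of_notMem hz]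
  rw [Metric.tendsto_atTop]
  intro η hη
  have husc : ∀ᶠ y in 𝓝 z, f y < f z + η / 2 := by
    have := hf.1.mono hLΩ z hzL (f z + η / 2) (by linarith)
    rwa [nhdsWithin_eq_nhds.2 hz] at this
  obtain ⟨δ', hδ', hδf⟩ := Metric.eventually_nhds_iff.1 husc
  have hev : ∀ᶠ m in atTop, ε m < min δ δ' := hε.eventually_lt_const (lt_min hδ hδ')
  obtain ⟨N, hN⟩ := eventually_atTop.1 hev
  refine ⟨N, fun m hm => ?_⟩
  obtain ⟨h1, h2⟩ := lt_min_iff.1 (hN m hm)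
  have low := (hk m).le_integral hf hL hLΩ hM (z := z)
    ((Metric.ball_subset_ball h1.le).trans hδL)
  have hki : Integrable (k m) :=
    (hk m).smooth.continuous.integrable_of_hasCompactSupport (hk m).compact
  have up : ∫ w, k m w * L.indicator f (z - w) ≤ f z + η / 2 := by
    calc _ ≤ ∫ w, k m w * (f z + η / 2) := by
          refine integral_mono ((hk m).integrable_mul hfl z) (hki.mul_const _) fun w => ?_
          by_cases hw : k m w = 0
          · simp [hw]
          · refine mul_le_mul_of_nonneg_left ?_ ((hk m).nonneg w)
            have h3 := (hk m).norm_lt w hw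
            have h4 : z - w ∈ L := hδL (by simpa [dist_eq_norm] using h3.trans h1)
            rw [indicator_of_mem h4]
            exact (hδf (by simpa [dist_eq_norm] using h3.trans h2)).le
      _ = _ := by rw [integral_mul_const, (hk m).integral_eq, one_mul]
  rw [Real.dist_eq, abs_lt]
  constructor <;> linarith

end Mollifier

/-! ### Hermitian forms of matrices -/

section Quad

open Matrix
open scoped ComplexOrder

variable {r : ℕ}

/-- The real quadratic form `v ↦ Re (v* A v)` of a matrix. -/
noncomputable def quad (A : Matrix (Fin r) (Fin r) ℂ) (v : Fin r → ℂ) : ℝ :=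
  (star v ⬝ᵥ A *ᵥ v).re

lemma dotProduct_mulVec_eq_sum (A : Matrix (Fin r) (Fin r) ℂ) (v : Fin r → ℂ) :
    star v ⬝ᵥ A *ᵥ v = ∑ i, ∑ j, star (v i) * v j * A i j := by
  simp only [dotProduct, mulVec, Finset.mul_sum, Pi.star_apply]
  exact Finset.sum_congr rfl fun i _ => Finset.sum_congr rfl fun j _ => by ring

lemma quad_eq_sum (A : Matrix (Fin r) (Fin r) ℂ) (v : Fin r → ℂ) :
    quad A v = ∑ i, ∑ j, (star (v i) * v j * A i j).re := by
  simp only [quad, dotProduct_mulVec_eq_sum, Complex.re_sum]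

lemma abs_quad_le {A : Matrix (Fin r) (Fin r) ℂ} {B : ℝ} (hB : ∀ i j, ‖A i j‖ ≤ B)
    (v : Fin r → ℂ) : |quad A v| ≤ B * (∑ i, ‖v i‖) ^ 2 := by
  calc |quad A v| ≤ ‖∑ i, ∑ j, star (v i) * v j * A i j‖ := by
        rw [quad, dotProduct_mulVec_eq_sum]; exact Complex.abs_re_le_norm _
    _ ≤ ∑ i, ∑ j, ‖v i‖ * ‖v j‖ * B := by
        refine (norm_sum_le _ _).trans (Finset.sum_le_sum fun i _ => (norm_sum_le _ _).trans
          (Finset.sum_le_sum fun j _ => ?_))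
        rw [norm_mul, norm_mul, norm_star]
        gcongr
        exact hB i j
    _ = _ := by
        rw [sq, Finset.sum_mul_sum, Finset.mul_sum]
        refine Finset.sum_congr rfl fun i _ => ?_
        rw [Finset.mul_sum]
        exact Finset.sum_congr rfl fun j _ => by ring

lemma quad_add_smul_one (A : Matrix (Fin r) (Fin r) ℂ) (ε : ℝ) (v : Fin r → ℂ) :
    quad (A + (ε : ℂ) • (1 : Matrix (Fin r) (Fin r) ℂ)) v = quad A v + ε * ∑ i, ‖v i‖ ^ 2 := by
  simp only [quad, add_mulVec, dotProduct_add, Complex.add_re, smul_mulVec, one_mulVec,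
    dotProduct_smul]
  congr 1
  simp only [dotProduct, Pi.star_apply, smul_eq_mul, Complex.re_ofReal_mul, Complex.re_sum]
  congr 1
  refine Finset.sum_congr rfl fun i _ => ?_
  rw [Complex.star_def, Complex.conj_mul', ← Complex.ofReal_pow, Complex.ofReal_re]

lemma star_dotProduct_eq_quad {A : Matrix (Fin r) (Fin r) ℂ} (hA : A.IsHermitian)
    (v : Fin r → ℂ) : star v ⬝ᵥ A *ᵥ v = (quad A v : ℂ) := by
  have := hA.im_star_dotProduct_mulVec_self v
  apply Complex.ext
  · simp [quad]
  · simpa using this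

/-- Polarization: the entries of a hermitian matrix are fixed linear combinations of values of its
quadratic form. -/
lemma exists_polarization (i j : Fin r) : ∃ (c : Fin 4 → ℂ) (v : Fin 4 → Fin r → ℂ),
    ∀ A : Matrix (Fin r) (Fin r) ℂ, A.IsHermitian → A i j = ∑ k, c k * (quad A (v k) : ℂ) := by
  -- Averaging (−i)^k times the form at e_i + i^k e_j over the fourth roots of unity cancels the
  -- diagonal entries and A j i.
  refine ⟨fun k => (-Complex.I) ^ (k : ℕ) / 4,
    fun k => Pi.single i 1 + Complex.I ^ (k : ℕ) • Pi.single j 1, fun A hA => ?_⟩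
  have hq := fun v => (star_dotProduct_eq_quad hA v).symm
  have hs : ∀ a : Fin r, star (Pi.single a (1 : ℂ) : Fin r → ℂ) = Pi.single a 1 := fun a => by
    rw [Pi.star_single, star_one]
  simp only [hq, star_add, star_smul, hs, mulVec_add, mulVec_smul, dotProduct_add, add_dotProduct,
    dotProduct_smul, smul_dotProduct, single_one_dotProduct, mulVec_single_one, col_apply,
    smul_eq_mul]
  simp only [Fin.sum_univ_four, star_pow, Complex.star_def, Complex.conj_I]
  have h2 : Complex.I ^ 2 = -1 := Complex.I_sq
  have h3 : Complex.I ^ 3 = -Complex.I := Complex.I_pow_three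
  norm_num [h2, h3, neg_pow]
  ring_nf
  simp [h2]
  ring

end Quad

/-! ### Mollified matrices -/

section Mollified

open Matrix
open scoped ComplexOrder

variable {n r : ℕ}

/-- Entrywise mollification of a matrix-valued function. -/
noncomputable def matMollify (k : (Fin n → ℂ) → ℝ) (H : (Fin n → ℂ) → Matrix (Fin r) (Fin r) ℂ)
    (z : Fin n → ℂ) : Matrix (Fin r) (Fin r) ℂ :=
  Matrix.of fun i j => ∫ w, k w • H (z - w) i j

lemma quad_matMollify {k : (Fin n → ℂ) → ℝ} {ε : ℝ} (hk : IsMollifier k ε)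
    {H : (Fin n → ℂ) → Matrix (Fin r) (Fin r) ℂ} (hH : ∀ i j, LocallyIntegrable fun z => H z i j)
    (z : Fin n → ℂ) (v : Fin r → ℂ) :
    quad (matMollify k H z) v = ∫ w, k w * quad (H (z - w)) v := by
  have hi : ∀ i j, Integrable fun w => star (v i) * v j * (k w • H (z - w) i j) := fun i j =>
    (hk.integrable_mul (hH i j) z).const_mul _
  have h1 : ∀ w, k w * quad (H (z - w)) v =
      ∑ i, ∑ j, (star (v i) * v j * (k w • H (z - w) i j)).re := fun w => by
    rw [quad_eq_sum, Finset.mul_sum]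
    refine Finset.sum_congr rfl fun i _ => ?_
    rw [Finset.mul_sum]
    refine Finset.sum_congr rfl fun j _ => ?_
    rw [mul_smul_comm, Complex.smul_re, smul_eq_mul]
  have hi' : ∀ i j, Integrable fun w => (star (v i) * v j * (k w • H (z - w) i j)).re :=
    fun i j => (hi i j).re
  simp_rw [h1]
  rw [integral_finsetSum _ fun i _ => integrable_finsetSum _ fun j _ => hi' i j, quad_eq_sum]
  refine Finset.sum_congr rfl fun i _ => ?_
  rw [integral_finsetSum _ fun j _ => hi' i j]
  refine Finset.sum_congr rfl fun j _ => ?_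
  have := integral_re (hi i j)
  simp only [RCLike.re_to_complex] at this
  rw [this, integral_const_mul]
  rfl

lemma contDiff_matMollify {k : (Fin n → ℂ) → ℝ} {ε : ℝ} (hk : IsMollifier k ε)
    {H : (Fin n → ℂ) → Matrix (Fin r) (Fin r) ℂ} (hH : ∀ i j, LocallyIntegrable fun z => H z i j)
    (i j : Fin r) : ContDiff ℝ ∞ fun z => matMollify k H z i j := by
  exact hk.compact.contDiff_convolution_left (ContinuousLinearMap.lsmul ℝ ℝ) hk.smooth (hH i j)

lemma isHermitian_matMollify (k : (Fin n → ℂ) → ℝ)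
    {H : (Fin n → ℂ) → Matrix (Fin r) (Fin r) ℂ} (hH : ∀ z, (H z).IsHermitian) (z : Fin n → ℂ) :
    (matMollify k H z).IsHermitian := by
  ext i j
  simp only [conjTranspose_apply, matMollify, of_apply, Complex.star_def]
  rw [← integral_conj]
  refine integral_congr_ae (Eventually.of_forall fun w => ?_)
  simp only [Complex.real_smul, map_mul, Complex.conj_ofReal]
  rw [← (hH (z - w)).apply i j]
  rfl

lemma norm_matMollify_le {k : (Fin n → ℂ) → ℝ} {ε : ℝ} (hk : IsMollifier k ε)
    {H : (Fin n → ℂ) → Matrix (Fin r) (Fin r) ℂ} {B : ℝ} (hB : ∀ z i j, ‖H z i j‖ ≤ B)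
    (z : Fin n → ℂ) (i j : Fin r) : ‖matMollify k H z i j‖ ≤ B := by
  have hki : Integrable k := hk.smooth.continuous.integrable_of_hasCompactSupport hk.compact
  calc _ ≤ ∫ w, k w * B := by
        refine norm_integral_le_of_norm_le (hki.mul_const _) (Eventually.of_forall fun w => ?_)
        rw [norm_smul, Real.norm_of_nonneg (hk.nonneg w)]
        exact mul_le_mul_of_nonneg_left (hB _ _ _) (hk.nonneg w)
    _ = B := by rw [integral_mul_const, hk.integral_eq, one_mul]

lemma quad_nonneg {A : Matrix (Fin r) (Fin r) ℂ} (hA : A.PosSemidef) (v : Fin r → ℂ) :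
    0 ≤ quad A v := (Complex.le_def.1 (hA.dotProduct_mulVec_nonneg v)).1

lemma posDef_add_smul_one {A : Matrix (Fin r) (Fin r) ℂ} (hA : A.IsHermitian)
    (hq : ∀ v, 0 ≤ quad A v) {ε : ℝ} (hε : 0 < ε) :
    (A + (ε : ℂ) • (1 : Matrix (Fin r) (Fin r) ℂ)).PosDef := by
  have h1 : (A + (ε : ℂ) • (1 : Matrix (Fin r) (Fin r) ℂ)).IsHermitian := by
    refine hA.add ?_
    rw [IsHermitian, conjTranspose_smul, conjTranspose_one, Complex.star_def, Complex.conj_ofReal]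
  refine PosDef.of_dotProduct_mulVec_pos h1 fun v hv => ?_
  rw [star_dotProduct_eq_quad h1, quad_add_smul_one, Complex.zero_lt_real]
  refine add_pos_of_nonneg_of_pos (hq v) (mul_pos hε ?_)
  obtain ⟨i, hi⟩ := Function.ne_iff.1 hv
  refine Finset.sum_pos' (fun _ _ => sq_nonneg _) ⟨i, Finset.mem_univ i, ?_⟩
  have : 0 < ‖v i‖ := norm_pos_iff.2 hi
  positivity

/-- The function ‖v + (z − c)w‖² exceeds the real part of a holomorphic function with the same value
at c by ‖(z − c)w‖². This handles the multiple of the identity added to mollified metrics. -/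
lemma sum_norm_sq_le_circleAverage (v w : Fin r → ℂ) (c : ℂ) (t : ℝ) :
    ∑ i, ‖v i‖ ^ 2 ≤ Real.circleAverage (fun z => ∑ i, ‖(v + (z - c) • w) i‖ ^ 2) c t := by
  set q : ℂ → ℂ := fun z => ∑ i, ((‖v i‖ ^ 2 : ℝ) + 2 * (starRingEnd ℂ (v i) * ((z - c) * w i)))
    with hq
  have hqd : Differentiable ℂ q := by simp only [hq]; fun_prop
  have hqc := hqd.continuous
  have h0 : (q c).re = ∑ i, ‖v i‖ ^ 2 := by
    simp only [hq, sub_self, zero_mul, mul_zero, add_zero, Complex.re_sum, Complex.ofReal_re]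
  rw [← h0, ← circleAverage_re_entire hqd c t]
  refine Real.circleAverage_mono
    (by fun_prop : Continuous fun z => (q z).re).continuousOn.circleIntegrable'
    (Continuous.continuousOn (by fun_prop)).circleIntegrable' fun z _ => ?_
  simp only [hq, Complex.re_sum]
  refine Finset.sum_le_sum fun i _ => ?_
  simp only [Pi.add_apply, Pi.smul_apply, smul_eq_mul, ← Complex.normSq_eq_norm_sq,
    Complex.normSq_apply, Complex.add_re, Complex.add_im, Complex.mul_re, Complex.mul_im,
    Complex.conj_re, Complex.conj_im, Complex.ofReal_re, Complex.re_ofNat, Complex.im_ofNat]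
  nlinarith [sq_nonneg ((z - c).re * (w i).re - (z - c).im * (w i).im),
    sq_nonneg ((z - c).re * (w i).im + (z - c).im * (w i).re)]

end Mollified

/-! ### Sub-mean value inequalities for mollified metrics. -/

section Nondegeneracy

open Matrix
open scoped ComplexOrder

variable {n r : ℕ}

lemma measurable_quad {α : Type*} [MeasurableSpace α] {A : α → Matrix (Fin r) (Fin r) ℂ}
    (hA : ∀ i j, Measurable fun x => A x i j) {v : α → Fin r → ℂ} (hv : Measurable v) :
    Measurable fun x => quad (A x) (v x) := by
  have hv' : ∀ i, Measurable fun x => v x i := fun i => (measurable_pi_apply i).comp hv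
  simp only [quad_eq_sum]
  refine Finset.measurable_sum _ fun i _ => Finset.measurable_sum _ fun j _ => ?_
  exact Complex.measurable_re.comp (((continuous_star.measurable.comp (hv' i)).mul (hv' j)).mul
    (hA i j))

lemma continuous_quad {α : Type*} [TopologicalSpace α] {A : α → Matrix (Fin r) (Fin r) ℂ}
    (hA : ∀ i j, Continuous fun x => A x i j) {v : α → Fin r → ℂ} (hv : Continuous v) :
    Continuous fun x => quad (A x) (v x) := by
  have hv' : ∀ i, Continuous fun x => v x i := fun i => (continuous_apply i).comp hv
  simp only [quad_eq_sum]
  refine continuous_finsetSum _ fun i _ => continuous_finsetSum _ fun j _ => ?_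
  exact Complex.continuous_re.comp (((hv' i).star.mul (hv' j)).mul (hA i j))

lemma locallyIntegrable_of_measurable_of_bound {f : (Fin n → ℂ) → ℂ} (hf : Measurable f) {B : ℝ}
    (hB : ∀ z, ‖f z‖ ≤ B) : LocallyIntegrable f :=
  (locallyIntegrable_const B).mono hf.aestronglyMeasurable
    (Eventually.of_forall fun z => (hB z).trans (le_abs_self B))

/-- Mollification preserves the sub-mean value inequality for `‖v + (z - z₀) w‖²`. -/
lemma quad_matMollify_le_circleAverage {L : Set (Fin n → ℂ)}
    {H : (Fin n → ℂ) → Matrix (Fin r) (Fin r) ℂ} (hm : ∀ i j, Measurable fun z => H z i j) {B : ℝ}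
    (hB : ∀ z i j, ‖H z i j‖ ≤ B)
    (hsub : ∀ (y b : Fin n → ℂ) (v w : Fin r → ℂ), b ≠ 0 → (∀ ζ : ℂ, ‖ζ‖ ≤ 1 → y + ζ • b ∈ L) →
      quad (H y) v ≤ Real.circleAverage (fun ζ : ℂ => quad (H (y + ζ • b)) (v + ζ • w)) 0 1)
    {k : (Fin n → ℂ) → ℝ} {ε : ℝ} (hk : IsMollifier k ε) {p b : Fin n → ℂ} (hb : b ≠ 0) {z₀ : ℂ}
    {t : ℝ} (ht : 0 < t)
    (hL : ∀ (ζ : ℂ) (w : Fin n → ℂ), ‖ζ‖ ≤ 1 → ‖w‖ < ε → p + (z₀ + t * ζ) • b - w ∈ L)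
    (v w : Fin r → ℂ) :
    quad (matMollify k H (p + z₀ • b)) v ≤
      Real.circleAverage (fun z => quad (matMollify k H (p + z • b)) (v + (z - z₀) • w)) z₀ t := by
  have hli : ∀ i j, LocallyIntegrable fun z => H z i j := fun i j =>
    locallyIntegrable_of_measurable_of_bound (hm i j) fun z => hB z i j
  have hkm : Measurable k := hk.smooth.continuous.measurable
  obtain ⟨B', hB'⟩ := hk.compact.exists_bound_of_continuous hk.smooth.continuous
  have hk0 : ∀ w, w ∉ tsupport k → k w = 0 := fun z => image_eq_zero_of_notMem_tsupport
  set F : (Fin n → ℂ) → ℂ → ℝ := fun y ζ =>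
    quad (H (p + (z₀ + t * ζ) • b - y)) (v + (t * ζ) • w) with hF
  have hFm : Measurable (Function.uncurry F) := by
    refine measurable_quad (fun i j => ?_) (by fun_prop)
    exact (hm i j).comp (by fun_prop :
      Measurable fun q : (Fin n → ℂ) × ℂ => p + (z₀ + t * q.2) • b - q.1)
  have hB0 : 0 ≤ B * (∑ i, (‖v i‖ + t * ‖w i‖)) ^ 2 := by
    rcases isEmpty_or_nonempty (Fin r) with h | ⟨⟨i⟩⟩
    · simp
    · exact mul_nonneg ((norm_nonneg _).trans (hB 0 i i)) (sq_nonneg _)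
  have hFB : ∀ y ζ, ‖ζ‖ = 1 → |F y ζ| ≤ B * (∑ i, (‖v i‖ + t * ‖w i‖)) ^ 2 := by
    intro y ζ hζ
    refine (abs_quad_le (hB _) _).trans ?_
    rcases isEmpty_or_nonempty (Fin r) with h | ⟨⟨i⟩⟩
    · simp
    have : 0 ≤ B := (norm_nonneg _).trans (hB 0 i i)
    gcongr with i
    refine (norm_add_le _ _).trans ?_
    simp [hζ, abs_of_pos ht]
  have i1 : Integrable (fun q : (Fin n → ℂ) × ℂ => k q.1 * F q.1 q.2)
      (volume.prod unitCircleMeasure) := by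
    refine integrable_prod_unitCircleMeasure
      ((hkm.comp measurable_fst).mul hFm).aestronglyMeasurable hk.compact
      (B' * (B * (∑ i, (‖v i‖ + t * ‖w i‖)) ^ 2)) (fun y ζ hζ => ?_)
      (fun y ζ hy => by simp [hk0 y hy])
    rw [norm_mul]
    exact mul_le_mul (hB' _) (hFB _ _ hζ) (norm_nonneg _) ((norm_nonneg _).trans (hB' 0))
  have e1 : Real.circleAverage
      (fun z => quad (matMollify k H (p + z • b)) (v + (z - z₀) • w)) z₀ t =
      ∫ y, ∫ ζ, k y * F y ζ ∂unitCircleMeasure := by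
    rw [Real.circleAverage_eq_circleAverage_zero_one, ← integral_unitCircleMeasure]
    · rw [integral_integral_swap i1]
      refine integral_congr_ae (Eventually.of_forall fun ζ => ?_)
      simp only [hF]
      rw [quad_matMollify hk hli, add_comm (t * ζ : ℂ) z₀, add_sub_cancel_left]
    · refine (continuous_quad (fun i j => ?_) (by fun_prop)).aestronglyMeasurable
      exact (contDiff_matMollify hk hli i j).continuous.comp (by fun_prop :
        Continuous fun ζ : ℂ => p + (t * ζ + z₀) • b)
  rw [e1, quad_matMollify hk hli]
  have i0 : Integrable fun y => k y * quad (H (p + z₀ • b - y)) v := by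
    have hm0 : Measurable fun y => quad (H (p + z₀ • b - y)) v :=
      measurable_quad (fun i j => (hm i j).comp (by fun_prop :
        Measurable fun y : Fin n → ℂ => p + z₀ • b - y)) measurable_const
    exact (hk.smooth.continuous.integrable_of_hasCompactSupport hk.compact).mul_bdd
      hm0.aestronglyMeasurable
      (Eventually.of_forall fun y => abs_quad_le (hB _) v)
  -- After Fubini the inequality is checked for each translate y separately, by `hsub` on the
  -- translated disc; the radius t is absorbed into b and w.
  refine integral_mono i0 i1.integral_prod_left fun y => ?_
  have e2 : ∫ ζ, k y * F y ζ ∂unitCircleMeasure = k y * ∫ ζ, F y ζ ∂unitCircleMeasure :=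
    integral_const_mul _ _
  have hFy : Measurable (F y) := hFm.of_uncurry_left
  change k y * quad (H (p + z₀ • b - y)) v ≤ ∫ ζ, k y * F y ζ ∂unitCircleMeasure
  rw [e2, integral_unitCircleMeasure hFy.aestronglyMeasurable]
  by_cases hy : k y = 0
  · rw [hy, zero_mul, zero_mul]
  refine mul_le_mul_of_nonneg_left ?_ (hk.nonneg y)
  have a1 : ∀ ζ : ℂ, p + z₀ • b - y + ζ • (t : ℂ) • b = p + (z₀ + t * ζ) • b - y := fun ζ => by
    rw [smul_smul, mul_comm ζ, add_smul]; abel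
  refine (hsub (p + z₀ • b - y) ((t : ℂ) • b) v ((t : ℂ) • w)
    (smul_ne_zero (by exact_mod_cast ht.ne') hb) fun ζ hζ => ?_).trans_eq ?_
  · rw [a1]
    exact hL ζ y hζ (hk.norm_lt y hy)
  · congr 1
    funext ζ
    simp only [hF]
    rw [a1, smul_smul, mul_comm ζ]

end Nondegeneracy

/-! ### Nondegeneracy almost everywhere around a nondegenerate point. -/

section Nondegeneracy

open Matrix
open scoped ComplexOrder

variable {n r : ℕ}

/-- Fatou's lemma for the non-negative functions log C − log d_m: their lower limit has finite
integral, hence is finite almost everywhere, whereas d_m → 0 would make it infinite. -/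
lemma ae_not_tendsto_zero_of_integral_log {α : Type*} [MeasurableSpace α] {μ : Measure α}
    [IsProbabilityMeasure μ] {d : ℕ → α → ℝ} (hd : ∀ m, Measurable (d m)) (h0 : ∀ m x, 0 < d m x)
    {C D : ℝ} (hC : ∀ m x, d m x ≤ C) (hi : ∀ m, Integrable (fun x => Real.log (d m x)) μ)
    (hD : ∀ m, D ≤ ∫ x, Real.log (d m x) ∂μ) :
    ∀ᵐ x ∂μ, ¬ Tendsto (fun m => d m x) atTop (𝓝 0) := by
  set F : ℕ → α → ENNReal := fun m x => ENNReal.ofReal (Real.log C - Real.log (d m x)) with hF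
  have hFm : ∀ m, Measurable (F m) := fun m =>
    ENNReal.measurable_ofReal.comp (measurable_const.sub (Real.measurable_log.comp (hd m)))
  have h1 : ∀ m, ∫⁻ x, F m x ∂μ ≤ ENNReal.ofReal (Real.log C - D) := by
    intro m
    rw [hF, ← ofReal_integral_eq_lintegral_ofReal (f := fun x => Real.log C - Real.log (d m x))
      ((integrable_const _).sub (hi m)) (Eventually.of_forall fun x => sub_nonneg.2 (Real.log_le_log (h0 m x) (hC m x)))]
    refine ENNReal.ofReal_le_ofReal ?_
    rw [integral_sub (integrable_const _) (hi m)]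
    have := hD m
    simp only [integral_const, probReal_univ, one_smul]
    linarith
  have h2 : ∫⁻ x, liminf (fun m => F m x) atTop ∂μ ≤ ENNReal.ofReal (Real.log C - D) :=
    (lintegral_liminf_le hFm).trans
      ((liminf_le_liminf (Eventually.of_forall h1)).trans_eq (liminf_const _))
  have h3 : ∀ᵐ x ∂μ, liminf (fun m => F m x) atTop < ⊤ :=
    ae_lt_top (Measurable.liminf hFm) (h2.trans_lt ENNReal.ofReal_lt_top).ne
  filter_upwards [h3] with x hx ht
  have h4 : Tendsto (fun m => Real.log (d m x)) atTop atBot :=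
    Real.tendsto_log_nhdsGT_zero.comp (tendsto_nhdsWithin_iff.2
      ⟨ht, Eventually.of_forall fun m => h0 m x⟩)
  have h5 : Tendsto (fun m => F m x) atTop (𝓝 ⊤) := by
    refine ENNReal.tendsto_ofReal_atTop.comp ?_
    simpa [sub_eq_add_neg] using tendsto_atTop_add_const_left atTop (Real.log C)
      (tendsto_neg_atBot_atTop.comp h4)
  rw [h5.liminf_eq] at hx
  exact lt_irrefl _ hx

/-- The hypothesis that `‖s‖²_H` is plurisubharmonic on `Ω` for affine sections `s`. -/
def IsAffinePSHOn (H : (Fin n → ℂ) → Matrix (Fin r) (Fin r) ℂ) (Ω : Set (Fin n → ℂ)) : Prop :=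
  ∀ (ℓ : (Fin n → ℂ) →L[ℂ] ℂ) (v w : Fin r → ℂ), IsPSHOn (fun z => quad (H z) (v + ℓ z • w)) Ω

lemma IsAffinePSHOn.isPSHOn {H : (Fin n → ℂ) → Matrix (Fin r) (Fin r) ℂ} {Ω : Set (Fin n → ℂ)}
    (h : IsAffinePSHOn H Ω) (v : Fin r → ℂ) : IsPSHOn (fun z => quad (H z) v) Ω := by
  simpa using h 0 v 0

/-- As b ≠ 0, some linear ℓ has ℓ(b) = 1. The section v + ζw along the disc is then the restriction
of an affine section of the ambient space. -/
lemma IsAffinePSHOn.quad_le_circleAverage {H : (Fin n → ℂ) → Matrix (Fin r) (Fin r) ℂ}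
    {Ω : Set (Fin n → ℂ)} (h : IsAffinePSHOn H Ω) (y b : Fin n → ℂ) (v w : Fin r → ℂ)
    (hb : b ≠ 0) (hy : ∀ ζ : ℂ, ‖ζ‖ ≤ 1 → y + ζ • b ∈ Ω) :
    quad (H y) v ≤ Real.circleAverage (fun ζ : ℂ => quad (H (y + ζ • b)) (v + ζ • w)) 0 1 := by
  obtain ⟨i, hi⟩ := Function.ne_iff.1 hb
  have hi' : b i ≠ 0 := hi
  set ℓ : (Fin n → ℂ) →L[ℂ] ℂ := (b i)⁻¹ • ContinuousLinearMap.proj i with hℓ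
  have hℓb : ℓ b = 1 := by simp [hℓ, hi']
  have h1 := ((h ℓ (v - ℓ y • w) w).2 y b hy).2
  simp only [sub_add_cancel] at h1
  refine h1.trans_eq ?_
  congr 1
  funext ζ
  rw [map_add, map_smul, hℓb, smul_eq_mul, mul_one, add_smul, ← add_assoc, sub_add_cancel]

lemma continuous_det_of {α : Type*} [TopologicalSpace α] {A : α → Matrix (Fin r) (Fin r) ℂ}
    (hA : ∀ i j, Continuous fun x => A x i j) : Continuous fun x => (A x).det :=
  Continuous.matrix_det (continuous_matrix hA)

lemma IsAffinePSHOn.measurable_indicator {H : (Fin n → ℂ) → Matrix (Fin r) (Fin r) ℂ}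
    {Ω L : Set (Fin n → ℂ)} (h : IsAffinePSHOn H Ω) (hH : ∀ z, (H z).IsHermitian)
    (hL : MeasurableSet L) (hLΩ : L ⊆ Ω) (i j : Fin r) :
    Measurable fun z => L.indicator (fun z => H z i j) z := by
  obtain ⟨c, u, hcu⟩ := exists_polarization i j
  have h1 : (fun z => L.indicator (fun z => H z i j) z) = fun z =>
      ∑ s, c s * ((L.indicator (fun z => quad (H z) (u s)) z : ℝ) : ℂ) := by
    funext z
    by_cases hz : z ∈ L
    · simp only [indicator_of_mem hz, hcu _ (hH z)]
    · simp [indicator_of_notMem hz]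
  rw [h1]
  exact Finset.measurable_sum _ fun s _ => (Complex.measurable_ofReal.comp
    (measurable_indicator_of_upperSemicontinuousOn hL ((h.isPSHOn _).1.mono hLΩ))).const_mul _

/-- The mollified metrics plus ε·1 have subharmonic log det on the disc. At the centre these
converge to the finite number log det H(a), so their circle means are bounded below, and the Fatou
argument forbids det → 0 on a set of positive measure. -/
lemma ae_circle_det_ne_zero {H : (Fin n → ℂ) → Matrix (Fin r) (Fin r) ℂ} {Ω : Set (Fin n → ℂ)}
    (hH : ∀ z, (H z).PosSemidef) (hpsh : IsAffinePSHOn H Ω) {a : Fin n → ℂ} {R : ℝ}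
    (hRΩ : Metric.closedBall a R ⊆ Ω) (ha : (H a).det ≠ 0) {b : Fin n → ℂ} (hb : ‖b‖ < R) :
    ∀ᵐ ζ ∂unitCircleMeasure, (H (a + ζ • b)).det ≠ 0 := by
  rcases eq_or_ne b 0 with rfl | hb0
  · exact Eventually.of_forall fun ζ => by rwa [smul_zero, add_zero]
  set L := Metric.closedBall a R with hLdef
  have hLc : IsCompact L := isCompact_closedBall a R
  set K : (Fin n → ℂ) → Matrix (Fin r) (Fin r) ℂ := L.indicator H with hK
  have hKsd : ∀ z, (K z).PosSemidef := fun z => by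
    by_cases hz : z ∈ L
    · rw [hK, indicator_of_mem hz]; exact hH z
    · rw [hK, indicator_of_notMem hz]; exact PosSemidef.zero
  have hKq : ∀ v z, quad (K z) v = L.indicator (fun z => quad (H z) v) z := fun v z => by
    by_cases hz : z ∈ L
    · rw [hK, indicator_of_mem hz, indicator_of_mem hz]
    · rw [hK, indicator_of_notMem hz, indicator_of_notMem hz]; simp [quad]
  have hqm : ∀ v, Measurable fun z => quad (K z) v := fun v => by
    simp only [hKq]
    exact measurable_indicator_of_upperSemicontinuousOn hLc.measurableSet
      ((hpsh.isPSHOn v).1.mono hRΩ)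
  have hqb : ∀ v, ∃ M, ∀ z ∈ L, |quad (H z) v| ≤ M := fun v => by
    obtain ⟨M, hM⟩ := (hpsh.isPSHOn v).exists_bound hLc hRΩ
    exact ⟨M, fun z hz => by rw [abs_of_nonneg (quad_nonneg (hH z) v)]; exact hM z hz⟩
  choose c u hcu using fun i j : Fin r => exists_polarization (r := r) i j
  choose M hM using hqb
  have hKe : ∀ z i j, K z i j = ∑ s, c i j s * (quad (K z) (u i j s) : ℂ) := fun z i j =>
    hcu i j _ (hKsd z).isHermitian
  have hKm : ∀ i j, Measurable fun z => K z i j := fun i j => by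
    simp only [hKe]
    exact Finset.measurable_sum _ fun s _ =>
      (Complex.measurable_ofReal.comp (hqm _)).const_mul _
  obtain ⟨B, hB⟩ : ∃ B, ∀ z i j, ‖K z i j‖ ≤ B := by
    have hMK : ∀ v z, |quad (K z) v| ≤ |M v| := fun v z => by
      rw [hKq]
      by_cases hz : z ∈ L
      · rw [indicator_of_mem hz]; exact (hM v z hz).trans (le_abs_self _)
      · rw [indicator_of_notMem hz, abs_zero]; positivity
    have h1 : ∀ z i j, ‖K z i j‖ ≤ ∑ s, ‖c i j s‖ * |M (u i j s)| := fun z i j => by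
      rw [hKe]
      refine norm_sum_le_of_le _ fun s _ => ?_
      rw [norm_mul, Complex.norm_real]
      gcongr
      exact hMK _ _
    refine ⟨∑ i, ∑ j, ∑ s, ‖c i j s‖ * |M (u i j s)|, fun z i j => (h1 z i j).trans ?_⟩
    refine (Finset.single_le_sum (f := fun j => ∑ s, ‖c i j s‖ * |M (u i j s)|)
      (fun j _ => by positivity) (Finset.mem_univ j)).trans ?_
    exact Finset.single_le_sum (f := fun i => ∑ j, ∑ s, ‖c i j s‖ * |M (u i j s)|)
      (fun i _ => by positivity) (Finset.mem_univ i)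
  have hKl : ∀ i j, LocallyIntegrable fun z => K z i j := fun i j =>
    locallyIntegrable_of_measurable_of_bound (hKm i j) fun z => hB z i j
  have hsub : ∀ (y b : Fin n → ℂ) (v w : Fin r → ℂ), b ≠ 0 → (∀ ζ : ℂ, ‖ζ‖ ≤ 1 → y + ζ • b ∈ L) →
      quad (K y) v ≤ Real.circleAverage (fun ζ : ℂ => quad (K (y + ζ • b)) (v + ζ • w)) 0 1 := by
    intro y b v w hb hy
    have h1 := hpsh.quad_le_circleAverage y b v w hb fun ζ hζ => hRΩ (hy ζ hζ)
    rw [Real.circleAverage_congr_sphere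
      (f₂ := fun ζ : ℂ => quad (H (y + ζ • b)) (v + ζ • w)), hK, indicator_of_mem]
    · exact h1
    · simpa using hy 0 (by simp)
    · intro ζ hζ
      simp only [hK]
      rw [indicator_of_mem (hy ζ (by simpa using (mem_sphere_zero_iff_norm.1 hζ).le))]
  -- the mollified metrics
  set ε : ℕ → ℝ := fun m => (R - ‖b‖) / (m + 1) with hε
  have hδ : 0 < R - ‖b‖ := sub_pos.2 hb
  have hε0 : ∀ m, 0 < ε m := fun m => by positivity
  have hεle : ∀ m, ε m ≤ R - ‖b‖ := fun m => div_le_self hδ.le (by simp)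
  have hεt : Tendsto ε atTop (𝓝 0) := by
    have := (tendsto_one_div_add_atTop_nhds_zero_nat (𝕜 := ℝ)).const_mul (R - ‖b‖)
    simpa [hε, div_eq_mul_inv] using this
  choose k hk using fun m => exists_isMollifier n (hε0 m)
  set G : ℕ → ℂ → Matrix (Fin r) (Fin r) ℂ := fun m ζ =>
    matMollify (k m) K (a + ζ • b) + (ε m : ℂ) • (1 : Matrix (Fin r) (Fin r) ℂ) with hG
  have hGs : ∀ m i j, ContDiff ℝ ∞ fun ζ => G m ζ i j := fun m i j => by
    have h1 := contDiff_matMollify (hk m) hKl i j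
    have h2 : ContDiff ℝ ∞ fun ζ : ℂ => a + ζ • b := contDiff_const.add
      (contDiff_id.smul contDiff_const)
    exact (h1.comp h2).add contDiff_const
  have hGh : ∀ m z, (matMollify (k m) K z).IsHermitian := fun m =>
    isHermitian_matMollify _ fun z => (hKsd z).isHermitian
  have hGq : ∀ m z v, 0 ≤ quad (matMollify (k m) K z) v := fun m z v => by
    rw [quad_matMollify (hk m) hKl]
    exact integral_nonneg fun w => mul_nonneg ((hk m).nonneg w) (quad_nonneg (hKsd _) v)
  have hGpd : ∀ m ζ, (G m ζ).PosDef := fun m ζ =>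
    posDef_add_smul_one (hGh m _) (hGq m _) (hε0 m)
  have hGsub : ∀ m (z₀ : ℂ) t, 0 < t → ‖z₀‖ + t < 1 → ∀ v w,
      quad (G m z₀) v ≤ Real.circleAverage (fun z => quad (G m z) (v + (z - z₀) • w)) z₀ t := by
    intro m z₀ t ht hzt v w
    have h1 := quad_matMollify_le_circleAverage (L := L) hKm hB hsub (hk m) (p := a) hb0
      (z₀ := z₀) ht (fun ζ y hζ hy => by
        rw [hLdef, mem_closedBall_iff_norm]
        have e : a + (z₀ + t * ζ) • b - y - a = (z₀ + t * ζ) • b - y := by abel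
        rw [e]
        refine (norm_sub_le _ _).trans ?_
        rw [norm_smul]
        have h2 : ‖z₀ + t * ζ‖ ≤ 1 := by
          refine (norm_add_le _ _).trans ?_
          rw [norm_mul, Complex.norm_real, Real.norm_of_nonneg ht.le]
          nlinarith
        have h3 := hεle m
        nlinarith [norm_nonneg b]) v w
    have h2 := sum_norm_sq_le_circleAverage v w z₀ t
    have c1 : Continuous fun z => quad (matMollify (k m) K (a + z • b)) (v + (z - z₀) • w) :=
      continuous_quad (fun i j => (contDiff_matMollify (hk m) hKl i j).continuous.comp
        (by fun_prop : Continuous fun z : ℂ => a + z • b)) (by fun_prop)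
    have c2 : Continuous fun z : ℂ => ε m * ∑ i, ‖(v + (z - z₀) • w) i‖ ^ 2 := by fun_prop
    have e2 := Real.circleAverage_fun_smul (a := ε m) (c := z₀) (R := t)
      (f := fun z : ℂ => ∑ i, ‖(v + (z - z₀) • w) i‖ ^ 2)
    simp only [smul_eq_mul] at e2
    simp only [hG, quad_add_smul_one]
    rw [Real.circleAverage_fun_add c1.continuousOn.circleIntegrable'
      c2.continuousOn.circleIntegrable', e2]
    exact add_le_add h1 (mul_le_mul_of_nonneg_left h2 (hε0 m).le)
  have hlog : ∀ m, Real.log (G m 0).det.re ≤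
      Real.circleAverage (fun z => Real.log (G m z).det.re) 0 1 := fun m =>
    log_det_le_circleAverage (hGs m) (hGpd m) (hGsub m)
  -- convergence
  have hGt : ∀ ζ : ℂ, ‖ζ‖ ≤ 1 → ∀ i j, Tendsto (fun m => G m ζ i j) atTop
      (𝓝 (H (a + ζ • b) i j)) := by
    intro ζ hζ i j
    have hz : L ∈ 𝓝 (a + ζ • b) := by
      refine mem_of_superset (Metric.isOpen_ball.mem_nhds ?_) Metric.ball_subset_closedBall
      rw [mem_ball_iff_norm, add_sub_cancel_left, norm_smul]
      nlinarith [norm_nonneg b]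
    have h1 : ∀ v, Tendsto (fun m => quad (matMollify (k m) K (a + ζ • b)) v) atTop
        (𝓝 (quad (H (a + ζ • b)) v)) := fun v => by
      have := tendsto_mollify hk hεt (hpsh.isPSHOn v) hLc hRΩ (hM v) hz
      refine this.congr fun m => ?_
      rw [quad_matMollify (hk m) hKl]
      simp only [hKq]
    have h2 : Tendsto (fun m => matMollify (k m) K (a + ζ • b) i j) atTop
        (𝓝 (H (a + ζ • b) i j)) := by
      rw [hcu i j _ (hH _).isHermitian]
      refine (tendsto_finsetSum _ fun s _ => (((Complex.continuous_ofReal.tendsto _).comp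
        (h1 (u i j s))).const_mul (c i j s))).congr fun m => ?_
      exact (hcu i j _ (hGh m _)).symm
    have h3 : Tendsto (fun m => (ε m : ℂ) * (1 : Matrix (Fin r) (Fin r) ℂ) i j) atTop (𝓝 0) := by
      have := ((Complex.continuous_ofReal.tendsto _).comp hεt).mul_const
        ((1 : Matrix (Fin r) (Fin r) ℂ) i j)
      simpa using this
    have h4 := h2.add h3
    rwa [add_zero] at h4
  have hdet : ∀ ζ : ℂ, ‖ζ‖ ≤ 1 → Tendsto (fun m => (G m ζ).det.re) atTop
      (𝓝 (H (a + ζ • b)).det.re) := fun ζ hζ => by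
    have h1 : Tendsto (fun m => G m ζ) atTop (𝓝 (H (a + ζ • b))) :=
      tendsto_pi_nhds.2 fun i => tendsto_pi_nhds.2 fun j => hGt ζ hζ i j
    exact (Complex.continuous_re.tendsto _).comp
      (((continuous_id.matrix_det (n := Fin r)).tendsto _).comp h1)
  have hpos : ∀ m ζ, 0 < (G m ζ).det.re := fun m ζ => (Complex.lt_def.1 (hGpd m ζ).det_pos).1
  have hcont : ∀ m, Continuous fun ζ => (G m ζ).det.re := fun m =>
    Complex.continuous_re.comp (continuous_det_of fun i j => (hGs m i j).continuous)
  have hcl : ∀ m, Continuous fun ζ => Real.log (G m ζ).det.re := fun m =>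
    (hcont m).log fun ζ => (hpos m ζ).ne'
  have hbd : ∀ m ζ, (G m ζ).det.re ≤ (Fintype.card (Fin r)).factorial •
      (B + (R - ‖b‖)) ^ Fintype.card (Fin r) := fun m ζ => by
    refine (Complex.re_le_norm _).trans ?_
    refine det_le (abv := NormedField.toAbsoluteValue ℂ) fun i j => ?_
    refine (norm_add_le _ _).trans (add_le_add (norm_matMollify_le (hk m) hB _ i j) ?_)
    rw [Matrix.smul_apply, smul_eq_mul, norm_mul, Complex.norm_real, Real.norm_of_nonneg (hε0 m).le,
      one_apply]
    split_ifs
    · simpa using hεle m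
    · simpa using hδ.le
  -- Semidefinite matrices have real determinant, so a nonzero determinant has nonzero real part, as
  -- the logarithm requires.
  have hreal : ∀ z, ((H z).det.re : ℂ) = (H z).det := fun z => by
    have := (Complex.le_def.1 (hH z).det_nonneg).2
    apply Complex.ext <;> simp_all
  have h0 : Tendsto (fun m => Real.log (G m 0).det.re) atTop (𝓝 (Real.log (H a).det.re)) := by
    have := hdet 0 (by simp)
    rw [zero_smul, add_zero] at this
    refine (Real.continuousAt_log ?_).tendsto.comp this
    intro h
    have h1 := hreal a
    rw [h] at h1
    exact ha (by simpa using h1.symm)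
  obtain ⟨D, hD⟩ := h0.bddBelow_range
  have hmain := ae_not_tendsto_zero_of_integral_log (μ := unitCircleMeasure)
    (d := fun m ζ => (G m ζ).det.re) (fun m => (hcont m).measurable) hpos hbd
    (fun m => integrable_unitCircleMeasure_of_continuous (hcl m)) (D := D) (fun m => by
      rw [integral_unitCircleMeasure (hcl m).aestronglyMeasurable]
      exact (hD (mem_range_self m)).trans (hlog m))
  filter_upwards [hmain, ae_norm_eq_one] with ζ hζ h1 hz
  apply hζ
  have := hdet ζ h1.le
  rwa [hz] at this

/-- If `H a` is nondegenerate, then `H` is nondegenerate almost everywhere on any ball around `a`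
whose closure lies in `Ω`. -/
lemma ae_ball_det_ne_zero {H : (Fin n → ℂ) → Matrix (Fin r) (Fin r) ℂ} {Ω : Set (Fin n → ℂ)}
    (hH : ∀ z, (H z).PosSemidef) (hpsh : IsAffinePSHOn H Ω) {a : Fin n → ℂ} {R : ℝ}
    (hRΩ : Metric.closedBall a R ⊆ Ω) (ha : (H a).det ≠ 0) :
    ∀ᵐ z, z ∈ Metric.ball a R → (H z).det ≠ 0 := by
  set L := Metric.closedBall a R with hLdef
  -- Cutting off outside L makes the determinant globally measurable, as needed for exchanging the
  -- almost-everywhere quantifiers.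
  set K : (Fin n → ℂ) → Matrix (Fin r) (Fin r) ℂ := fun z =>
    Matrix.of fun i j => L.indicator (fun z => H z i j) z with hK
  have hKH : ∀ z ∈ L, K z = H z := fun z hz => by
    ext i j
    simp only [hK, of_apply, indicator_of_mem hz]
  have hdm : Measurable fun z => (K z).det := by
    simp only [det_apply']
    refine Finset.measurable_sum _ fun σ _ => Measurable.const_mul ?_ _
    refine Finset.measurable_prod _ fun i _ => ?_
    exact hpsh.measurable_indicator (fun z => (hH z).isHermitian)
      (isCompact_closedBall a R).measurableSet hRΩ _ _
  have hmem : ∀ (b : Fin n → ℂ) (ζ : ℂ), ‖ζ‖ = 1 → ‖b‖ < R → a + ζ • b ∈ Metric.ball a R :=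
    fun b ζ hζ hb => by rwa [mem_ball_iff_norm, add_sub_cancel_left, norm_smul, hζ, one_mul]
  have h1 : ∀ b : Fin n → ℂ, ∀ᵐ ζ ∂unitCircleMeasure, ‖b‖ < R → (K (a + ζ • b)).det ≠ 0 := by
    intro b
    by_cases hb : ‖b‖ < R
    · filter_upwards [ae_circle_det_ne_zero hH hpsh hRΩ ha hb, ae_norm_eq_one] with ζ h2 h3 _
      rwa [hKH _ (Metric.ball_subset_closedBall (hmem b ζ h3 hb))]
    · exact Eventually.of_forall fun ζ h => absurd h hb
  have hms : MeasurableSet {p : (Fin n → ℂ) × ℂ | ‖p.1‖ < R → (K (a + p.2 • p.1)).det ≠ 0} := by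
    have m1 : MeasurableSet {p : (Fin n → ℂ) × ℂ | ‖p.1‖ < R} :=
      measurableSet_lt measurable_fst.norm measurable_const
    have m2 : MeasurableSet {p : (Fin n → ℂ) × ℂ | (K (a + p.2 • p.1)).det = 0} :=
      measurableSet_eq_fun (hdm.comp (by fun_prop :
        Measurable fun p : (Fin n → ℂ) × ℂ => a + p.2 • p.1)) measurable_const
    exact m1.imp m2.compl
  -- Exchanging quantifiers yields one unit ζ that is good for almost every b. Since multiplication
  -- by ζ⁻¹ preserves Lebesgue measure, the points a + ζb then fill almost all of the ball.
  have h2 := (Measure.ae_ae_comm (μ := (volume : Measure (Fin n → ℂ))) (ν := unitCircleMeasure)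
    (p := fun b ζ => ‖b‖ < R → (K (a + ζ • b)).det ≠ 0) hms).1 (Eventually.of_forall h1)
  obtain ⟨ζ, hζ, hζ1⟩ := (h2.and ae_norm_eq_one).exists
  have hζ0 : ζ ≠ 0 := fun h => by simp [h] at hζ1
  have hζ' : ‖ζ⁻¹‖ = 1 := by rw [norm_inv, hζ1, inv_one]
  have h3 := (measurePreserving_unit_smul (n := n) hζ').quasiMeasurePreserving.ae hζ
  have h4 := (measurePreserving_sub_right (volume : Measure (Fin n → ℂ))
    a).quasiMeasurePreserving.ae h3
  filter_upwards [h4] with z hz hzR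
  rw [mem_ball_iff_norm] at hzR
  rw [norm_smul, hζ', one_mul, smul_smul, mul_inv_cancel₀ hζ0, one_smul, add_sub_cancel] at hz
  rw [← hKH z (by rw [hLdef, mem_closedBall_iff_norm]; exact hzR.le)]
  exact hz hzR

end Nondegeneracy

lemma IsPSHOn.congr {n : ℕ} {f g : (Fin n → ℂ) → ℝ} {Ω : Set (Fin n → ℂ)} (hf : IsPSHOn f Ω)
    (hfg : EqOn f g Ω) : IsPSHOn g Ω := by
  refine ⟨fun z hz => ?_, fun a b hab => ?_⟩
  · exact (hf.1 z hz).congr_of_eventuallyEq hz (eventually_of_mem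
      self_mem_nhdsWithin fun y hy t => by rw [hfg hy])
  · obtain ⟨h1, h2⟩ := hf.2 a b hab
    have h3 : EqOn (fun ζ : ℂ => f (a + ζ • b)) (fun ζ : ℂ => g (a + ζ • b))
        (Metric.sphere 0 |1|) := fun ζ hζ => hfg (hab ζ (by
          have := mem_sphere_zero_iff_norm.1 hζ
          rw [this, abs_one]))
    refine ⟨h1.congr_codiscreteWithin ?_, ?_⟩
    · exact eventually_of_mem (mem_codiscreteWithin.2 fun z hz => by simp) h3
    · rw [← Real.circleAverage_congr_sphere h3]
      have := hfg (hab 0 (by simp))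
      simp only [zero_smul, add_zero] at this
      rwa [← this]

lemma isOpen_chartImage {n : ℕ} {X : Type*} [TopologicalSpace X] {c : OpenPartialHomeomorph X (Fin n → ℂ)} {U : Set X} (hU : IsOpen U) :
    IsOpen (chartImage c U) :=
  c.isOpen_inter_preimage_symm hU

/-! ### From bundles to matrix-valued functions in charts. -/

section HolomorphicSection

variable {n r : ℕ} {X : Type*} [TopologicalSpace X] [ChartedSpace (Fin n → ℂ) X]
  {E : X → Type*} [TopologicalSpace (TotalSpace (Fin r → ℂ) E)] [∀ x, TopologicalSpace (E x)]
  [∀ x, AddCommGroup (E x)] [∀ x, Module ℂ (E x)] [FiberBundle (Fin r → ℂ) E]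
  [VectorBundle ℂ (Fin r → ℂ) E]

/-- Griffiths negativity is tested on these sections alone: constant ones control the entries of h,
affine ones its determinant. -/
lemma isHolomorphicOn_affine {c : OpenPartialHomeomorph X (Fin n → ℂ)}
    (hc : c ∈ holomorphicCharts n X) {e : Fin r → ∀ x, E x} {U : Set X}
    (he : IsHolomorphicFrame (n := n) r e U) (ℓ : (Fin n → ℂ) →L[ℂ] ℂ) (v w : Fin r → ℂ) :
    IsHolomorphicOn (n := n) r (fun x => ∑ a, (v a + ℓ (c x) * w a) • e a x) (c.source ∩ U) := by
  have h1 : ContMDiffOn 𝓘(ℂ, Fin n → ℂ) 𝓘(ℂ, Fin n → ℂ) ω c c.source :=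
    contMDiffOn_of_mem_maximalAtlas hc
  refine ContMDiffOn.sum_section (t := fun a x => (v a + ℓ (c x) * w a) • e a x) fun a _ => ?_
  have hg : ContDiff ℂ ω fun y : Fin n → ℂ => v a + ℓ y * w a :=
    contDiff_const.add (ℓ.contDiff.mul contDiff_const)
  have h2 : ContMDiffOn 𝓘(ℂ, Fin n → ℂ) 𝓘(ℂ, ℂ) ω (fun x => v a + ℓ (c x) * w a)
      (c.source ∩ U) := hg.contMDiff.comp_contMDiffOn (h1.mono inter_subset_left)
  exact h2.smul_section ((he.isFrame.contMDiffOn a).mono inter_subset_right)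

end HolomorphicSection

section Metric

open Matrix
open scoped ComplexOrder

variable {n r : ℕ} {X : Type*} [TopologicalSpace X] [ChartedSpace (Fin n → ℂ) X]
  [MeasurableSpace X]
  {E : X → Type*} [TopologicalSpace (TotalSpace (Fin r → ℂ) E)] [∀ x, TopologicalSpace (E x)]
  [∀ x, AddCommGroup (E x)] [∀ x, Module ℂ (E x)] [FiberBundle (Fin r → ℂ) E]

namespace SingularHermitianMetric

variable (h : SingularHermitianMetric (n := n) r E)

lemma isHermitian_localMatrix (c : OpenPartialHomeomorph X (Fin n → ℂ)) (e : Fin r → ∀ x, E x)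
    (z : Fin n → ℂ) : (h.localMatrix c e z).IsHermitian := by
  ext i j
  simp only [conjTranspose_apply, localMatrix, of_apply]
  exact h.conj_symm _ _ _

lemma form_sum_right (c : OpenPartialHomeomorph X (Fin n → ℂ)) (e : Fin r → ∀ x, E x)
    (z : Fin n → ℂ) (v : Fin r → ℂ) (a : Fin r) :
    h.form (c.symm z) (e a (c.symm z)) (∑ b, v b • e b (c.symm z)) =
      (h.localMatrix c e z *ᵥ v) a := by
  simp only [map_sum, map_smul, mulVec, dotProduct, localMatrix, of_apply, smul_eq_mul]
  exact Finset.sum_congr rfl fun b _ => mul_comm _ _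

lemma form_sum_sum (c : OpenPartialHomeomorph X (Fin n → ℂ)) (e : Fin r → ∀ x, E x)
    (z : Fin n → ℂ) (u v : Fin r → ℂ) :
    h.form (c.symm z) (∑ a, u a • e a (c.symm z)) (∑ b, v b • e b (c.symm z)) =
      star u ⬝ᵥ h.localMatrix c e z *ᵥ v := by
  rw [map_sum (h.form (c.symm z)), LinearMap.sum_apply]
  simp only [map_smulₛₗ, LinearMap.smul_apply, h.form_sum_right c, dotProduct, Pi.star_apply,
    smul_eq_mul]
  rfl

lemma quad_localMatrix (c : OpenPartialHomeomorph X (Fin n → ℂ)) (e : Fin r → ∀ x, E x)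
    (z : Fin n → ℂ) (v : Fin r → ℂ) :
    quad (h.localMatrix c e z) v = (h.form (c.symm z) (∑ a, v a • e a (c.symm z))
      (∑ a, v a • e a (c.symm z))).re := by
  rw [form_sum_sum, quad]

lemma posSemidef_localMatrix (c : OpenPartialHomeomorph X (Fin n → ℂ)) (e : Fin r → ∀ x, E x)
    (z : Fin n → ℂ) : (h.localMatrix c e z).PosSemidef := by
  refine PosSemidef.of_dotProduct_mulVec_nonneg (h.isHermitian_localMatrix c e z) fun v => ?_
  rw [star_dotProduct_eq_quad (h.isHermitian_localMatrix c e z), Complex.zero_le_real,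
    quad_localMatrix]
  exact h.nonneg _ _

lemma isNondegenerateAt_iff {c : OpenPartialHomeomorph X (Fin n → ℂ)} {e : Fin r → ∀ x, E x}
    {U : Set X} (he : IsHolomorphicFrame (n := n) r e U) {z : Fin n → ℂ} (hz : c.symm z ∈ U) :
    h.IsNondegenerateAt (c.symm z) ↔ (h.localMatrix c e z).det ≠ 0 := by
  have hspan : ∀ s : E (c.symm z), ∃ v : Fin r → ℂ, s = ∑ a, v a • e a (c.symm z) := fun s => by
    obtain ⟨v, hv⟩ := (Submodule.mem_span_range_iff_exists_fun ℂ).1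
      (he.isFrame.generating hz (Submodule.mem_top (x := s)))
    exact ⟨v, hv.symm⟩
  rw [Ne, ← exists_mulVec_eq_zero_iff]
  constructor
  · rintro hN ⟨v, hv, h0⟩
    have h1 := hN (∑ a, v a • e a (c.symm z)) fun t => by
      obtain ⟨u, rfl⟩ := hspan t
      rw [form_sum_sum, h0, dotProduct_zero]
    exact hv (funext (Fintype.linearIndependent_iff.1 (he.isFrame.linearIndependent hz) v h1))
  · intro hdet s hs
    obtain ⟨v, rfl⟩ := hspan s
    have h1 : h.localMatrix c e z *ᵥ v = 0 := by
      funext a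
      rw [← form_sum_right]
      exact hs _
    have h2 : v = 0 := by
      by_contra hv
      exact hdet ⟨v, hv, h1⟩
    simp [h2]

variable [VectorBundle ℂ (Fin r → ℂ) E]

lemma IsGriffithsNegativeOn.isAffinePSHOn {h : SingularHermitianMetric (n := n) r E} {W : Set X}
    (hW : h.IsGriffithsNegativeOn W) {c : OpenPartialHomeomorph X (Fin n → ℂ)}
    (hc : c ∈ holomorphicCharts n X) {e : Fin r → ∀ x, E x} {U : Set X} (hU : U ⊆ W)
    (he : IsHolomorphicFrame (n := n) r e U) :
    IsAffinePSHOn (h.localMatrix c e) (chartImage c U) := by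
  intro ℓ v w
  have h1 := hW (c.source ∩ U) (inter_subset_right.trans hU) (c.open_source.inter he.isOpen) _
    (isHolomorphicOn_affine hc he ℓ v w) c hc
  have h2 : chartImage c (c.source ∩ U) = chartImage c U := by
    ext z
    simp only [chartImage, mem_inter_iff, mem_preimage]
    exact ⟨fun h => ⟨h.1, h.2.2⟩, fun h => ⟨h.1, c.map_target h.1, h.2⟩⟩
  rw [h2] at h1
  refine h1.congr fun z hz => ?_
  rw [quad_localMatrix, Function.comp_apply, normSq, c.right_inv hz.1]
  rfl

end SingularHermitianMetric

end Metric

open scoped ComplexOrder in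
/-- Nondegeneracy at points arbitrarily close to `z₀` implies nondegeneracy almost everywhere
near `z₀`. -/
lemma IsAffinePSHOn.exists_nhds_ae_det_ne_zero {n r : ℕ}
    {H : (Fin n → ℂ) → Matrix (Fin r) (Fin r) ℂ} {Ω : Set (Fin n → ℂ)} (hΩ : IsOpen Ω)
    (hH : ∀ z, (H z).PosSemidef) (hpsh : IsAffinePSHOn H Ω) {z₀ : Fin n → ℂ} (hz₀ : z₀ ∈ Ω)
    (hfr : ∃ᶠ z in 𝓝 z₀, (H z).det ≠ 0) :
    ∃ V ⊆ Ω, IsOpen V ∧ z₀ ∈ V ∧ ∀ᵐ z, z ∈ V → (H z).det ≠ 0 := by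
  obtain ⟨ρ, hρ, hρΩ⟩ := Metric.isOpen_iff.1 hΩ z₀ hz₀
  -- With a within ρ/4 of z₀, the ball of radius ρ/2 about a contains the ρ/4-ball about z₀, and its
  -- closure stays in the ρ-ball.
  obtain ⟨a, ha, haz⟩ := (hfr.and_eventually (Metric.ball_mem_nhds z₀ (ε := ρ / 4)
    (by positivity))).exists
  have h1 : Metric.closedBall a (ρ / 2) ⊆ Ω := by
    refine Subset.trans (fun y hy => ?_) hρΩ
    rw [Metric.mem_closedBall] at hy
    rw [Metric.mem_ball]
    linarith [dist_triangle y a z₀]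
  refine ⟨Metric.ball z₀ (ρ / 4), (Metric.ball_subset_ball (by linarith)).trans hρΩ,
    Metric.isOpen_ball, Metric.mem_ball_self (by positivity), ?_⟩
  filter_upwards [ae_ball_det_ne_zero hH hpsh h1 ha] with z hz hzV
  refine hz ?_
  rw [Metric.mem_ball] at hzV ⊢
  linarith [dist_triangle z z₀ a, dist_comm a z₀]

lemma exists_isHolomorphicFrame (n r : ℕ) {X : Type*} [TopologicalSpace X]
    [ChartedSpace (Fin n → ℂ) X] (E : X → Type*) [TopologicalSpace (TotalSpace (Fin r → ℂ) E)]
    [∀ x, TopologicalSpace (E x)] [∀ x, AddCommGroup (E x)] [∀ x, Module ℂ (E x)]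
    [FiberBundle (Fin r → ℂ) E] [VectorBundle ℂ (Fin r → ℂ) E]
    [ContMDiffVectorBundle ω (Fin r → ℂ) E 𝓘(ℂ, Fin n → ℂ)] (x : X) : ∃ (U : Set X) (e : Fin r → ∀ x, E x),
    x ∈ U ∧ IsHolomorphicFrame (n := n) r e U := by
  let t := trivializationAt (Fin r → ℂ) E x
  exact ⟨t.baseSet, t.localFrame (Pi.basisFun ℂ (Fin r)),
    FiberBundle.mem_baseSet_trivializationAt' x, t.open_baseSet,
    t.isLocalFrameOn_localFrame_baseSet 𝓘(ℂ, Fin n → ℂ) ω _⟩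

/-! ### Propagation of nondegeneracy over connected components. -/

namespace SingularHermitianMetric

variable {n r : ℕ} {X : Type*} [TopologicalSpace X] [ChartedSpace (Fin n → ℂ) X]
  [MeasurableSpace X]
  {E : X → Type*} [TopologicalSpace (TotalSpace (Fin r → ℂ) E)] [∀ x, TopologicalSpace (E x)]
  [∀ x, AddCommGroup (E x)] [∀ x, Module ℂ (E x)] [FiberBundle (Fin r → ℂ) E]
  [VectorBundle ℂ (Fin r → ℂ) E]
  {h : SingularHermitianMetric (n := n) r E}

lemma IsGriffithsNegative.exists_nhds_ae (hneg : h.IsGriffithsNegative)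
    {c : OpenPartialHomeomorph X (Fin n → ℂ)} (hc : c ∈ holomorphicCharts n X) {U : Set X}
    {e : Fin r → ∀ x, E x} (he : IsHolomorphicFrame (n := n) r e U) {z₀ : Fin n → ℂ}
    (hz₀ : z₀ ∈ chartImage c U) (hfr : ∃ᶠ x in 𝓝 (c.symm z₀), h.IsNondegenerateAt x) :
    ∃ V ⊆ chartImage c U, IsOpen V ∧ z₀ ∈ V ∧
      ∀ᵐ z, z ∈ V → (h.localMatrix c e z).det ≠ 0 := by
  have hΩ := isOpen_chartImage (c := c) he.isOpen
  refine (IsGriffithsNegativeOn.isAffinePSHOn hneg hc (subset_univ U)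
    he).exists_nhds_ae_det_ne_zero hΩ (h.posSemidef_localMatrix c e) hz₀ ?_
  rw [← c.symm.map_nhds_eq hz₀.1, frequently_map] at hfr
  refine (hfr.and_eventually (hΩ.mem_nhds hz₀)).mono fun z hz => ?_
  exact (h.isNondegenerateAt_iff he hz.2.2).1 hz.1

variable [IsManifold 𝓘(ℂ, Fin n → ℂ) ω X] [ContMDiffVectorBundle ω (Fin r → ℂ) E 𝓘(ℂ, Fin n → ℂ)]

/-- If `h` is nondegenerate somewhere on each connected component, then its nondegenerate points
are dense. -/
lemma IsGriffithsNegative.frequently_isNondegenerateAt (hneg : h.IsGriffithsNegative)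
    (hcomp : ∀ x : X, ∃ y ∈ connectedComponent x, h.IsNondegenerateAt y) (x : X) :
    ∃ᶠ y in 𝓝 x, h.IsNondegenerateAt y := by
  set A : Set X := {x | ∀ᶠ y in 𝓝 x, ¬ h.IsNondegenerateAt y} with hA
  have hAo : IsOpen A := isOpen_iff_mem_nhds.2 fun x hx => eventually_eventually_nhds.2 hx
  -- Near a limit of nondegenerate points the degenerate set is null in a chart, so it contains no
  -- nonempty open set there.
  have hAc : IsOpen Aᶜ := by
    refine isOpen_iff_mem_nhds.2 fun x₀ hx₀ => ?_
    have hx₀' : ∃ᶠ y in 𝓝 x₀, h.IsNondegenerateAt y := hx₀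
    obtain ⟨U, e, hxU, he⟩ := exists_isHolomorphicFrame n r E x₀
    set c := chartAt (Fin n → ℂ) x₀ with hcdef
    have hc : c ∈ holomorphicCharts n X := IsManifold.chart_mem_maximalAtlas x₀
    have hxs : x₀ ∈ c.source := mem_chart_source _ x₀
    have hinv : c.symm (c x₀) = x₀ := c.left_inv hxs
    have hz₀ : c x₀ ∈ chartImage c U := ⟨c.map_source hxs, by
      rw [mem_preimage, hinv]; exact hxU⟩
    obtain ⟨V, hVΩ, hVo, hzV, hae⟩ := hneg.exists_nhds_ae hc he hz₀ (by rwa [hinv])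
    have hN : c.source ∩ c ⁻¹' V ∈ 𝓝 x₀ :=
      (c.isOpen_inter_preimage hVo).mem_nhds ⟨hxs, hzV⟩
    refine mem_of_superset hN fun x₁ hx₁ => ?_
    intro hev
    have hinv₁ : c.symm (c x₁) = x₁ := c.left_inv hx₁.1
    change ∀ᶠ y in 𝓝 x₁, ¬ h.IsNondegenerateAt y at hev
    rw [← hinv₁, ← c.symm.map_nhds_eq (c.map_source hx₁.1), eventually_map] at hev
    obtain ⟨O, hO, hOo, hxO⟩ := mem_nhds_iff.1 (inter_mem hev (hVo.mem_nhds hx₁.2))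
    have hpos : 0 < volume O := hOo.measure_pos _ ⟨_, hxO⟩
    refine hpos.ne' (measure_mono_null (fun z hz => ?_) (ae_iff.1 hae))
    simp only [mem_ofPred_eq, Classical.not_imp]
    refine ⟨(hO hz).2, fun hd => (hO hz).1 ?_⟩
    exact (h.isNondegenerateAt_iff he (hVΩ (hO hz).2).2).2 hd
  have hclopen : IsClopen A := ⟨isOpen_compl_iff.1 hAc, hAo⟩
  by_contra hx
  rw [not_frequently] at hx
  obtain ⟨y, hy, hyN⟩ := hcomp x
  have hyA : y ∈ A := hclopen.connectedComponent_subset hx hy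
  exact hyA.self_of_nhds hyN

lemma IsGriffithsNegative.ae_det_ne_zero (hneg : h.IsGriffithsNegative)
    (hcomp : ∀ x : X, ∃ y ∈ connectedComponent x, h.IsNondegenerateAt y)
    {c : OpenPartialHomeomorph X (Fin n → ℂ)} (hc : c ∈ holomorphicCharts n X) {U : Set X}
    {e : Fin r → ∀ x, E x} (he : IsHolomorphicFrame (n := n) r e U) :
    ∀ᵐ z ∂volume.restrict (chartImage c U), (h.localMatrix c e z).det ≠ 0 := by
  rw [ae_restrict_iff' (isOpen_chartImage he.isOpen).measurableSet, ae_iff]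
  refine measure_null_of_locally_null _ fun z hz => ?_
  simp only [mem_ofPred_eq, Classical.not_imp] at hz
  obtain ⟨V, -, hVo, hzV, hae⟩ := hneg.exists_nhds_ae hc he hz.1
    (hneg.frequently_isNondegenerateAt hcomp _)
  refine ⟨_, inter_mem_nhdsWithin _ (hVo.mem_nhds hzV), measure_mono_null (fun y hy => ?_)
    (ae_iff.1 hae)⟩
  simp only [mem_inter_iff, mem_ofPred_eq, Classical.not_imp] at hy ⊢
  exact ⟨hy.2, hy.1.2⟩

end SingularHermitianMetric

/-! ### The assertions for matrix-valued functions on open subsets of ℂⁿ. -/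

section LocalResults

open Matrix
open scoped ComplexOrder

variable {n r : ℕ}

lemma IsAffinePSHOn.exists_representsDel {H : (Fin n → ℂ) → Matrix (Fin r) (Fin r) ℂ}
    {Ω : Set (Fin n → ℂ)} (hΩ : IsOpen Ω) (hH : ∀ z, (H z).PosSemidef) (hpsh : IsAffinePSHOn H Ω) :
    ∃ G : Fin n → (Fin n → ℂ) → Matrix (Fin r) (Fin r) ℂ, RepresentsDel H G Ω ∧
      ∀ j a b, IsLocallyL2On (fun z => G j z a b) Ω := by
  have key : ∀ (j : Fin n) (a b : Fin r), ∃ g : (Fin n → ℂ) → ℂ,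
      HasWeakWirtinger j (fun z => H z a b) g Ω ∧ IsLocallyL2On g Ω := by
    intro j a b
    obtain ⟨c, u, hcu⟩ := exists_polarization a b
    choose g hg hg2 using fun s => (hpsh.isPSHOn (u s)).exists_hasWeakWirtinger hΩ
      (fun z _ => quad_nonneg (hH z) (u s)) j
    refine ⟨fun z => ∑ s, c s * g s z, ?_,
      IsLocallyL2On.sum Finset.univ fun s => (hg2 s).const_mul (c s)⟩
    simp only [hcu _ (hH _).isHermitian]
    exact HasWeakWirtinger.sum Finset.univ fun s => (hg s).const_mul (c s)
  choose g hg hg2 using key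
  exact ⟨fun j z => Matrix.of fun a b => g j a b z, hg, hg2⟩

/-- Weak derivatives are unique almost everywhere, so every representative inherits the
integrability of the constructed one. -/
lemma RepresentsDel.isLocallyL2On {H : (Fin n → ℂ) → Matrix (Fin r) (Fin r) ℂ}
    {Ω : Set (Fin n → ℂ)} (hΩ : IsOpen Ω) (hH : ∀ z, (H z).PosSemidef) (hpsh : IsAffinePSHOn H Ω)
    {G : Fin n → (Fin n → ℂ) → Matrix (Fin r) (Fin r) ℂ} (hG : RepresentsDel H G Ω)
    (j : Fin n) (a b : Fin r) : IsLocallyL2On (fun z => G j z a b) Ω := by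
  obtain ⟨G₀, hG₀, hG₀2⟩ := hpsh.exists_representsDel hΩ hH
  exact (hG₀2 j a b).congr_ae ((hG₀ j a b).ae_eq hΩ (hG j a b))

/-- The matrix inverse is the adjugate times the inverse determinant, with value zero where the
determinant vanishes. Measurability and independence of the representative therefore do not depend
on invertibility. -/
lemma exists_measurable_connection {H : (Fin n → ℂ) → Matrix (Fin r) (Fin r) ℂ}
    {Ω : Set (Fin n → ℂ)} (hΩ : IsOpen Ω) (hH : ∀ z, (H z).PosSemidef)
    (hpsh : IsAffinePSHOn H Ω) :
    ∃ θ : Fin n → (Fin n → ℂ) → Matrix (Fin r) (Fin r) ℂ,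
      (∀ j a b, AEStronglyMeasurable (fun z => θ j z a b) (volume.restrict Ω)) ∧
      ∀ G, RepresentsDel H G Ω → ∀ j, ∀ᵐ z ∂volume.restrict Ω, θ j z = (H z)⁻¹ * G j z := by
  obtain ⟨G₀, hG₀, -⟩ := hpsh.exists_representsDel hΩ hH
  refine ⟨fun j z => (H z)⁻¹ * G₀ j z, fun j a b => ?_, fun G hG j => ?_⟩
  · have hHm : ∀ i k, AEMeasurable (fun z => H z i k) (volume.restrict Ω) := fun i k =>
      (hG₀ j i k).locallyIntegrable.aestronglyMeasurable.aemeasurable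
    have hGm : ∀ i k, AEMeasurable (fun z => G₀ j z i k) (volume.restrict Ω) := fun i k =>
      (hG₀ j i k).locallyIntegrable_deriv.aestronglyMeasurable.aemeasurable
    have hdet : ∀ A : (Fin n → ℂ) → Matrix (Fin r) (Fin r) ℂ,
        (∀ i k, AEMeasurable (fun z => A z i k) (volume.restrict Ω)) →
        AEMeasurable (fun z => (A z).det) (volume.restrict Ω) := fun A hA => by
      simp only [det_apply']
      exact Finset.aemeasurable_fun_sum _ fun σ _ => AEMeasurable.const_mul
        (Finset.aemeasurable_fun_prod _ fun i _ => hA _ _) _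
    have hadj : ∀ i k, AEMeasurable (fun z => (H z).adjugate i k) (volume.restrict Ω) :=
      fun i k => by
        simp only [adjugate_apply]
        refine hdet _ fun i' k' => ?_
        simp only [updateRow_apply]
        split_ifs
        · exact aemeasurable_const
        · exact hHm _ _
    have hinv : ∀ i k, AEMeasurable (fun z => (H z)⁻¹ i k) (volume.restrict Ω) := fun i k => by
      simp only [inv_def, Matrix.smul_apply, Ring.inverse_eq_inv', smul_eq_mul]
      exact (hdet H hHm).inv.mul (hadj i k)
    simp only [mul_apply]
    exact (Finset.aemeasurable_fun_sum _ fun i _ =>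
      (hinv a i).mul (hGm i b)).aestronglyMeasurable
  · have h1 : ∀ᵐ z ∂volume.restrict Ω, ∀ a b, G₀ j z a b = G j z a b :=
      ae_all_iff.2 fun a => ae_all_iff.2 fun b => (hG₀ j a b).ae_eq hΩ (hG j a b)
    filter_upwards [h1] with z hz
    rw [show G₀ j z = G j z from Matrix.ext hz]

lemma distWirtinger_sum_mul {ι : Type*} (s : Finset ι) {j : Fin n} {c : ι → ℂ}
    {f : ι → (Fin n → ℂ) → ℂ} {U : Set (Fin n → ℂ)} (hf : ∀ i, LocallyIntegrableOn (f i) U)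
    {φ : (Fin n → ℂ) → ℂ} (hφ : IsTestFunction U φ) :
    distWirtinger j (fun z => ∑ i ∈ s, c i * f i z) φ = ∑ i ∈ s, c i * distWirtinger j (f i) φ := by
  simp only [distWirtinger, Finset.sum_mul, mul_assoc]
  rw [integral_finsetSum _ fun i _ => (hφ.integrable_mul_wirtinger (hf i) j).const_mul (c i)]
  simp only [integral_const_mul, mul_neg, Finset.sum_neg_distrib]

/-- The derivative rests on φ, so dominated convergence applies, with `q 0` as the dominating
function. -/
lemma tendsto_distWirtinger_of_antitone {Ω : Set (Fin n → ℂ)} (hΩ : IsOpen Ω)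
    {q : ℕ → (Fin n → ℂ) → ℝ} {q₀ : (Fin n → ℂ) → ℝ} (hq : ∀ ν, IsPSHOn (q ν) Ω)
    (h0 : ∀ ν, ∀ z ∈ Ω, 0 ≤ q ν z) (hanti : ∀ z ∈ Ω, Antitone fun ν => q ν z)
    (hlim : ∀ z ∈ Ω, Tendsto (fun ν => q ν z) atTop (𝓝 (q₀ z))) (j : Fin n)
    {φ : (Fin n → ℂ) → ℂ} (hφ : IsTestFunction Ω φ) :
    Tendsto (fun ν => distWirtinger j (fun z => (q ν z : ℂ)) φ) atTop
      (𝓝 (distWirtinger j (fun z => (q₀ z : ℂ)) φ)) := by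
  have hi : ∀ ν, Integrable fun z => (q ν z : ℂ) * wirtinger j φ z := fun ν =>
    hφ.integrable_mul_wirtinger
      (LocallyIntegrableOn.complex_ofReal ((hq ν).locallyIntegrableOn hΩ (h0 ν))) j
  have hout : ∀ z ∉ Ω, wirtinger j φ z = 0 := fun z hz =>
    image_eq_zero_of_notMem_tsupport fun h =>
      hz (hφ.subset (tsupport_wirtinger_subset j φ h))
  refine (tendsto_integral_of_dominated_convergence (fun z => ‖(q 0 z : ℂ) * wirtinger j φ z‖)
    (fun ν => (hi ν).aestronglyMeasurable) (hi 0).norm (fun ν => Eventually.of_forall fun z => ?_)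
    (Eventually.of_forall fun z => ?_)).neg
  · by_cases hz : z ∈ Ω
    · rw [norm_mul, norm_mul, Complex.norm_real, Complex.norm_real,
        Real.norm_of_nonneg (h0 ν z hz), Real.norm_of_nonneg (h0 0 z hz)]
      gcongr
      exact hanti z hz (Nat.zero_le ν)
    · simp [hout z hz]
  · by_cases hz : z ∈ Ω
    · exact ((Complex.continuous_ofReal.tendsto _).comp (hlim z hz)).mul_const _
    · simp [hout z hz]

/-- All `q ν` lie between 0 and `q 0`, and the derivative estimate sees a function only through its
upper bound. -/
lemma exists_norm_distWirtinger_le {Ω U K : Set (Fin n → ℂ)} (hΩ : IsOpen Ω) (hK : IsCompact K)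
    (hUK : U ⊆ K) (hKΩ : K ⊆ Ω) {q : ℕ → (Fin n → ℂ) → ℝ} (hq : ∀ ν, IsPSHOn (q ν) Ω)
    (h0 : ∀ ν, ∀ z ∈ Ω, 0 ≤ q ν z) (hanti : ∀ z ∈ Ω, Antitone fun ν => q ν z) (j : Fin n) :
    ∃ C : ℝ, ∀ ν, ∀ φ : testFunctions U,
      ‖distWirtinger j (fun z => (q ν z : ℂ)) φ‖ ≤ C * ‖testToLp U φ‖ := by
  obtain ⟨L, hLΩ, hL, -, A, hA⟩ := exists_norm_integral_mul_wirtinger_le hΩ hK hKΩ j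
  obtain ⟨M, hM⟩ := (hq 0).exists_bound hL hLΩ
  refine ⟨A * M ^ 2 + 1, fun ν => ?_⟩
  refine norm_le_mul_norm_testToLp (distWirtingerLinear j
    ((LocallyIntegrableOn.complex_ofReal ((hq ν).locallyIntegrableOn hΩ (h0 ν))).mono_set
      (hUK.trans hKΩ))) fun φ => ?_
  have := hA (q ν) M (hq ν) (fun z hz => ⟨h0 ν z (hLΩ hz),
    (hanti z (hLΩ hz) (Nat.zero_le ν)).trans (hM z hz)⟩) φ φ.2.smooth φ.2.compact
    (φ.2.subset.trans hUK)
  simpa [distWirtingerLinear, distWirtinger] using this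

/-- Off-diagonal entries are not monotone in ν; polarization reduces both the uniform bound and the
convergence to quadratic forms, which are. -/
lemma weaklyL2TendstoOn_of_antitone {H : (Fin n → ℂ) → Matrix (Fin r) (Fin r) ℂ}
    {H' : ℕ → (Fin n → ℂ) → Matrix (Fin r) (Fin r) ℂ} {Ω : Set (Fin n → ℂ)} (hΩ : IsOpen Ω)
    (hH : ∀ z, (H z).PosSemidef) (hpsh : IsAffinePSHOn H Ω)
    (hH' : ∀ ν z, (H' ν z).PosSemidef) (hpsh' : ∀ ν, IsAffinePSHOn (H' ν) Ω)
    (hsm : ∀ ν a b, ContDiffOn ℝ ∞ (fun z => H' ν z a b) Ω)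
    (hdec : ∀ z ∈ Ω, ∀ v, (Antitone fun ν => quad (H' ν z) v) ∧
      Tendsto (fun ν => quad (H' ν z) v) atTop (𝓝 (quad (H z) v)))
    {G : Fin n → (Fin n → ℂ) → Matrix (Fin r) (Fin r) ℂ} (hG : RepresentsDel H G Ω)
    (j : Fin n) (a b : Fin r) :
    WeaklyL2TendstoOn (fun ν => wirtinger j (fun z => H' ν z a b)) (fun z => G j z a b) Ω := by
  obtain ⟨c, u, hcu⟩ := exists_polarization a b
  have hq : ∀ s ν, IsPSHOn (fun z => quad (H' ν z) (u s)) Ω := fun s ν => (hpsh' ν).isPSHOn _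
  have h0 : ∀ s ν, ∀ z ∈ Ω, 0 ≤ quad (H' ν z) (u s) := fun s ν z _ => quad_nonneg (hH' ν z) _
  have hli : ∀ s ν, LocallyIntegrableOn (fun z => (quad (H' ν z) (u s) : ℂ)) Ω := fun s ν =>
    LocallyIntegrableOn.complex_ofReal ((hq s ν).locallyIntegrableOn hΩ (h0 s ν))
  have hli₀ : ∀ s, LocallyIntegrableOn (fun z => (quad (H z) (u s) : ℂ)) Ω := fun s =>
    LocallyIntegrableOn.complex_ofReal ((hpsh.isPSHOn _).locallyIntegrableOn hΩ
      fun z _ => quad_nonneg (hH z) _)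
  have e : ∀ ν, (fun z => H' ν z a b) = fun z => ∑ s, c s * (quad (H' ν z) (u s) : ℂ) :=
    fun ν => funext fun z => hcu _ (hH' ν z).isHermitian
  have e₀ : (fun z => H z a b) = fun z => ∑ s, c s * (quad (H z) (u s) : ℂ) :=
    funext fun z => hcu _ (hH z).isHermitian
  refine weaklyL2TendstoOn_wirtinger hΩ (fun ν => hsm ν a b) (hG j a b)
    (hG.isLocallyL2On hΩ hH hpsh j a b) (fun U K hU hK hUK hKΩ => ?_) fun φ hφ => ?_
  · choose C hC using fun s => exists_norm_distWirtinger_le hΩ hK hUK hKΩ (hq s) (h0 s)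
      (fun z hz => (hdec z hz (u s)).1) j
    refine ⟨∑ s, ‖c s‖ * C s, fun ν φ => ?_⟩
    rw [e, distWirtinger_sum_mul _ (fun s => (hli s ν).mono_set (hUK.trans hKΩ)) φ.2,
      Finset.sum_mul]
    refine norm_sum_le_of_le _ fun s _ => ?_
    rw [norm_mul, mul_assoc]
    exact mul_le_mul_of_nonneg_left (hC s ν φ) (norm_nonneg _)
  · simp only [e]
    rw [e₀, distWirtinger_sum_mul _ hli₀ hφ]
    simp only [distWirtinger_sum_mul _ (fun s => hli s _) hφ]
    exact tendsto_finsetSum _ fun s _ => (tendsto_distWirtinger_of_antitone hΩ (hq s) (h0 s)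
      (fun z hz => (hdec z hz (u s)).1) (fun z hz => (hdec z hz (u s)).2) j hφ).const_mul _

end LocalResults

end GriffithsMetric

theorem proposition1p4 {n r : ℕ}
    {X : Type*} [TopologicalSpace X] [ChartedSpace (Fin n → ℂ) X]
    [IsManifold 𝓘(ℂ, Fin n → ℂ) ω X] [MeasurableSpace X] [BorelSpace X]
    {E : X → Type*} [TopologicalSpace (TotalSpace (Fin r → ℂ) E)] [∀ x, TopologicalSpace (E x)]
    [∀ x, AddCommGroup (E x)] [∀ x, Module ℂ (E x)] [FiberBundle (Fin r → ℂ) E]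
    [VectorBundle ℂ (Fin r → ℂ) E] [ContMDiffVectorBundle ω (Fin r → ℂ) E 𝓘(ℂ, Fin n → ℂ)]
    (h : SingularHermitianMetric (n := n) r E) (hneg : h.IsGriffithsNegative) :
    -- the current `∂h` is locally an `L²`-valued form
    (∀ c ∈ holomorphicCharts n X, ∀ (U : Set X) (e : Fin r → ∀ x, E x),
      IsHolomorphicFrame (n := n) r e U →
      ∃ G : Fin n → (Fin n → ℂ) → Matrix (Fin r) (Fin r) ℂ,
        RepresentsDel (h.localMatrix c e) G (chartImage c U) ∧
        ∀ j a b, IsLocallyL2On (fun z => G j z a b) (chartImage c U)) ∧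
    -- if `det h` does not vanish identically (on any component of `X`), then `h` is invertible
    -- almost everywhere and `θ = h⁻¹ ∂h` is an a.e. well-defined matrix of `(1,0)`-forms
    ((∀ x : X, ∃ y ∈ connectedComponent x, h.IsNondegenerateAt y) →
      ∀ c ∈ holomorphicCharts n X, ∀ (U : Set X) (e : Fin r → ∀ x, E x),
      IsHolomorphicFrame (n := n) r e U →
      (∀ᵐ z ∂(volume.restrict (chartImage c U)), (h.localMatrix c e z).det ≠ 0) ∧
      ∃ θ : Fin n → (Fin n → ℂ) → Matrix (Fin r) (Fin r) ℂ,
        (∀ j a b, AEStronglyMeasurable (fun z => θ j z a b)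
          (volume.restrict (chartImage c U))) ∧
        ∀ G, RepresentsDel (h.localMatrix c e) G (chartImage c U) →
          ∀ j, ∀ᵐ z ∂(volume.restrict (chartImage c U)),
            θ j z = (h.localMatrix c e z)⁻¹ * G j z) ∧
    -- `∂h_ν` converges weakly in `L²` to `∂h` for smooth Griffiths negative `h_ν` decreasing to `h`
    (∀ (W : Set X), IsOpen W → ∀ h' : ℕ → SingularHermitianMetric (n := n) r E,
      (∀ ν, (h' ν).IsSmoothOn W) → (∀ ν, (h' ν).IsGriffithsNegativeOn W) →
      SingularHermitianMetric.DecreasesToOn h' h W →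
      ∀ c ∈ holomorphicCharts n X, ∀ U ⊆ W, ∀ e : Fin r → ∀ x, E x,
      IsHolomorphicFrame (n := n) r e U →
      ∀ G, RepresentsDel (h.localMatrix c e) G (chartImage c U) →
      ∀ j a b, WeaklyL2TendstoOn
        (fun ν => wirtinger j (fun z => (h' ν).localMatrix c e z a b))
        (fun z => G j z a b) (chartImage c U)) := by
  refine ⟨fun c hc U e he => ?_, fun hcomp c hc U e he => ?_,
    fun W hW h' hsm hneg' hdec c hc U hU e he G hG j a b => ?_⟩
  · exact (SingularHermitianMetric.IsGriffithsNegativeOn.isAffinePSHOn hneg hc (subset_univ U)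
      he).exists_representsDel (isOpen_chartImage he.isOpen) (h.posSemidef_localMatrix c e)
  · exact ⟨SingularHermitianMetric.IsGriffithsNegative.ae_det_ne_zero hneg hcomp hc he,
      exists_measurable_connection (isOpen_chartImage he.isOpen) (h.posSemidef_localMatrix c e)
        (SingularHermitianMetric.IsGriffithsNegativeOn.isAffinePSHOn hneg hc (subset_univ U) he)⟩
  · refine weaklyL2TendstoOn_of_antitone (H' := fun ν => (h' ν).localMatrix c e)
      (isOpen_chartImage he.isOpen) (h.posSemidef_localMatrix c e)
      (SingularHermitianMetric.IsGriffithsNegativeOn.isAffinePSHOn hneg hc (subset_univ U) he)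
      (fun ν => (h' ν).posSemidef_localMatrix c e) (fun ν => (hneg' ν).isAffinePSHOn hc hU he)
      (fun ν => hsm ν c hc U hU e he) (fun z hz v => ?_) hG j a b
    simp only [SingularHermitianMetric.quad_localMatrix]
    exact hdec _ (hU hz.2) _
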